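/- Let $N,m$ be integers and $\alpha,\gamma$ real numbers with $$1\le m\le N,\qquad 0<\gamma<N,\qquad 0<\alpha<\frac{2}{\gamma+m}.$$ Let $\Omega=\{x\in\mathbb R^N:\ x_1>0,\dots,x_m>0\}$ and $\psi_0(x)=(-1)^m\partial_1\cdots\partial_m\left(|x|^{-\gamma}\right)$ for $x\in\Omega$. A function is called anti-symmetric if it changes sign under each of the reflections $x_i\mapsto -x_i$, $1\le i\le m$. Let $G_t(x)=(4\pi t)^{-N/2}e^{-|x|^2/(4t)}$ and $e^{t\Delta}U=G_t\star U$ for a tempered distribution $U$, and let $e^{t\Delta_\Omega}$ be the Dirichlet heat semigroup of $\Omega$, with kernel $(4\pi t)^{-N/2}\prod_{j>m}e^{-(x_j-y_j)^2/(4t)}\prod_{i\le m}\left[e^{-(x_i-y_i)^2/(4t)}-e^{-(x_i+y_i)^2/(4t)}\right]$. Let $u_0\in L^1_{loc}(\mathbb R^N\setminus\{0\})$ be real-valued and anti-symmetric with $|u_0|\le C\psi_0$ on $\Omega$ for some constant $C>0$. Then $u_0$ defines a tempered distribution, again denoted $u_0$, by $\langle u_0,\varphi\rangle=\lim_{\varepsilon\to0}\int_{|x|>\varepsilon}u_0\varphi\,dx$,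 and the following holds for $a=1$ and for $a=-1$. Consider the integral equation $$u(t)=e^{t\Delta}u_0+a\int_0^t e^{(t-\sigma)\Delta}\left[|u(\sigma)|^\alpha u(\sigma)\right]d\sigma, \qquad (*)$$ where the integral is required to converge absolutely in $C_0(\mathbb R^N)$. By a solution on an interval $J=(0,T]$ or $(0,T)$ we mean a continuous $u:J\to C_0(\mathbb R^N)$ satisfying $(*)$ for all $t\in J$, such that every $u(t)$ is anti-symmetric and, for some $M$ and all small $t$, $|u(t)|\le M e^{t\Delta_\Omega}\psi_0$ on $\Omega$. Let $T_{\max}(u_0)\in[0,\infty]$ be the supremum of the $T>0$ such that a solution on $(0,T]$ exists. (1) There are $T>0$ and a solution $u$ on $(0,T]$, and $u(t)\to u_0$ in $\mathcal S'(\mathbb R^N)$ as $t\to0$. If $u_0\ge0$ a.e. on $\Omega$ and $u_0$ does not vanish a.e. on $\Omega$, then $u(t,x)>0$ for all $t\in(0,T]$ and $x\in\Omega$. (2) $T<T_{\max}(u_0)$, and $u$ extends to a solution on $(0,T_{\max}(u_0))$. This is maximal: if a solution on $(0,T']$ exists, then $T'<T_{\max}(u_0)$. Any two solutions on the same interval $(0,T']$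 coincide. (3) If $a=-1$, then $T_{\max}(u_0)=\infty$. If $a=1$, then $$\liminf_{\lambda\to0^+}\lambda^{\left(\frac1\alpha-\frac{\gamma+m}{2}\right)^{-1}}T_{\max}(\lambda u_0)>0.$$ -/

import Mathlib

open MeasureTheory Set Filter Topology
open scoped SchwartzMap ENNReal ContDiff ZeroAtInfty

noncomputable section

/-- `ℝ^N` with its Euclidean norm. -/
abbrev Eucl (N : ℕ) : Type := EuclideanSpace ℝ (Fin N)

/-- The Gauss kernel `G_t(x) = (4πt)^{-N/2} exp(-|x|²/(4t))`. -/
def gaussKernel {N : ℕ} (t : ℝ) (x : Eucl N) : ℝ :=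
  (4 * Real.pi * t) ^ (-(N : ℝ) / 2) * Real.exp (-‖x‖ ^ 2 / (4 * t))

theorem one_add_norm_pow_mul_exp_le {E : Type*} [NormedAddCommGroup E] {b : ℝ} (hb : 0 < b)
    (x y : E) (p : ℕ) :
    (1 + ‖y‖) ^ p * Real.exp (-b * ‖x - y‖ ^ 2) ≤
      (1 + ‖x‖) ^ p * (p.factorial * Real.exp (1 + 1 / (4 * b))) := by
  set r := ‖x - y‖ with hr
  have hr0 : 0 ≤ r := norm_nonneg _
  have hx0 : 0 ≤ ‖x‖ := norm_nonneg _
  have h1 : 1 + ‖y‖ ≤ (1 + ‖x‖) * (1 + r) := by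
    have : ‖y‖ ≤ ‖x‖ + r := by
      have h := norm_sub_le x (x - y)
      simpa using h
    nlinarith
  have h2 : (1 + r) ^ p ≤ p.factorial * Real.exp (1 + r) := by
    have h := Real.pow_div_factorial_le_exp (x := 1 + r) (by linarith) p
    have hp : (0 : ℝ) < p.factorial := by exact_mod_cast p.factorial_pos
    rw [div_le_iff₀ hp] at h
    linarith
  have h3 : 1 + r + -b * r ^ 2 ≤ 1 + 1 / (4 * b) := by
    have : 1 / (4 * b) - r + b * r ^ 2 = (1 - 2 * b * r) ^ 2 / (4 * b) := by
      field_simp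
      ring
    have h4 : 0 ≤ (1 - 2 * b * r) ^ 2 / (4 * b) := by positivity
    linarith
  calc (1 + ‖y‖) ^ p * Real.exp (-b * r ^ 2)
      ≤ ((1 + ‖x‖) * (1 + r)) ^ p * Real.exp (-b * r ^ 2) := by gcongr
    _ = (1 + ‖x‖) ^ p * ((1 + r) ^ p * Real.exp (-b * r ^ 2)) := by rw [mul_pow, mul_assoc]
    _ ≤ (1 + ‖x‖) ^ p * ((p.factorial * Real.exp (1 + r)) * Real.exp (-b * r ^ 2)) := by gcongr
    _ = (1 + ‖x‖) ^ p * (p.factorial * Real.exp (1 + r + -b * r ^ 2)) := by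
        rw [Real.exp_add (1 + r)]; ring
    _ ≤ _ := by gcongr

theorem exp_neg_norm_sub_sq_decay {E : Type*} [NormedAddCommGroup E] [InnerProductSpace ℝ E]
    {b : ℝ} (hb : 0 < b) (x : E) (k n : ℕ) :
    ∃ C : ℝ, ∀ y, ‖y‖ ^ k *
      ‖iteratedFDeriv ℝ n (fun y : E => Real.exp (-b * ‖x - y‖ ^ 2)) y‖ ≤ C := by
  have hf : Function.HasTemperateGrowth (fun y : E => -b * ‖x - y‖ ^ 2) :=
    (Function.HasTemperateGrowth.const (-b)).mul
      (Function.HasTemperateGrowth.comp (Function.hasTemperateGrowth_norm_sq (H := E))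
        ((Function.HasTemperateGrowth.const x).sub Function.HasTemperateGrowth.id))
  obtain ⟨l, A, hA, hbd⟩ := hf.norm_iteratedFDeriv_le_uniform n
  have hbound : ∀ y : E, ‖iteratedFDeriv ℝ n (fun y : E => Real.exp (-b * ‖x - y‖ ^ 2)) y‖ ≤
      n.factorial * Real.exp (-b * ‖x - y‖ ^ 2) * ((1 + A) * (1 + ‖y‖) ^ l) ^ n := by
    intro y
    have hD1 : 1 ≤ (1 + A) * (1 + ‖y‖) ^ l := by
      have : 1 ≤ (1 + ‖y‖) ^ l := one_le_pow₀ (by linarith [norm_nonneg y])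
      nlinarith
    refine norm_iteratedFDeriv_comp_le (g := Real.exp) (f := fun y : E => -b * ‖x - y‖ ^ 2)
      (N := ∞) Real.contDiff_exp hf.1 (by exact_mod_cast le_top) y ?_ ?_
    · intro i _
      rw [norm_iteratedFDeriv_eq_norm_iteratedDeriv, iteratedDeriv_eq_iterate,
        Real.iter_deriv_exp, Real.norm_eq_abs, Real.abs_exp]
    · intro i hi hin
      refine (hbd i hin y).trans ?_
      calc A * (1 + ‖y‖) ^ l ≤ (1 + A) * (1 + ‖y‖) ^ l := by
            gcongr; linarith
        _ ≤ _ := le_self_pow₀ hD1 (by omega)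
  refine ⟨n.factorial * (1 + A) ^ n * ((1 + ‖x‖) ^ (k + l * n) *
    ((k + l * n).factorial * Real.exp (1 + 1 / (4 * b)))), fun y => ?_⟩
  have hk : ‖y‖ ^ k ≤ (1 + ‖y‖) ^ k := by gcongr; linarith
  calc ‖y‖ ^ k * ‖iteratedFDeriv ℝ n (fun y : E => Real.exp (-b * ‖x - y‖ ^ 2)) y‖
      ≤ (1 + ‖y‖) ^ k * (n.factorial * Real.exp (-b * ‖x - y‖ ^ 2) *
          ((1 + A) * (1 + ‖y‖) ^ l) ^ n) := by
        gcongr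
        exact hbound y
    _ = n.factorial * (1 + A) ^ n *
          ((1 + ‖y‖) ^ (k + l * n) * Real.exp (-b * ‖x - y‖ ^ 2)) := by
        rw [mul_pow, ← pow_mul, pow_add]; ring
    _ ≤ _ := mul_le_mul_of_nonneg_left (one_add_norm_pow_mul_exp_le hb x y _) (by positivity)

/-- The Schwartz function `y ↦ exp(-|x-y|²/(4t))`. -/
def gaussSchwartzAux {N : ℕ} {t : ℝ} (ht : 0 < t) (x : Eucl N) : 𝓢(Eucl N, ℝ) where
  toFun y := Real.exp (-(1 / (4 * t)) * ‖x - y‖ ^ 2)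
  smooth' := by
    have : ContDiff ℝ ∞ (fun y : Eucl N => ‖x - y‖ ^ 2) :=
      (contDiff_const.sub contDiff_id).norm_sq ℝ
    exact (contDiff_const.mul this).exp
  decay' := exp_neg_norm_sub_sq_decay (by positivity) x

/-- The Schwartz function `y ↦ G_t(x-y)`. -/
def gaussSchwartz {N : ℕ} {t : ℝ} (ht : 0 < t) (x : Eucl N) : 𝓢(Eucl N, ℂ) :=
  ((4 * Real.pi * t) ^ (-(N : ℝ) / 2)) •
    SchwartzMap.postcompCLM (𝕜 := ℝ) Complex.ofRealCLM (gaussSchwartzAux ht x)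

theorem gaussSchwartz_apply {N : ℕ} {t : ℝ} (ht : 0 < t) (x y : Eucl N) :
    gaussSchwartz ht x y = (gaussKernel t (x - y) : ℂ) := by
  have h : gaussSchwartzAux ht x y = Real.exp (-(1 / (4 * t)) * ‖x - y‖ ^ 2) := rfl
  have h2 : -(1 / (4 * t)) * ‖x - y‖ ^ 2 = -‖x - y‖ ^ 2 / (4 * t) := by ring
  simp only [gaussSchwartz, smul_apply, SchwartzMap.postcompCLM_apply, h, h2,
    gaussKernel, Complex.ofRealCLM_apply, Complex.real_smul, Complex.ofReal_mul]

/-- The heat semigroup on tempered distributions, `(e^{tΔ}U)(x) = (G_t ⋆ U)(x) = ⟨U, G_t(x-·)⟩`,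
for `t > 0`. -/
def heatDist {N : ℕ} (t : ℝ) (U : 𝓢'(Eucl N, ℂ)) (x : Eucl N) : ℂ :=
  if ht : 0 < t then U (gaussSchwartz ht x) else 0

/-- The heat semigroup on functions, `(e^{tΔ}f)(x) = (G_t ⋆ f)(x)`. -/
def heatFun {N : ℕ} (t : ℝ) (f : Eucl N → ℝ) (x : Eucl N) : ℝ :=
  ∫ y, gaussKernel t (x - y) * f y

/-- The sector `Ω = {x_1 > 0, …, x_m > 0}`. -/
def sector (N m : ℕ) : Set (Eucl N) := {x | ∀ i : Fin N, (i : ℕ) < m → 0 < x i}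

/-- The reflection `x_i ↦ -x_i`. -/
def reflectCoord {N : ℕ} (i : Fin N) (x : Eucl N) : Eucl N :=
  WithLp.toLp 2 (Function.update (fun j => x j) i (-x i))

/-- `f` is anti-symmetric in `x_1, …, x_m` (everywhere). -/
def AntisymmIn {N : ℕ} (m : ℕ) (f : Eucl N → ℝ) : Prop :=
  ∀ i : Fin N, (i : ℕ) < m → ∀ x, f (reflectCoord i x) = -f x

/-- `f` is anti-symmetric in `x_1, …, x_m` (almost everywhere). -/
def AntisymmInAE {N : ℕ} (m : ℕ) (f : Eucl N → ℝ) : Prop :=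
  ∀ i : Fin N, (i : ℕ) < m → ∀ᵐ x, f (reflectCoord i x) = -f x

/-- `ψ₀(x) = (-1)^m ∂_1 ⋯ ∂_m |x|^{-γ}`, as a pointwise derivative; it is used on `Ω` only. -/
def psiZero {N m : ℕ} (hm : m ≤ N) (γ : ℝ) (x : Eucl N) : ℝ :=
  (-1) ^ m * iteratedFDeriv ℝ m (fun y : Eucl N => ‖y‖ ^ (-γ)) x
    (fun i : Fin m => EuclideanSpace.single (Fin.castLE hm i) (1 : ℝ))

/-- The Dirichlet heat kernel of the sector `Ω`. -/
def sectorKernel {N : ℕ} (m : ℕ) (t : ℝ) (x y : Eucl N) : ℝ :=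
  (4 * Real.pi * t) ^ (-(N : ℝ) / 2) *
    ∏ i : Fin N, if (i : ℕ) < m then
        Real.exp (-(x i - y i) ^ 2 / (4 * t)) - Real.exp (-(x i + y i) ^ 2 / (4 * t))
      else Real.exp (-(x i - y i) ^ 2 / (4 * t))

/-- `Ψ(t) = e^{tΔ_Ω} ψ₀`: the solution on `Ω` of the linear heat equation with initial
value `ψ₀`. -/
def bigPsi {N m : ℕ} (hm : m ≤ N) (γ t : ℝ) (x : Eucl N) : ℝ :=
  ∫ y in sector N m, sectorKernel m t x y * psiZero hm γ y

/-- `U` is the tempered distribution given by the function `u₀`, which may have a non-integrable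
singularity at the origin: `⟨U, φ⟩ = lim_{ε → 0} ∫_{|x| > ε} u₀ φ`. -/
def IsTemperedExtension {N : ℕ} (u₀ : Eucl N → ℝ) (U : 𝓢'(Eucl N, ℂ)) : Prop :=
  ∀ φ : 𝓢(Eucl N, ℂ),
    (∀ ε > 0, IntegrableOn (fun x => (u₀ x : ℂ) * φ x) {x | ε < ‖x‖}) ∧
    Tendsto (fun ε : ℝ => ∫ x in {x : Eucl N | ε < ‖x‖}, (u₀ x : ℂ) * φ x) (𝓝[>] 0) (𝓝 (U φ))

/-- `u(t) → U` in `𝓢'` as `t → 0`. -/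
def TendstoInitial {N : ℕ} (u : ℝ → C₀(Eucl N, ℝ)) (U : 𝓢'(Eucl N, ℂ)) : Prop :=
  ∀ φ : 𝓢(Eucl N, ℂ), Tendsto (fun t => ∫ x, (u t x : ℂ) * φ x) (𝓝[>] 0) (𝓝 (U φ))

/-- The nonlinearity `|v|^α v`. -/
def nonlin {N : ℕ} (α : ℝ) (v : Eucl N → ℝ) (y : Eucl N) : ℝ := |v y| ^ α * v y

/-- `u : J → C_0(ℝ^N)` is continuous and solves
`u(t) = e^{tΔ}U + a ∫_0^t e^{(t-σ)Δ}[|u(σ)|^α u(σ)] dσ` for all `t ∈ J`, the integral being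
absolutely convergent in the sup norm. Here `J` is an interval `(0,T]` or `(0,T)`. -/
structure IsMildSolution {N : ℕ} (a α : ℝ) (U : 𝓢'(Eucl N, ℂ)) (J : Set ℝ)
    (u : ℝ → C₀(Eucl N, ℝ)) : Prop where
  cont : ContinuousOn u J
  abs_conv : ∀ t ∈ J,
    IntegrableOn (fun σ => ⨆ x, |heatFun (t - σ) (nonlin α (u σ)) x|) (Ioo 0 t)
  eqn : ∀ t ∈ J, ∀ x, (u t x : ℂ) = heatDist t U x +
    ((a * ∫ σ in Ioo 0 t, heatFun (t - σ) (nonlin α (u σ)) x : ℝ) : ℂ)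

/-- Solutions anti-symmetric in `x_1, …, x_m` that are bounded on `Ω`, for small `t`, by a multiple
of `Ψ(t)`. Uniqueness holds in this class, and the maximal existence time refers to it. -/
structure IsSectorSolution {N m : ℕ} (hm : m ≤ N) (γ a α : ℝ) (U : 𝓢'(Eucl N, ℂ)) (J : Set ℝ)
    (u : ℝ → C₀(Eucl N, ℝ)) : Prop extends IsMildSolution a α U J u where
  antisymm : ∀ t ∈ J, AntisymmIn m (u t)
  bound : ∃ τ > 0, ∃ M : ℝ, ∀ t ∈ J, t ≤ τ → ∀ x ∈ sector N m, |u t x| ≤ M * bigPsi hm γ t x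

/-- The maximal existence time `T_max(U) ∈ [0,∞]`. -/
def maxTime {N m : ℕ} (hm : m ≤ N) (γ a α : ℝ) (U : 𝓢'(Eucl N, ℂ)) : ℝ≥0∞ :=
  ⨆ T ∈ {T : ℝ | 0 < T ∧ ∃ u, IsSectorSolution hm γ a α U (Ioc 0 T) u}, ENNReal.ofReal T

end

/-! ### Sign changes of coordinates -/

/-- The isometry changing the sign of the coordinates in `S`. -/
noncomputable def signFlip {N : ℕ} (S : Finset (Fin N)) : Eucl N ≃ₗᵢ[ℝ] Eucl N :=
  LinearIsometryEquiv.piLpCongrRight 2 fun i =>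
    if i ∈ S then LinearIsometryEquiv.neg ℝ else LinearIsometryEquiv.refl ℝ ℝ

/-- The indices of the first `m` coordinates. -/
def headCoords (N m : ℕ) : Finset (Fin N) := Finset.univ.filter fun i => (i : ℕ) < m

section SignFlip

variable {N m : ℕ}

@[simp]
theorem mem_headCoords {i : Fin N} : i ∈ headCoords N m ↔ (i : ℕ) < m := by
  simp [headCoords]

theorem card_headCoords (hm : m ≤ N) : (headCoords N m).card = m := by
  have : headCoords N m = Finset.univ.map (Fin.castLEEmb hm) := by
    ext i
    simp only [mem_headCoords, Finset.mem_map, Finset.mem_univ, true_and]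
    constructor
    · intro h
      exact ⟨⟨i, h⟩, by ext; simp⟩
    · rintro ⟨j, rfl⟩
      simp
  rw [this]
  simp

theorem signFlip_apply (S : Finset (Fin N)) (x : Eucl N) (i : Fin N) :
    signFlip S x i = if i ∈ S then -x i else x i := by
  simp only [signFlip, LinearIsometryEquiv.piLpCongrRight_apply]
  split_ifs <;> simp

@[simp]
theorem signFlip_signFlip (S : Finset (Fin N)) (x : Eucl N) : signFlip S (signFlip S x) = x := by
  ext i
  simp only [signFlip_apply]
  split_ifs <;> simp

@[simp]
theorem signFlip_empty (x : Eucl N) : signFlip ∅ x = x := by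
  ext i
  simp [signFlip_apply]

theorem reflectCoord_apply (i : Fin N) (x : Eucl N) (j : Fin N) :
    reflectCoord i x j = if j = i then -x j else x j := by
  by_cases h : j = i
  · subst h; simp [reflectCoord]
  · simp [reflectCoord, h]

theorem reflectCoord_eq_signFlip (i : Fin N) (x : Eucl N) : reflectCoord i x = signFlip {i} x := by
  ext j
  simp [signFlip_apply, reflectCoord_apply]

theorem signFlip_insert {S : Finset (Fin N)} {i : Fin N} (hi : i ∉ S) (x : Eucl N) :
    signFlip (insert i S) x = signFlip S (reflectCoord i x) := by
  ext j
  simp only [signFlip_apply, reflectCoord_apply, Finset.mem_insert]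
  by_cases h : j = i
  · subst h; simp [hi]
  · simp [h]

theorem measurePreserving_signFlip (S : Finset (Fin N)) :
    MeasurePreserving (signFlip S : Eucl N → Eucl N) :=
  (signFlip S).measurePreserving

theorem AntisymmIn.apply_signFlip {f : Eucl N → ℝ} (hf : AntisymmIn m f) {S : Finset (Fin N)}
    (hS : S ⊆ headCoords N m) (x : Eucl N) : f (signFlip S x) = (-1) ^ S.card * f x := by
  induction S using Finset.induction_on generalizing x with
  | empty => simp
  | insert i S hi ih =>
    have h1 : S ⊆ headCoords N m := (Finset.subset_insert _ _).trans hS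
    have h2 : (i : ℕ) < m := mem_headCoords.1 (hS (Finset.mem_insert_self _ _))
    rw [signFlip_insert hi, ih h1, hf i h2, Finset.card_insert_of_notMem hi]
    ring

theorem AntisymmInAE.apply_signFlip {f : Eucl N → ℝ} (hf : AntisymmInAE m f) {S : Finset (Fin N)}
    (hS : S ⊆ headCoords N m) : ∀ᵐ x, f (signFlip S x) = (-1) ^ S.card * f x := by
  induction S using Finset.induction_on with
  | empty => simp
  | insert i S hi ih =>
    have h1 : S ⊆ headCoords N m := (Finset.subset_insert _ _).trans hS
    have h2 : (i : ℕ) < m := mem_headCoords.1 (hS (Finset.mem_insert_self _ _))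
    have h3 := (measurePreserving_signFlip (N := N) {i}).quasiMeasurePreserving.ae (ih h1)
    filter_upwards [h3, hf i h2] with x hx hx2
    rw [signFlip_insert hi, reflectCoord_eq_signFlip, hx, ← reflectCoord_eq_signFlip, hx2,
      Finset.card_insert_of_notMem hi]
    ring

theorem antisymmIn_of_apply_signFlip {f : Eucl N → ℝ}
    (h : ∀ i : Fin N, (i : ℕ) < m → ∀ x, f (signFlip {i} x) = -f x) : AntisymmIn m f :=
  fun i hi x => by rw [reflectCoord_eq_signFlip, h i hi]

theorem AntisymmIn.eq_zero {f : Eucl N → ℝ} (hf : AntisymmIn m f) {x : Eucl N} {i : Fin N}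
    (hi : (i : ℕ) < m) (hx : x i = 0) : f x = 0 := by
  have h : reflectCoord i x = x := by
    ext j
    rw [reflectCoord_apply]
    split_ifs with h
    · subst h; simp [hx]
    · rfl
  have := hf i hi x
  rw [h] at this
  linarith

theorem isOpen_sector : IsOpen (sector N m) := by
  have : sector N m = ⋂ i : Fin N, {x | (i : ℕ) < m → 0 < x i} := by
    ext x; simp [sector]
  rw [this]
  refine isOpen_iInter_of_finite fun i => ?_
  by_cases h : (i : ℕ) < m
  · simp only [h, forall_const]
    exact isOpen_lt continuous_const (by fun_prop)
  · simp [h]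

theorem measurableSet_sector : MeasurableSet (sector N m) := isOpen_sector.measurableSet

theorem sector_ne_zero (hm1 : 1 ≤ m) (hm : m ≤ N) {x : Eucl N} (hx : x ∈ sector N m) : x ≠ 0 := by
  rintro rfl
  have := hx ⟨0, by omega⟩ (by simp; omega)
  simp at this

theorem ae_coord_ne_zero : ∀ᵐ x : Eucl N, ∀ i, x i ≠ 0 := by
  rw [ae_all_iff]
  intro i
  have h := Measure.addHaar_submodule (volume : Measure (Eucl N))
    (LinearMap.ker (EuclideanSpace.proj i : Eucl N →L[ℝ] ℝ).toLinearMap) (by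
      intro h
      have h2 : (EuclideanSpace.single i (1 : ℝ) : Eucl N) ∈
        LinearMap.ker (EuclideanSpace.proj i : Eucl N →L[ℝ] ℝ).toLinearMap := by rw [h]; trivial
      simp at h2)
  rw [ae_iff]
  convert h using 2
  ext x
  simp

/-- The sign pattern taking a point without vanishing coordinates into the sector. -/
theorem signFlip_mem_sector {S : Finset (Fin N)} (hS : S ⊆ headCoords N m) {x : Eucl N}
    (hx : ∀ i, x i ≠ 0) :
    signFlip S x ∈ sector N m ↔ S = (headCoords N m).filter fun i => x i < 0 := by
  constructor
  · intro h
    ext i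
    simp only [Finset.mem_filter, mem_headCoords]
    constructor
    · intro hi
      have h1 := mem_headCoords.1 (hS hi)
      have h2 := h i h1
      rw [signFlip_apply, if_pos hi] at h2
      exact ⟨h1, by linarith⟩
    · rintro ⟨h1, h2⟩
      by_contra hi
      have h3 := h i h1
      rw [signFlip_apply, if_neg hi] at h3
      linarith
  · rintro rfl i hi
    rw [signFlip_apply]
    simp only [Finset.mem_filter, mem_headCoords, hi, true_and]
    split_ifs with h
    · linarith
    · exact lt_of_le_of_ne (not_lt.1 h) (hx i).symm

theorem exists_signFlip_mem_sector (m : ℕ) {x : Eucl N} (hx : ∀ i, x i ≠ 0) :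
    ∃ S ⊆ headCoords N m, signFlip S x ∈ sector N m :=
  ⟨_, Finset.filter_subset _ _, (signFlip_mem_sector (Finset.filter_subset _ _) hx).2 rfl⟩

theorem integrableOn_signFlip_comp {V : Type*} [NormedAddCommGroup V] {F : Eucl N → V}
    (hF : Integrable F) (S : Finset (Fin N)) (A : Set (Eucl N)) :
    IntegrableOn (fun y => F (signFlip S y)) A :=
  ((measurePreserving_signFlip S).integrable_comp_of_integrable hF).integrableOn

/-- Folding the space onto the sector. -/
theorem integral_eq_setIntegral_sector_sum {V : Type*} [NormedAddCommGroup V] [NormedSpace ℝ V]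
    {F : Eucl N → V} (hF : Integrable F) :
    ∫ x, F x = ∫ y in sector N m, ∑ S ∈ (headCoords N m).powerset, F (signFlip S y) := by
  rw [integral_finsetSum _ fun S _ => integrableOn_signFlip_comp hF S _]
  have h1 : ∀ S : Finset (Fin N), ∫ y in sector N m, F (signFlip S y) =
      ∫ y in signFlip S ⁻¹' sector N m, F y := by
    intro S
    rw [← (measurePreserving_signFlip S).setIntegral_preimage_emb
      (signFlip S).toHomeomorph.measurableEmbedding F]
    congr 2
    ext x
    simp
  simp_rw [h1]
  have hmeas : ∀ S : Finset (Fin N), MeasurableSet (signFlip S ⁻¹' sector N m) := fun S =>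
    measurableSet_sector.preimage (signFlip S).continuous.measurable
  set B : Set (Eucl N) := {x | ∀ i, x i ≠ 0} with hB
  have hBae : B =ᵐ[volume] (univ : Set (Eucl N)) := by
    rw [eventuallyEq_univ]; exact ae_coord_ne_zero
  have hBm : MeasurableSet B := by
    have : B = ⋂ i, {x : Eucl N | x i ≠ 0} := by ext; simp [hB]
    rw [this]
    refine MeasurableSet.iInter fun i => ?_
    exact (isOpen_ne_fun (by fun_prop) continuous_const).measurableSet
  have h2 : ∀ S : Finset (Fin N), ∫ y in signFlip S ⁻¹' sector N m, F y =
      ∫ y in (signFlip S ⁻¹' sector N m) ∩ B, F y := fun S =>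
    setIntegral_congr_set (by
      have := (ae_eq_refl (signFlip S ⁻¹' sector N m)).inter hBae
      simpa using this.symm)
  simp_rw [h2]
  rw [← integral_biUnion_finset _ (fun S _ => (hmeas S).inter hBm) _
    (fun S _ => hF.integrableOn)]
  · rw [← setIntegral_univ]
    refine setIntegral_congr_set (hBae.symm.trans ?_)
    refine Eq.eventuallyEq (Set.ext fun x => ?_)
    simp only [mem_iUnion, mem_inter_iff, exists_prop, Finset.mem_powerset, mem_preimage]
    constructor
    · intro hx
      obtain ⟨S, hS, hS2⟩ := exists_signFlip_mem_sector m hx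
      exact ⟨S, hS, hS2, hx⟩
    · rintro ⟨S, -, -, hx⟩
      exact hx
  · intro S hS S' hS' hne
    rw [Function.onFun, Set.disjoint_left]
    rintro x ⟨h3, hx⟩ ⟨h4, -⟩
    simp only [Finset.coe_powerset, mem_preimage, mem_powerset_iff, Finset.coe_subset]
      at hS hS' h3 h4
    exact hne (((signFlip_mem_sector hS hx).1 h3).trans ((signFlip_mem_sector hS' hx).1 h4).symm)

end SignFlip

/-! ### The Gauss kernel -/

section Gauss

variable {N m : ℕ}

theorem gaussKernel_pos {t : ℝ} (ht : 0 < t) (x : Eucl N) : 0 < gaussKernel t x := by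
  unfold gaussKernel; positivity

theorem continuous_gaussKernel (t : ℝ) : Continuous (gaussKernel t : Eucl N → ℝ) := by
  unfold gaussKernel; fun_prop

theorem gaussKernel_signFlip (t : ℝ) (S : Finset (Fin N)) (x : Eucl N) :
    gaussKernel t (signFlip S x) = gaussKernel t x := by
  simp [gaussKernel]

theorem gaussKernel_eq (t : ℝ) (x : Eucl N) : gaussKernel t x =
    (4 * Real.pi * t) ^ (-(N : ℝ) / 2) * Real.exp (-(1 / (4 * t)) * ‖x‖ ^ 2) := by
  rw [gaussKernel]; congr 2; ring

theorem gaussKernel_le {t : ℝ} (ht : 0 < t) (x : Eucl N) :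
    gaussKernel t x ≤ (4 * Real.pi * t) ^ (-(N : ℝ) / 2) := by
  unfold gaussKernel
  refine mul_le_of_le_one_right (by positivity) (Real.exp_le_one_iff.2 ?_)
  rw [neg_div]
  have : 0 ≤ ‖x‖ ^ 2 / (4 * t) := by positivity
  linarith

theorem integrable_exp_neg_mul_norm_sq {b : ℝ} (hb : 0 < b) :
    Integrable fun x : Eucl N => Real.exp (-b * ‖x‖ ^ 2) := by
  by_contra h
  have h1 := GaussianFourier.integral_rexp_neg_mul_sq_norm (V := Eucl N) hb
  rw [integral_undef h] at h1
  have : 0 < (Real.pi / b) ^ ((Module.finrank ℝ (Eucl N) : ℝ) / 2) := by positivity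
  linarith

theorem integrable_gaussKernel {t : ℝ} (ht : 0 < t) :
    Integrable (gaussKernel t : Eucl N → ℝ) := by
  have := (integrable_exp_neg_mul_norm_sq (N := N) (b := 1 / (4 * t)) (by positivity)).const_mul
    ((4 * Real.pi * t) ^ (-(N : ℝ) / 2))
  exact this.congr (Eventually.of_forall fun x => (gaussKernel_eq t x).symm)

theorem integral_gaussKernel {t : ℝ} (ht : 0 < t) : ∫ x : Eucl N, gaussKernel t x = 1 := by
  simp_rw [gaussKernel_eq]
  rw [integral_const_mul, GaussianFourier.integral_rexp_neg_mul_sq_norm (by positivity)]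
  have : Real.pi / (1 / (4 * t)) = 4 * Real.pi * t := by field_simp
  rw [this, finrank_euclideanSpace_fin, ← Real.rpow_add (by positivity), neg_div, neg_add_cancel,
    Real.rpow_zero]

theorem gaussKernel_mul_gaussKernel {s t : ℝ} (hs : 0 < s) (ht : 0 < t) (x y : Eucl N) :
    gaussKernel s y * gaussKernel t (x - y) =
      gaussKernel (s + t) x * gaussKernel (s * t / (s + t)) (y - (s / (s + t)) • x) := by
  have hst : 0 < s + t := by positivity
  have h1 : (4 * Real.pi * s) ^ (-(N : ℝ) / 2) * (4 * Real.pi * t) ^ (-(N : ℝ) / 2) =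
      (4 * Real.pi * (s + t)) ^ (-(N : ℝ) / 2) *
        (4 * Real.pi * (s * t / (s + t))) ^ (-(N : ℝ) / 2) := by
    rw [← Real.mul_rpow (by positivity) (by positivity),
      ← Real.mul_rpow (by positivity) (by positivity)]
    congr 1
    field_simp
  have h2 : -‖y‖ ^ 2 / (4 * s) + -‖x - y‖ ^ 2 / (4 * t) =
      -‖x‖ ^ 2 / (4 * (s + t)) + -‖y - (s / (s + t)) • x‖ ^ 2 / (4 * (s * t / (s + t))) := by
    rw [norm_sub_sq_real, norm_sub_sq_real, norm_smul, inner_smul_right, real_inner_comm,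
      Real.norm_of_nonneg (by positivity)]
    field_simp
    ring
  unfold gaussKernel
  rw [mul_mul_mul_comm, h1, ← Real.exp_add, h2, Real.exp_add]
  ring

theorem integral_gaussKernel_mul_gaussKernel {s t : ℝ} (hs : 0 < s) (ht : 0 < t) (x : Eucl N) :
    ∫ y, gaussKernel s y * gaussKernel t (x - y) = gaussKernel (s + t) x := by
  simp_rw [gaussKernel_mul_gaussKernel hs ht]
  rw [integral_const_mul, integral_sub_right_eq_self (gaussKernel (s * t / (s + t))),
    integral_gaussKernel (by positivity), mul_one]

theorem gaussKernel_sqrt_smul {t : ℝ} (ht : 0 < t) (x : Eucl N) :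
    gaussKernel t (√t • x) = t ^ (-(N : ℝ) / 2) * gaussKernel 1 x := by
  unfold gaussKernel
  rw [norm_smul, Real.norm_of_nonneg (Real.sqrt_nonneg t), mul_pow, Real.sq_sqrt ht.le, mul_one,
    Real.mul_rpow (by positivity) ht.le]
  have : -(t * ‖x‖ ^ 2) / (4 * t) = -‖x‖ ^ 2 / 4 := by field_simp
  rw [this]
  ring_nf

/-- Rescaling of Gaussian averages to unit time. -/
theorem integral_gaussKernel_mul_eq_scaled {V : Type*} [NormedAddCommGroup V] [NormedSpace ℝ V]
    {t : ℝ} (ht : 0 < t) (f : Eucl N → V) :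
    ∫ y, gaussKernel t y • f y = ∫ z, gaussKernel 1 z • f (√t • z) := by
  have h := Measure.integral_comp_smul (volume : Measure (Eucl N))
    (fun y => gaussKernel t y • f y) (√t)
  simp_rw [gaussKernel_sqrt_smul ht, mul_smul] at h
  rw [integral_smul, finrank_euclideanSpace_fin] at h
  have h3 : |((√t) ^ N)⁻¹| = t ^ (-(N : ℝ) / 2) := by
    rw [abs_of_nonneg (by positivity), Real.sqrt_eq_rpow, ← Real.rpow_natCast,
      ← Real.rpow_mul ht.le, ← Real.rpow_neg ht.le]
    congr 1; ring
  rw [h3] at h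
  exact (smul_right_injective V (r := t ^ (-(N : ℝ) / 2)) (by positivity) h).symm

end Gauss

/-! ### Functions vanishing at infinity -/

namespace ZeroAtInftyContinuousMap

variable {X : Type*} [TopologicalSpace X]

theorem abs_apply_le_norm (f : C₀(X, ℝ)) (x : X) : |f x| ≤ ‖f‖ :=
  f.toBCF.norm_coe_le_norm x

theorem norm_le_of_abs_apply_le {f : C₀(X, ℝ)} {C : ℝ} (hC : 0 ≤ C) (h : ∀ x, |f x| ≤ C) :
    ‖f‖ ≤ C :=
  (BoundedContinuousFunction.norm_le (f := f.toBCF) hC).2 h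

theorem norm_eq_iSup_abs (f : C₀(X, ℝ)) : ‖f‖ = ⨆ x, |f x| :=
  f.toBCF.norm_eq_iSup_norm

/-- Evaluation at a point. -/
noncomputable def evalCLM (x : X) : C₀(X, ℝ) →L[ℝ] ℝ :=
  LinearMap.mkContinuous
    { toFun := fun f => f x
      map_add' := fun _ _ => rfl
      map_smul' := fun _ _ => rfl } 1 fun f => by simpa using f.abs_apply_le_norm x

@[simp]
theorem evalCLM_apply (x : X) (f : C₀(X, ℝ)) : evalCLM x f = f x := rfl

theorem integral_apply {Y : Type*} [MeasurableSpace Y] {μ : Measure Y} {g : Y → C₀(X, ℝ)}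
    (hg : Integrable g μ) (x : X) : (∫ y, g y ∂μ) x = ∫ y, g y x ∂μ :=
  ((evalCLM x).integral_comp_comm hg).symm

theorem intervalIntegral_apply {a b : ℝ} {g : ℝ → C₀(X, ℝ)}
    (hg : IntervalIntegrable g volume a b) (x : X) :
    (∫ s in a..b, g s) x = ∫ s in a..b, g s x :=
  ((evalCLM x).intervalIntegral_comp_comm hg).symm

end ZeroAtInftyContinuousMap

open ZeroAtInftyContinuousMap

/-- Translation of functions vanishing at infinity. -/
noncomputable def shiftOp {N : ℕ} (h : Eucl N) : C₀(Eucl N, ℝ) →L[ℝ] C₀(Eucl N, ℝ) :=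
  LinearMap.mkContinuous
    (ZeroAtInftyContinuousMap.compLinearMap (Homeomorph.subRight h).toCocompactMap) 1 fun f => by
      rw [one_mul]
      exact norm_le_of_abs_apply_le (norm_nonneg _) fun x => f.abs_apply_le_norm (x - h)

section Translate

variable {N m : ℕ}

@[simp]
theorem shiftOp_apply (h : Eucl N) (f : C₀(Eucl N, ℝ)) (x : Eucl N) :
    shiftOp h f x = f (x - h) := rfl

theorem norm_shiftOp_le (h : Eucl N) (f : C₀(Eucl N, ℝ)) : ‖shiftOp h f‖ ≤ ‖f‖ :=
  norm_le_of_abs_apply_le (norm_nonneg _) fun x => f.abs_apply_le_norm (x - h)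

@[simp]
theorem shiftOp_zero (f : C₀(Eucl N, ℝ)) : shiftOp 0 f = f := by
  ext x; simp

theorem continuous_shiftOp (f : C₀(Eucl N, ℝ)) : Continuous fun h => shiftOp h f := by
  rw [Metric.continuous_iff]
  intro h ε hε
  obtain ⟨δ, hδ, H⟩ := Metric.uniformContinuous_iff.1
    (ZeroAtInftyContinuousMap.uniformContinuous f) (ε / 2) (by positivity)
  refine ⟨δ, hδ, fun h' hh => ?_⟩
  rw [dist_eq_norm]
  refine lt_of_le_of_lt (norm_le_of_abs_apply_le (by positivity) (C := ε / 2) fun x => ?_)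
    (by linarith)
  have : dist (x - h') (x - h) < δ := by simpa [dist_eq_norm, norm_sub_rev] using hh
  exact (H this).le

end Translate

/-! ### The heat semigroup on functions vanishing at infinity -/

section HeatOp

variable {N m : ℕ}

theorem integrable_gaussKernel_smul_shiftOp (t : ℝ) (f : C₀(Eucl N, ℝ)) :
    Integrable fun z => gaussKernel 1 z • shiftOp (√t • z) f := by
  have hc : Continuous fun z : Eucl N => shiftOp (√t • z) f :=
    (continuous_shiftOp f).comp (continuous_const_smul _)
  refine ((integrable_gaussKernel one_pos).mul_const ‖f‖).mono'
    ((continuous_gaussKernel 1).smul hc).aestronglyMeasurable (Eventually.of_forall fun z => ?_)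
  rw [norm_smul, Real.norm_of_nonneg (gaussKernel_pos one_pos z).le]
  exact mul_le_mul_of_nonneg_left (norm_shiftOp_le _ _) (gaussKernel_pos one_pos z).le

theorem norm_integral_gaussKernel_smul_shiftOp_le (t : ℝ) (f : C₀(Eucl N, ℝ)) :
    ‖∫ z, gaussKernel 1 z • shiftOp (√t • z) f‖ ≤ ‖f‖ := by
  refine (norm_integral_le_of_norm_le ((integrable_gaussKernel one_pos).mul_const ‖f‖)
    (Eventually.of_forall fun z => ?_)).trans ?_
  · rw [norm_smul, Real.norm_of_nonneg (gaussKernel_pos one_pos z).le]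
    exact mul_le_mul_of_nonneg_left (norm_shiftOp_le _ _) (gaussKernel_pos one_pos z).le
  · rw [integral_mul_const, integral_gaussKernel one_pos, one_mul]

/-- The heat semigroup on `C₀`; it is the identity for `t ≤ 0`. -/
noncomputable def heatOp (t : ℝ) : C₀(Eucl N, ℝ) →L[ℝ] C₀(Eucl N, ℝ) :=
  LinearMap.mkContinuous
    { toFun := fun f => ∫ z, gaussKernel 1 z • shiftOp (√t • z) f
      map_add' := fun f g => by
        rw [← integral_add (integrable_gaussKernel_smul_shiftOp t f)
          (integrable_gaussKernel_smul_shiftOp t g)]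
        refine integral_congr_ae (Eventually.of_forall fun z => ?_)
        simp only [map_add]
        exact smul_add (gaussKernel 1 z) (shiftOp (√t • z) f) (shiftOp (√t • z) g)
      map_smul' := fun c f => by
        rw [RingHom.id_apply, ← integral_smul]
        refine integral_congr_ae (Eventually.of_forall fun z => ?_)
        simp only [map_smul]
        exact smul_comm _ _ _ } 1 fun f => by
      rw [one_mul]
      exact norm_integral_gaussKernel_smul_shiftOp_le t f

theorem heatOp_def (t : ℝ) (f : C₀(Eucl N, ℝ)) :
    heatOp t f = ∫ z, gaussKernel 1 z • shiftOp (√t • z) f := rfl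

theorem norm_heatOp_le (t : ℝ) (f : C₀(Eucl N, ℝ)) : ‖heatOp t f‖ ≤ ‖f‖ :=
  norm_integral_gaussKernel_smul_shiftOp_le t f

theorem heatOp_apply_eq_scaled (t : ℝ) (f : C₀(Eucl N, ℝ)) (x : Eucl N) :
    heatOp t f x = ∫ z, gaussKernel 1 z * f (x - √t • z) := by
  rw [heatOp_def, integral_apply (integrable_gaussKernel_smul_shiftOp t f)]
  rfl

theorem heatOp_apply {t : ℝ} (ht : 0 < t) (f : C₀(Eucl N, ℝ)) (x : Eucl N) :
    heatOp t f x = ∫ y, gaussKernel t y * f (x - y) := by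
  rw [heatOp_apply_eq_scaled]
  exact (integral_gaussKernel_mul_eq_scaled ht fun y => f (x - y)).symm

theorem heatOp_apply_eq_heatFun {t : ℝ} (ht : 0 < t) (f : C₀(Eucl N, ℝ)) (x : Eucl N) :
    heatOp t f x = heatFun t f x := by
  rw [heatOp_apply ht, heatFun, ← integral_sub_left_eq_self _ _ x]
  simp

theorem heatOp_of_nonpos {t : ℝ} (ht : t ≤ 0) (f : C₀(Eucl N, ℝ)) : heatOp t f = f := by
  rw [heatOp_def, Real.sqrt_eq_zero_of_nonpos ht]
  simp [integral_smul_const, integral_gaussKernel]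

theorem continuous_heatOp (f : C₀(Eucl N, ℝ)) : Continuous fun t => heatOp t f := by
  simp_rw [heatOp_def]
  refine continuous_of_dominated (bound := fun z => gaussKernel 1 z * ‖f‖)
    (fun t => (integrable_gaussKernel_smul_shiftOp t f).aestronglyMeasurable)
    (fun t => Eventually.of_forall fun z => ?_)
    ((integrable_gaussKernel one_pos).mul_const _)
    (Eventually.of_forall fun z => ?_)
  · rw [norm_smul, Real.norm_of_nonneg (gaussKernel_pos one_pos z).le]
    exact mul_le_mul_of_nonneg_left (norm_shiftOp_le _ _) (gaussKernel_pos one_pos z).le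
  · exact ((continuous_shiftOp f).comp
      (Real.continuous_sqrt.smul continuous_const)).const_smul (gaussKernel 1 z)

theorem continuousWithinAt_heatOp {X : Type*} [TopologicalSpace X] {s : Set X} {p : X} {τ : X → ℝ}
    {f : X → C₀(Eucl N, ℝ)} (hτ : ContinuousWithinAt τ s p) (hf : ContinuousWithinAt f s p) :
    ContinuousWithinAt (fun q => heatOp (τ q) (f q)) s p := by
  have h1 : Tendsto (fun q => heatOp (τ q) (f p)) (𝓝[s] p) (𝓝 (heatOp (τ p) (f p))) :=
    (continuous_heatOp (f p)).continuousAt.comp_continuousWithinAt hτ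
  have h2 : Tendsto (fun q => heatOp (τ q) (f q) - heatOp (τ q) (f p)) (𝓝[s] p) (𝓝 0) := by
    have h3 : Tendsto (fun q => ‖f q - f p‖) (𝓝[s] p) (𝓝 0) := by
      rw [← tendsto_iff_norm_sub_tendsto_zero]; exact hf
    refine squeeze_zero_norm (fun q => ?_) h3
    rw [← map_sub]
    exact norm_heatOp_le _ _
  have := h2.add h1
  simpa [ContinuousWithinAt] using this

theorem continuousOn_heatOp {X : Type*} [TopologicalSpace X] {s : Set X} {τ : X → ℝ}
    {f : X → C₀(Eucl N, ℝ)} (hτ : ContinuousOn τ s) (hf : ContinuousOn f s) :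
    ContinuousOn (fun q => heatOp (τ q) (f q)) s :=
  fun p hp => continuousWithinAt_heatOp (hτ p hp) (hf p hp)

theorem integrable_gaussKernel_mul_sub {t : ℝ} (ht : 0 < t) (f : C₀(Eucl N, ℝ)) (x : Eucl N) :
    Integrable fun y => gaussKernel t y * f (x - y) :=
  (integrable_gaussKernel ht).mul_bdd (c := ‖f‖)
    (f.continuous.comp (continuous_const.sub continuous_id)).aestronglyMeasurable
    (Eventually.of_forall fun _ => f.abs_apply_le_norm _)

theorem heatOp_heatOp_of_pos {s t : ℝ} (hs : 0 < s) (ht : 0 < t) (f : C₀(Eucl N, ℝ)) :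
    heatOp s (heatOp t f) = heatOp (s + t) f := by
  ext x
  rw [heatOp_apply hs, heatOp_apply (by positivity)]
  have h1 : ∀ y, gaussKernel s y * heatOp t f (x - y) =
      ∫ z, gaussKernel s y * gaussKernel t (z - y) * f (x - z) := by
    intro y
    rw [heatOp_apply ht, ← integral_const_mul, ← integral_sub_right_eq_self _ y]
    congr 1
    ext z
    rw [sub_sub, add_sub_cancel, mul_assoc]
  simp_rw [h1]
  have hint : Integrable (fun p : Eucl N × Eucl N =>
      gaussKernel s p.2 * gaussKernel t (p.1 - p.2)) (volume.prod volume) := by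
    simpa using (integrable_gaussKernel hs).convolution_integrand (ContinuousLinearMap.mul ℝ ℝ)
      (integrable_gaussKernel ht)
  have hint2 : Integrable (fun p : Eucl N × Eucl N =>
      gaussKernel s p.2 * gaussKernel t (p.1 - p.2) * f (x - p.1)) (volume.prod volume) :=
    hint.mul_bdd (c := ‖f‖)
      (f.continuous.comp (continuous_const.sub continuous_fst)).aestronglyMeasurable
      (Eventually.of_forall fun _ => f.abs_apply_le_norm _)
  rw [integral_integral_swap (f := fun y z => gaussKernel s y * gaussKernel t (z - y) * f (x - z))
    hint2.swap]
  congr 1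
  ext z
  rw [integral_mul_const, integral_gaussKernel_mul_gaussKernel hs ht]

theorem heatOp_heatOp {s t : ℝ} (hs : 0 ≤ s) (ht : 0 ≤ t) (f : C₀(Eucl N, ℝ)) :
    heatOp s (heatOp t f) = heatOp (s + t) f := by
  rcases hs.eq_or_lt with rfl | hs
  · rw [heatOp_of_nonpos le_rfl, zero_add]
  rcases ht.eq_or_lt with rfl | ht
  · rw [heatOp_of_nonpos le_rfl, add_zero]
  exact heatOp_heatOp_of_pos hs ht f

theorem heatOp_antisymmIn {f : C₀(Eucl N, ℝ)} (hf : AntisymmIn m f) (t : ℝ) :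
    AntisymmIn m (heatOp t f) := by
  refine antisymmIn_of_apply_signFlip fun i hi x => ?_
  rw [heatOp_apply_eq_scaled, heatOp_apply_eq_scaled, ← integral_neg,
    ← (measurePreserving_signFlip {i}).integral_comp
      (signFlip {i}).toHomeomorph.measurableEmbedding]
  congr 1
  ext z
  rw [gaussKernel_signFlip, ← map_smul, ← map_sub, ← reflectCoord_eq_signFlip, hf i hi]
  ring

/-! ### The Dirichlet heat kernel of the sector -/

theorem sectorKernel_eq_sum (t : ℝ) (x y : Eucl N) : sectorKernel m t x y =
    ∑ S ∈ (headCoords N m).powerset, (-1) ^ S.card * gaussKernel t (x - signFlip S y) := by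
  have h1 : (∏ i : Fin N, if (i : ℕ) < m then
        Real.exp (-(x i - y i) ^ 2 / (4 * t)) - Real.exp (-(x i + y i) ^ 2 / (4 * t))
      else Real.exp (-(x i - y i) ^ 2 / (4 * t))) =
      (∏ i ∈ headCoords N m, (Real.exp (-(x i - y i) ^ 2 / (4 * t)) -
        Real.exp (-(x i + y i) ^ 2 / (4 * t)))) *
      ∏ i ∈ Finset.univ.filter (fun i : Fin N => ¬ (i : ℕ) < m),
        Real.exp (-(x i - y i) ^ 2 / (4 * t)) := by
    rw [Finset.prod_ite]; rfl
  rw [sectorKernel, h1]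
  have h2 : ∏ i ∈ headCoords N m, (Real.exp (-(x i - y i) ^ 2 / (4 * t)) -
        Real.exp (-(x i + y i) ^ 2 / (4 * t))) =
      ∏ i ∈ headCoords N m, (-Real.exp (-(x i + y i) ^ 2 / (4 * t)) +
        Real.exp (-(x i - y i) ^ 2 / (4 * t))) :=
    Finset.prod_congr rfl fun i _ => by ring
  rw [h2, Finset.prod_add, Finset.sum_mul, Finset.mul_sum]
  refine Finset.sum_congr rfl fun S hS => ?_
  rw [Finset.mem_powerset] at hS
  rw [Finset.prod_neg, gaussKernel, EuclideanSpace.norm_sq_eq]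
  have h3 : Real.exp (-(∑ i, ‖(x - signFlip S y) i‖ ^ 2) / (4 * t)) =
      ∏ i, Real.exp (-((x - signFlip S y) i) ^ 2 / (4 * t)) := by
    rw [← Real.exp_sum]
    congr 1
    rw [← Finset.sum_div, Finset.sum_neg_distrib]
    simp
  have h4 : ∏ i, Real.exp (-((x - signFlip S y) i) ^ 2 / (4 * t)) =
      (∏ i ∈ S, Real.exp (-(x i + y i) ^ 2 / (4 * t))) *
      (∏ i ∈ headCoords N m \ S, Real.exp (-(x i - y i) ^ 2 / (4 * t))) *
      ∏ i ∈ Finset.univ.filter (fun i : Fin N => ¬ (i : ℕ) < m),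
        Real.exp (-(x i - y i) ^ 2 / (4 * t)) := by
    rw [← Finset.prod_filter_mul_prod_filter_not Finset.univ (fun i : Fin N => (i : ℕ) < m)]
    congr 1
    · change ∏ i ∈ headCoords N m, _ = _
      rw [← Finset.prod_sdiff hS, mul_comm]
      congr 1
      · refine Finset.prod_congr rfl fun i hi => ?_
        simp [signFlip_apply, hi]
      · refine Finset.prod_congr rfl fun i hi => ?_
        simp [signFlip_apply, (Finset.mem_sdiff.1 hi).2]
    · refine Finset.prod_congr rfl fun i hi => ?_
      have : i ∉ S := fun h => (Finset.mem_filter.1 hi).2 (mem_headCoords.1 (hS h))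
      simp [signFlip_apply, this]
  rw [h3, h4]
  ring

theorem exp_neg_sq_lt {t a b : ℝ} (ht : 0 < t) (ha : 0 < a) (hb : 0 < b) :
    Real.exp (-(a + b) ^ 2 / (4 * t)) < Real.exp (-(a - b) ^ 2 / (4 * t)) := by
  refine Real.exp_lt_exp.2 ?_
  rw [div_lt_div_iff_of_pos_right (by positivity)]
  nlinarith [mul_pos ha hb]

theorem sectorKernel_pos {t : ℝ} (ht : 0 < t) {x y : Eucl N} (hx : x ∈ sector N m)
    (hy : y ∈ sector N m) : 0 < sectorKernel m t x y := by
  unfold sectorKernel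
  refine mul_pos (by positivity) (Finset.prod_pos fun i _ => ?_)
  split_ifs with hi
  · exact sub_pos.2 (exp_neg_sq_lt ht (hx i hi) (hy i hi))
  · positivity

theorem integrable_sectorKernel {t : ℝ} (ht : 0 < t) (x : Eucl N) :
    Integrable fun y => sectorKernel m t x y := by
  simp_rw [sectorKernel_eq_sum]
  refine integrable_finsetSum _ fun S _ => Integrable.const_mul ?_ _
  exact (measurePreserving_signFlip S).integrable_comp_of_integrable
    ((integrable_gaussKernel ht).comp_sub_left x)

theorem abs_sectorKernel_le_sum {t : ℝ} (ht : 0 < t) (x y : Eucl N) : |sectorKernel m t x y| ≤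
    ∑ S ∈ (headCoords N m).powerset, gaussKernel t (x - signFlip S y) := by
  rw [sectorKernel_eq_sum]
  refine (Finset.abs_sum_le_sum_abs _ _).trans_eq (Finset.sum_congr rfl fun S _ => ?_)
  rw [abs_mul, abs_pow, abs_neg, abs_one, one_pow, one_mul, abs_of_pos (gaussKernel_pos ht _)]

theorem integral_gaussKernel_sub_signFlip {t : ℝ} (ht : 0 < t) (x : Eucl N)
    (S : Finset (Fin N)) : ∫ y, gaussKernel t (x - signFlip S y) = 1 := by
  rw [(measurePreserving_signFlip S).integral_comp
    (signFlip S).toHomeomorph.measurableEmbedding fun y => gaussKernel t (x - y),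
    integral_sub_left_eq_self (gaussKernel t), integral_gaussKernel ht]

theorem integral_abs_sectorKernel_le {t : ℝ} (ht : 0 < t) (x : Eucl N) :
    ∫ y, |sectorKernel m t x y| ≤ 2 ^ (headCoords N m).card := by
  have hi : ∀ S ∈ (headCoords N m).powerset,
      Integrable fun y => gaussKernel t (x - signFlip S y) := fun S _ =>
    (measurePreserving_signFlip S).integrable_comp_of_integrable
      ((integrable_gaussKernel ht).comp_sub_left x)
  refine (integral_mono (integrable_sectorKernel ht x).abs (integrable_finsetSum _ hi)
    fun y => abs_sectorKernel_le_sum ht x y).trans_eq ?_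
  rw [integral_finsetSum _ hi]
  simp_rw [integral_gaussKernel_sub_signFlip ht]
  simp

/-- On anti-symmetric functions the heat semigroup is given by the kernel of the sector. -/
theorem heatOp_apply_eq_setIntegral {t : ℝ} (ht : 0 < t) {f : C₀(Eucl N, ℝ)}
    (hf : AntisymmIn m f) (x : Eucl N) :
    heatOp t f x = ∫ y in sector N m, sectorKernel m t x y * f y := by
  have hint : Integrable fun y => gaussKernel t (x - y) * f y := by
    simpa using (integrable_gaussKernel_mul_sub ht f x).comp_sub_left x
  rw [heatOp_apply_eq_heatFun ht, heatFun, integral_eq_setIntegral_sector_sum (m := m) hint]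
  congr 1
  ext y
  rw [sectorKernel_eq_sum, Finset.sum_mul]
  refine Finset.sum_congr rfl fun S hS => ?_
  rw [hf.apply_signFlip (Finset.mem_powerset.1 hS)]
  ring

theorem abs_heatOp_apply_le {t : ℝ} {f g : C₀(Eucl N, ℝ)}
    (hf : AntisymmIn m f) (hg : AntisymmIn m g) (h : ∀ x ∈ sector N m, |f x| ≤ g x)
    {x : Eucl N} (hx : x ∈ sector N m) : |heatOp t f x| ≤ heatOp t g x := by
  rcases le_or_gt t 0 with ht | ht
  · rw [heatOp_of_nonpos ht, heatOp_of_nonpos ht]; exact h x hx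
  have hint : ∀ f : C₀(Eucl N, ℝ), IntegrableOn (fun y => sectorKernel m t x y * f y)
      (sector N m) := fun f =>
    ((integrable_sectorKernel ht x).mul_bdd (c := ‖f‖) f.continuous.aestronglyMeasurable
      (Eventually.of_forall fun _ => f.abs_apply_le_norm _)).integrableOn
  rw [heatOp_apply_eq_setIntegral ht hf, heatOp_apply_eq_setIntegral ht hg]
  refine abs_integral_le_integral_abs.trans (setIntegral_mono_on (hint f).abs (hint g)
    measurableSet_sector fun y hy => ?_)
  rw [abs_mul, abs_of_pos (sectorKernel_pos ht hx hy)]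
  exact mul_le_mul_of_nonneg_left (h y hy) (sectorKernel_pos ht hx hy).le

theorem AntisymmIn.norm_le {f : C₀(Eucl N, ℝ)} (hf : AntisymmIn m f) {C : ℝ} (hC : 0 ≤ C)
    (h : ∀ x ∈ sector N m, |f x| ≤ C) : ‖f‖ ≤ C := by
  refine norm_le_of_abs_apply_le hC fun x => ?_
  by_cases hx : ∃ i : Fin N, (i : ℕ) < m ∧ x i = 0
  · obtain ⟨i, hi, hx⟩ := hx
    rw [hf.eq_zero hi hx, abs_zero]
    exact hC
  · push Not at hx
    set S := (headCoords N m).filter fun i => x i < 0 with hS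
    have h1 : signFlip S x ∈ sector N m := by
      intro i hi
      rw [signFlip_apply]
      simp only [hS, Finset.mem_filter, mem_headCoords, hi, true_and]
      split_ifs with h
      · linarith
      · exact lt_of_le_of_ne (not_lt.1 h) (hx i hi).symm
    have h2 := h _ h1
    rwa [hf.apply_signFlip (Finset.filter_subset _ _), abs_mul, abs_pow, abs_neg, abs_one, one_pow,
      one_mul] at h2

end HeatOp

/-! ### The kernels as functions vanishing at infinity -/

/-- The Gauss kernel as an element of `C₀`. -/
noncomputable def gaussC0 {N : ℕ} {t : ℝ} (ht : 0 < t) : C₀(Eucl N, ℝ) :=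
  ((4 * Real.pi * t) ^ (-(N : ℝ) / 2)) • (gaussSchwartzAux ht (0 : Eucl N)).toZeroAtInfty

/-- The kernel `x ↦ K_t(x, z)` of the sector as an element of `C₀`. -/
noncomputable def sectorC0 {N : ℕ} (m : ℕ) {t : ℝ} (ht : 0 < t) (z : Eucl N) : C₀(Eucl N, ℝ) :=
  ∑ S ∈ (headCoords N m).powerset, (-1 : ℝ) ^ S.card • shiftOp (signFlip S z) (gaussC0 ht)

section KernelC0

variable {N m : ℕ}

theorem gaussC0_apply {t : ℝ} (ht : 0 < t) (x : Eucl N) : gaussC0 ht x = gaussKernel t x := by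
  have h : gaussSchwartzAux ht (0 : Eucl N) x = Real.exp (-(1 / (4 * t)) * ‖0 - x‖ ^ 2) := rfl
  rw [gaussKernel_eq, ← norm_neg x, ← zero_sub x, ← h]
  rfl

theorem heatOp_shiftOp (s : ℝ) (h : Eucl N) (f : C₀(Eucl N, ℝ)) :
    heatOp s (shiftOp h f) = shiftOp h (heatOp s f) := by
  ext x
  rw [shiftOp_apply, heatOp_apply_eq_scaled, heatOp_apply_eq_scaled]
  simp_rw [shiftOp_apply, sub_right_comm]

theorem heatOp_gaussC0 {s t : ℝ} (hs : 0 < s) (ht : 0 < t) :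
    heatOp s (gaussC0 ht : C₀(Eucl N, ℝ)) = gaussC0 (add_pos hs ht) := by
  ext x
  rw [heatOp_apply hs, gaussC0_apply]
  simp_rw [gaussC0_apply]
  exact integral_gaussKernel_mul_gaussKernel hs ht x

theorem sectorC0_apply {t : ℝ} (ht : 0 < t) (z x : Eucl N) :
    sectorC0 m ht z x = sectorKernel m t x z := by
  rw [sectorKernel_eq_sum, sectorC0, ← evalCLM_apply, map_sum]
  refine Finset.sum_congr rfl fun S _ => ?_
  rw [map_smul, evalCLM_apply, shiftOp_apply, gaussC0_apply, smul_eq_mul]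

theorem heatOp_sectorC0 {s t : ℝ} (hs : 0 < s) (ht : 0 < t) (z : Eucl N) :
    heatOp s (sectorC0 m ht z) = sectorC0 m (add_pos hs ht) z := by
  simp_rw [sectorC0, map_sum, map_smul, heatOp_shiftOp, heatOp_gaussC0 hs ht]

theorem continuous_sectorC0 {t : ℝ} (ht : 0 < t) :
    Continuous fun z : Eucl N => sectorC0 m ht z := by
  refine continuous_finsetSum _ fun S _ => ?_
  exact ((continuous_shiftOp (gaussC0 ht)).comp (signFlip S).continuous).const_smul
    ((-1 : ℝ) ^ S.card)

theorem sectorKernel_antisymmIn (t : ℝ) (z : Eucl N) :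
    AntisymmIn m fun x => sectorKernel m t x z := by
  intro i hi x
  simp only [sectorKernel]
  rw [← Finset.mul_prod_erase _ _ (Finset.mem_univ i),
    ← Finset.mul_prod_erase Finset.univ _ (Finset.mem_univ i), if_pos hi, if_pos hi]
  have h1 : ∀ j ∈ Finset.univ.erase i, reflectCoord i x j = x j := fun j hj => by
    rw [reflectCoord_apply, if_neg (Finset.ne_of_mem_erase hj)]
  rw [Finset.prod_congr rfl fun j hj => by rw [h1 j hj]]
  rw [reflectCoord_apply, if_pos rfl]
  have h2 : (-x i - z i) ^ 2 = (x i + z i) ^ 2 := by ring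
  have h3 : (-x i + z i) ^ 2 = (x i - z i) ^ 2 := by ring
  rw [h2, h3]
  ring

theorem abs_exp_neg_sq_sub_le (a b : ℝ) :
    |Real.exp (-a ^ 2) - Real.exp (-b ^ 2)| ≤ |a - b| := by
  have hd : ∀ s : ℝ, HasDerivAt (fun s : ℝ => Real.exp (-s ^ 2))
      (Real.exp (-s ^ 2) * -(2 * s)) s := fun s => by
    have := ((hasDerivAt_pow 2 s).neg).exp
    simpa using this
  have := Convex.norm_image_sub_le_of_norm_hasDerivWithin_le (C := 1) (s := Set.univ)
    (fun s _ => (hd s).hasDerivWithinAt) (fun s _ => ?_) convex_univ (mem_univ b) (mem_univ a)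
  · simpa using this
  · rw [norm_mul, Real.norm_eq_abs, Real.abs_exp, norm_neg, Real.norm_eq_abs, abs_mul, abs_two]
    have h1 : 2 * |s| ≤ Real.exp (s ^ 2) := by
      have := Real.add_one_le_exp (s ^ 2)
      nlinarith [sq_abs s, sq_nonneg (|s| - 1)]
    calc Real.exp (-s ^ 2) * (2 * |s|) ≤ Real.exp (-s ^ 2) * Real.exp (s ^ 2) := by gcongr
      _ = 1 := by rw [← Real.exp_add]; simp

theorem abs_sectorKernel_le_prod {t : ℝ} (ht : 0 < t) (x z : Eucl N) :
    |sectorKernel m t x z| ≤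
      (4 * Real.pi * t) ^ (-(N : ℝ) / 2) * ∏ i ∈ headCoords N m, (|z i| / √t) := by
  have hpos : 0 < (4 * Real.pi * t) ^ (-(N : ℝ) / 2) := by positivity
  rw [sectorKernel, abs_mul, abs_of_pos hpos]
  refine mul_le_mul_of_nonneg_left ?_ hpos.le
  rw [Finset.abs_prod, headCoords, Finset.prod_filter]
  refine Finset.prod_le_prod (fun i _ => abs_nonneg _) fun i _ => ?_
  have hst : 0 < √t := Real.sqrt_pos.2 ht
  split_ifs with h
  · have key : ∀ r : ℝ, -r ^ 2 / (4 * t) = -(r / (2 * √t)) ^ 2 := fun r => by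
      rw [div_pow, mul_pow, Real.sq_sqrt ht.le]; ring
    rw [key, key]
    refine (abs_exp_neg_sq_sub_le _ _).trans_eq ?_
    rw [← sub_div, abs_div, abs_of_pos (by positivity : 0 < 2 * √t)]
    have : x i - z i - (x i + z i) = -(2 * z i) := by ring
    rw [this, abs_neg, abs_mul, abs_two]
    field_simp
  · rw [Real.abs_exp, Real.exp_le_one_iff, neg_div]
    have : 0 ≤ (x i - z i) ^ 2 / (4 * t) := by positivity
    linarith

theorem prod_abs_headCoords_le (hm : m ≤ N) (z : Eucl N) :
    ∏ i ∈ headCoords N m, |z i| ≤ ‖z‖ ^ m := by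
  refine (Finset.prod_le_prod (fun i _ => abs_nonneg _) fun i _ => PiLp.norm_apply_le z i).trans ?_
  rw [Finset.prod_const, card_headCoords hm]

theorem abs_sectorKernel_le (hm : m ≤ N) {t : ℝ} (ht : 0 < t) (x z : Eucl N) :
    |sectorKernel m t x z| ≤ (4 * Real.pi * t) ^ (-(N : ℝ) / 2) * (‖z‖ / √t) ^ m := by
  refine (abs_sectorKernel_le_prod ht x z).trans ?_
  refine mul_le_mul_of_nonneg_left ?_ (by positivity)
  rw [Finset.prod_div_distrib, Finset.prod_const, card_headCoords hm, div_pow]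
  gcongr
  exact prod_abs_headCoords_le hm z

theorem norm_sectorC0_le (hm : m ≤ N) {t : ℝ} (ht : 0 < t) (z : Eucl N) :
    ‖sectorC0 m ht z‖ ≤ (4 * Real.pi * t) ^ (-(N : ℝ) / 2) * (‖z‖ / √t) ^ m :=
  norm_le_of_abs_apply_le (by positivity) fun x => by
    rw [sectorC0_apply]; exact abs_sectorKernel_le hm ht x z

end KernelC0

/-! ### The linear evolution of singular data -/

/-- Data on the sector bounded by `A ‖z‖ ^ (-κ)`. -/
structure SingularData {N : ℕ} (m : ℕ) (κ A : ℝ) (w : Eucl N → ℝ) : Prop where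
  one_le : 1 ≤ m
  le_dim : m ≤ N
  kappa_pos : 0 < κ
  kappa_lt : κ < N + m
  nonneg : 0 ≤ A
  meas : AEStronglyMeasurable w (volume.restrict (sector N m))
  le : ∀ᵐ z ∂volume.restrict (sector N m), |w z| ≤ A * ‖z‖ ^ (-κ)

/-- The solution `x ↦ ∫_Ω K_t(x, z) w(z) dz` of the linear heat equation in the sector, as an
element of `C₀` (see `SingularData.evol_apply`). -/
noncomputable def evol {N : ℕ} (m : ℕ) (w : Eucl N → ℝ) (t : ℝ) : C₀(Eucl N, ℝ) :=
  Classical.epsilon fun L => ∀ x, L x = ∫ z in sector N m, sectorKernel m t x z * w z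

theorem integrableOn_ball_norm_rpow {N : ℕ} (hN : 1 ≤ N) {p : ℝ} (hp : -(N : ℝ) < p) (r : ℝ) :
    IntegrableOn (fun z : Eucl N => ‖z‖ ^ p) (Metric.ball 0 r) := by
  refine integrableOn_ball_of_norm_le_rpow (C := 1) (α := -p) (by simpa using hN)
    (by rw [finrank_euclideanSpace_fin]; linarith) ?_ ?_
  · refine Eventually.of_forall fun z => ?_
    rw [neg_neg, one_mul, Real.norm_of_nonneg (by positivity)]
  · exact (Measurable.pow_const measurable_norm p).aestronglyMeasurable

theorem setIntegral_ball_norm_rpow {N : ℕ} {p r : ℝ} (hr : 0 < r) :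
    ∫ z in Metric.ball (0 : Eucl N) r, ‖z‖ ^ p =
      r ^ ((N : ℝ) + p) * ∫ z in Metric.ball (0 : Eucl N) 1, ‖z‖ ^ p := by
  have h := Measure.setIntegral_comp_smul_of_pos (volume : Measure (Eucl N))
    (fun z => ‖z‖ ^ p) (Metric.ball 0 1) hr
  rw [smul_unitBall_of_pos hr, finrank_euclideanSpace_fin] at h
  have h2 : ∀ z : Eucl N, ‖r • z‖ ^ p = r ^ p * ‖z‖ ^ p := fun z => by
    rw [norm_smul, Real.norm_of_nonneg hr.le, Real.mul_rpow hr.le (norm_nonneg _)]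
  simp_rw [h2] at h
  rw [integral_const_mul, smul_eq_mul, eq_inv_mul_iff_mul_eq₀ (by positivity)] at h
  rw [← h, Real.rpow_add hr, Real.rpow_natCast]
  ring

section Evol

variable {N m : ℕ} {κ A : ℝ} {w : Eucl N → ℝ}

namespace SingularData

theorem one_le_dim (hw : SingularData m κ A w) : 1 ≤ N := hw.one_le.trans hw.le_dim

theorem integrableOn_norm_pow_mul (hw : SingularData m κ A w) (r : ℝ) :
    IntegrableOn (fun z => ‖z‖ ^ m * w z) (sector N m ∩ Metric.ball 0 r) := by
  have h1 : IntegrableOn (fun z : Eucl N => A * ‖z‖ ^ ((m : ℝ) - κ)) (Metric.ball 0 r) :=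
    ((integrableOn_ball_norm_rpow hw.one_le_dim (p := m - κ)
      (by linarith [hw.kappa_lt]) r).const_mul A)
  refine (h1.mono_set inter_subset_right).mono' ?_ ?_
  · exact ((by fun_prop : Continuous fun z : Eucl N => ‖z‖ ^ m).aestronglyMeasurable).mul
      (hw.meas.mono_set inter_subset_left)
  · have h2 : ∀ᵐ z ∂volume.restrict (sector N m ∩ Metric.ball 0 r), |w z| ≤ A * ‖z‖ ^ (-κ) :=
      ae_restrict_of_ae_restrict_of_subset inter_subset_left hw.le
    filter_upwards [h2, ae_restrict_mem (measurableSet_sector.inter measurableSet_ball)]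
      with z hz hz2
    have hz0 : 0 < ‖z‖ := norm_pos_iff.2 (sector_ne_zero hw.one_le hw.le_dim hz2.1)
    rw [norm_mul, norm_pow, norm_norm, Real.norm_eq_abs, sub_eq_add_neg, Real.rpow_add hz0,
      Real.rpow_natCast]
    calc ‖z‖ ^ m * |w z| ≤ ‖z‖ ^ m * (A * ‖z‖ ^ (-κ)) := by gcongr
      _ = _ := by ring

theorem integrableOn_smul_sectorC0 (hw : SingularData m κ A w) {t : ℝ} (ht : 0 < t) (r : ℝ) :
    IntegrableOn (fun z => w z • sectorC0 m ht z) (sector N m ∩ Metric.ball 0 r) := by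
  refine ((hw.integrableOn_norm_pow_mul r).norm.const_mul
    ((4 * Real.pi * t) ^ (-(N : ℝ) / 2) / √t ^ m)).mono' ?_ (Eventually.of_forall fun z => ?_)
  · exact (hw.meas.mono_set inter_subset_left).smul (continuous_sectorC0 ht).aestronglyMeasurable
  · rw [norm_smul]
    refine (mul_le_mul_of_nonneg_left (norm_sectorC0_le hw.le_dim ht z) (norm_nonneg _)).trans_eq ?_
    rw [norm_mul, norm_pow, norm_norm, div_pow]
    ring

theorem abs_le_of_notMem_ball (hw : SingularData m κ A w) {r : ℝ}
    (hr : 0 < r) :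
    ∀ᵐ z ∂volume.restrict (sector N m \ Metric.ball 0 r), |w z| ≤ A * r ^ (-κ) := by
  have h2 : ∀ᵐ z ∂volume.restrict (sector N m \ Metric.ball 0 r), |w z| ≤ A * ‖z‖ ^ (-κ) :=
    ae_restrict_of_ae_restrict_of_subset sdiff_subset hw.le
  filter_upwards [h2, ae_restrict_mem (measurableSet_sector.diff measurableSet_ball)] with z hz hz2
  have h3 : r ≤ ‖z‖ := by simpa using hz2.2
  refine hz.trans (mul_le_mul_of_nonneg_left ?_ hw.nonneg)
  exact Real.rpow_le_rpow_of_nonpos hr h3 (by linarith [hw.kappa_pos])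

theorem integrableOn_sectorKernel_mul_diff (hw : SingularData m κ A w)
    {t : ℝ} (ht : 0 < t) (x : Eucl N) {r : ℝ} (hr : 0 < r) :
    IntegrableOn (fun z => sectorKernel m t x z * w z) (sector N m \ Metric.ball 0 r) :=
  (integrable_sectorKernel ht x).integrableOn.mul_bdd (c := A * r ^ (-κ))
    (hw.meas.mono_set sdiff_subset) (hw.abs_le_of_notMem_ball hr)

theorem abs_setIntegral_diff_le (hw : SingularData m κ A w) {t : ℝ} (ht : 0 < t) (x : Eucl N)
    {r : ℝ} (hr : 0 < r) :
    |∫ z in sector N m \ Metric.ball 0 r, sectorKernel m t x z * w z| ≤ 2 ^ m * (A * r ^ (-κ)) := by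
  have hA := hw.nonneg
  have h1 : ∀ᵐ z ∂volume.restrict (sector N m \ Metric.ball 0 r),
      ‖sectorKernel m t x z * w z‖ ≤ |sectorKernel m t x z| * (A * r ^ (-κ)) := by
    filter_upwards [hw.abs_le_of_notMem_ball hr] with z hz
    rw [norm_mul]
    exact mul_le_mul_of_nonneg_left hz (abs_nonneg _)
  refine (norm_integral_le_of_norm_le
    ((integrable_sectorKernel ht x).abs.integrableOn.mul_const _) h1).trans ?_
  rw [integral_mul_const]
  refine mul_le_mul_of_nonneg_right ?_ (by positivity)
  refine (setIntegral_le_integral (integrable_sectorKernel ht x).abs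
    (Eventually.of_forall fun z => abs_nonneg _)).trans ?_
  exact (integral_abs_sectorKernel_le ht x).trans_eq (by rw [card_headCoords hw.le_dim])

theorem integrableOn_sectorKernel_mul_ball (hw : SingularData m κ A w) {t : ℝ} (ht : 0 < t)
    (x : Eucl N) (r : ℝ) :
    IntegrableOn (fun z => sectorKernel m t x z * w z) (sector N m ∩ Metric.ball 0 r) := by
  refine ((evalCLM x).integrable_comp (hw.integrableOn_smul_sectorC0 ht r)).congr
    (Eventually.of_forall fun z => ?_)
  simp only [map_smul, evalCLM_apply, sectorC0_apply, smul_eq_mul, mul_comm]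

theorem integrableOn_sectorKernel_mul (hw : SingularData m κ A w) {t : ℝ} (ht : 0 < t)
    (x : Eucl N) :
    IntegrableOn (fun z => sectorKernel m t x z * w z) (sector N m) := by
  have := (hw.integrableOn_sectorKernel_mul_ball ht x 1).union
    (hw.integrableOn_sectorKernel_mul_diff ht x one_pos)
  rwa [inter_union_sdiff] at this

theorem abs_trunc_sub_le (hw : SingularData m κ A w) {t : ℝ} (ht : 0 < t) (x : Eucl N)
    {r : ℝ} (hr : 0 < r) :
    |(∫ z in sector N m ∩ Metric.ball 0 r, w z • sectorC0 m ht z) x -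
      ∫ z in sector N m, sectorKernel m t x z * w z| ≤ 2 ^ m * (A * r ^ (-κ)) := by
  rw [ZeroAtInftyContinuousMap.integral_apply (hw.integrableOn_smul_sectorC0 ht r)]
  have h1 : ∀ z, (w z • sectorC0 m ht z) x = sectorKernel m t x z * w z := fun z => by
    rw [ZeroAtInftyContinuousMap.smul_apply, sectorC0_apply, smul_eq_mul, mul_comm]
  simp_rw [h1]
  rw [← integral_inter_add_sdiff (s := sector N m) measurableSet_ball
    (hw.integrableOn_sectorKernel_mul ht x), sub_add_cancel_left, abs_neg]
  exact hw.abs_setIntegral_diff_le ht x hr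

theorem tendsto_trunc_error (hκ0 : 0 < κ) (A : ℝ) :
    Tendsto (fun n : ℕ => 2 ^ m * (A * ((n : ℝ) + 1) ^ (-κ))) atTop (𝓝 0) := by
  have h := (tendsto_rpow_neg_atTop hκ0).comp
    (tendsto_atTop_add_const_right atTop (1 : ℝ) tendsto_natCast_atTop_atTop)
  simpa using (h.const_mul A).const_mul (2 ^ m)

theorem exists_evol (hw : SingularData m κ A w) {t : ℝ} (ht : 0 < t) :
    ∃ L : C₀(Eucl N, ℝ), ∀ x, L x = ∫ z in sector N m, sectorKernel m t x z * w z := by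
  have hA := hw.nonneg
  set Tn : ℕ → C₀(Eucl N, ℝ) := fun n =>
    ∫ z in sector N m ∩ Metric.ball 0 ((n : ℝ) + 1), w z • sectorC0 m ht z with hTn
  set e : ℕ → ℝ := fun n => 2 ^ m * (A * ((n : ℝ) + 1) ^ (-κ)) with he
  have hT : ∀ n x, |Tn n x - ∫ z in sector N m, sectorKernel m t x z * w z| ≤ e n := fun n x =>
    hw.abs_trunc_sub_le ht x (by positivity)
  have he0 : Tendsto e atTop (𝓝 0) := tendsto_trunc_error hw.kappa_pos A
  have hanti : Antitone e := fun a b hab => by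
    have : ((b : ℝ) + 1) ^ (-κ) ≤ ((a : ℝ) + 1) ^ (-κ) :=
      Real.rpow_le_rpow_of_nonpos (by positivity) (by exact_mod_cast Nat.succ_le_succ hab)
        (by linarith [hw.kappa_pos])
    simp only [he]
    gcongr
  have hc : CauchySeq Tn := by
    refine cauchySeq_of_le_tendsto_0 (fun n => e n + e n) (fun n k M hn hk => ?_)
      (by simpa using he0.add he0)
    rw [dist_eq_norm]
    refine norm_le_of_abs_apply_le (by positivity) fun x => ?_
    have h1 := (hT n x).trans (hanti hn)
    have h2 := (hT k x).trans (hanti hk)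
    rw [ZeroAtInftyContinuousMap.sub_apply]
    rw [abs_le] at *
    constructor <;> linarith
  obtain ⟨L, hL⟩ := cauchySeq_tendsto_of_complete hc
  refine ⟨L, fun x => ?_⟩
  have h1 : Tendsto (fun n => Tn n x) atTop (𝓝 (L x)) := ((evalCLM x).continuous.tendsto L).comp hL
  refine tendsto_nhds_unique h1 ?_
  rw [tendsto_iff_norm_sub_tendsto_zero]
  exact squeeze_zero (fun n => norm_nonneg _) (fun n => hT n x) he0

theorem evol_apply (hw : SingularData m κ A w) {t : ℝ} (ht : 0 < t) (x : Eucl N) :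
    evol m w t x = ∫ z in sector N m, sectorKernel m t x z * w z :=
  Classical.epsilon_spec (hw.exists_evol ht) x

theorem tendsto_trunc (hw : SingularData m κ A w) {t : ℝ} (ht : 0 < t) :
    Tendsto (fun n : ℕ => ∫ z in sector N m ∩ Metric.ball 0 ((n : ℝ) + 1), w z • sectorC0 m ht z)
      atTop (𝓝 (evol m w t)) := by
  have hA := hw.nonneg
  rw [tendsto_iff_norm_sub_tendsto_zero]
  refine squeeze_zero (fun n => norm_nonneg _) (fun n => ?_)
    (tendsto_trunc_error (m := m) hw.kappa_pos A)
  refine norm_le_of_abs_apply_le (by positivity) fun x => ?_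
  rw [ZeroAtInftyContinuousMap.sub_apply, hw.evol_apply ht]
  exact hw.abs_trunc_sub_le ht x (by positivity)

theorem heatOp_evol_of_pos (hw : SingularData m κ A w) {s t : ℝ} (hs : 0 < s) (ht : 0 < t) :
    heatOp s (evol m w t) = evol m w (s + t) := by
  have h1 := ((heatOp s).continuous.tendsto _).comp (hw.tendsto_trunc ht)
  have h2 := hw.tendsto_trunc (add_pos hs ht)
  refine tendsto_nhds_unique h1 (h2.congr fun n => ?_)
  rw [Function.comp_apply, ← (heatOp s).integral_comp_comm
    (hw.integrableOn_smul_sectorC0 ht _)]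
  simp_rw [map_smul, heatOp_sectorC0 hs ht]

theorem heatOp_evol (hw : SingularData m κ A w) {s t : ℝ} (hs : 0 ≤ s) (ht : 0 < t) :
    heatOp s (evol m w t) = evol m w (s + t) := by
  rcases hs.eq_or_lt with rfl | hs
  · rw [heatOp_of_nonpos le_rfl, zero_add]
  · exact hw.heatOp_evol_of_pos hs ht

theorem continuousOn_evol (hw : SingularData m κ A w) :
    ContinuousOn (evol m w) (Ioi 0) := by
  intro t ht
  have ht' : (0 : ℝ) < t := ht
  have h1 : ContinuousAt (fun s => heatOp (s - t / 2) (evol m w (t / 2))) t :=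
    ((continuous_heatOp _).comp (continuous_id.sub continuous_const)).continuousAt
  refine (h1.congr ?_).continuousWithinAt
  filter_upwards [lt_mem_nhds (half_lt_self ht')] with s hs
  rw [hw.heatOp_evol (by linarith) (by positivity)]
  congr 1; ring

theorem evol_antisymmIn (hw : SingularData m κ A w) {t : ℝ} (ht : 0 < t) :
    AntisymmIn m (evol m w t) := by
  intro i hi x
  rw [hw.evol_apply ht, hw.evol_apply ht, ← integral_neg]
  congr 1
  ext z
  have : sectorKernel m t (reflectCoord i x) z = -sectorKernel m t x z :=
    sectorKernel_antisymmIn t z i hi x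
  rw [this]; ring

theorem abs_evol_le {A' : ℝ} {v : Eucl N → ℝ} (hw : SingularData m κ A w)
    (hv : SingularData m κ A' v)
    (h : ∀ᵐ z ∂volume.restrict (sector N m), |w z| ≤ v z) {t : ℝ} (ht : 0 < t)
    {x : Eucl N} (hx : x ∈ sector N m) : |evol m w t x| ≤ evol m v t x := by
  rw [hw.evol_apply ht, hv.evol_apply ht]
  rw [← Real.norm_eq_abs]
  refine norm_integral_le_of_norm_le (hv.integrableOn_sectorKernel_mul ht x) ?_
  filter_upwards [h, ae_restrict_mem measurableSet_sector] with z hz hz2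
  rw [norm_mul, Real.norm_of_nonneg (sectorKernel_pos ht hx hz2).le]
  exact mul_le_mul_of_nonneg_left hz (sectorKernel_pos ht hx hz2).le

theorem evol_pos (hw : SingularData m κ A w)
    (h0 : ∀ᵐ z ∂volume.restrict (sector N m), 0 ≤ w z)
    (h1 : ¬ ∀ᵐ z ∂volume.restrict (sector N m), w z = 0) {t : ℝ} (ht : 0 < t)
    {x : Eucl N} (hx : x ∈ sector N m) : 0 < evol m w t x := by
  rw [hw.evol_apply ht]
  have hnn : 0 ≤ᵐ[volume.restrict (sector N m)] fun z => sectorKernel m t x z * w z := by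
    filter_upwards [h0, ae_restrict_mem measurableSet_sector] with z hz hz2
    exact mul_nonneg (sectorKernel_pos ht hx hz2).le hz
  refine lt_of_le_of_ne (integral_nonneg_of_ae hnn) fun h2 => h1 ?_
  rw [eq_comm, integral_eq_zero_iff_of_nonneg_ae hnn
    (hw.integrableOn_sectorKernel_mul ht x)] at h2
  filter_upwards [h2, ae_restrict_mem measurableSet_sector] with z hz hz2
  exact (mul_eq_zero.1 hz).resolve_left (sectorKernel_pos ht hx hz2).ne'

theorem const_mul (hw : SingularData m κ A w) {l : ℝ} (hl : 0 ≤ l) :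
    SingularData m κ (l * A) fun z => l * w z where
  __ := hw
  nonneg := mul_nonneg hl hw.nonneg
  meas := hw.meas.const_mul l
  le := by
    filter_upwards [hw.le] with z hz
    rw [abs_mul, abs_of_nonneg hl, mul_assoc]
    exact mul_le_mul_of_nonneg_left hz hl

theorem abs (hw : SingularData m κ A w) : SingularData m κ A fun z => |w z| where
  __ := hw
  meas := hw.meas.norm
  le := by simpa using hw.le

end SingularData

/-- The smoothing estimate for the linear evolution of singular data. -/
theorem exists_norm_evol_le : ∃ B > 0, ∀ (A : ℝ) (w : Eucl N → ℝ), SingularData m κ A w →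
      ∀ t > 0, ‖evol m w t‖ ≤ B * A * t ^ (-(κ / 2)) := by
  set J := ∫ z in Metric.ball (0 : Eucl N) 1, ‖z‖ ^ ((m : ℝ) - κ) with hJ
  have hJ0 : 0 ≤ J := integral_nonneg fun z => by positivity
  refine ⟨(4 * Real.pi) ^ (-(N : ℝ) / 2) * J + 2 ^ m, by positivity, fun A w hw t ht => ?_⟩
  have hA := hw.nonneg
  refine norm_le_of_abs_apply_le (by positivity) fun x => ?_
  have hst : 0 < √t := Real.sqrt_pos.2 ht
  rw [hw.evol_apply ht, ← integral_inter_add_sdiff (s := sector N m)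
    (measurableSet_ball (x := (0 : Eucl N)) (ε := √t))
    (hw.integrableOn_sectorKernel_mul ht x)]
  refine (abs_add_le _ _).trans ?_
  rw [add_mul, add_mul]
  refine add_le_add ?_ ?_
  · have hb : IntegrableOn (fun z : Eucl N =>
        ((4 * Real.pi * t) ^ (-(N : ℝ) / 2) * (√t ^ m)⁻¹ * A) * ‖z‖ ^ ((m : ℝ) - κ))
        (Metric.ball 0 √t) := (integrableOn_ball_norm_rpow hw.one_le_dim (p := m - κ)
      (by linarith [hw.kappa_lt]) √t).const_mul
        ((4 * Real.pi * t) ^ (-(N : ℝ) / 2) * (√t ^ m)⁻¹ * A)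
    rw [← Real.norm_eq_abs]
    refine (norm_integral_le_of_norm_le (hb.mono_set inter_subset_right) ?_).trans
      ((setIntegral_mono_set hb (Eventually.of_forall fun z => by positivity)
        (LE.le.eventuallyLE inter_subset_right)).trans ?_)
    · have h2 : ∀ᵐ z ∂volume.restrict (sector N m ∩ Metric.ball 0 √t), |w z| ≤ A * ‖z‖ ^ (-κ) :=
        ae_restrict_of_ae_restrict_of_subset inter_subset_left hw.le
      filter_upwards [h2, ae_restrict_mem (measurableSet_sector.inter measurableSet_ball)]
        with z hz hz2
      have hz0 : 0 < ‖z‖ := norm_pos_iff.2 (sector_ne_zero hw.one_le hw.le_dim hz2.1)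
      rw [norm_mul, Real.norm_eq_abs, Real.norm_eq_abs]
      refine (mul_le_mul (abs_sectorKernel_le hw.le_dim ht x z) hz (abs_nonneg _)
        (by positivity)).trans_eq ?_
      rw [sub_eq_add_neg, Real.rpow_add hz0, Real.rpow_natCast, div_pow]
      ring
    · rw [integral_const_mul, setIntegral_ball_norm_rpow hst, ← hJ]
      have e1 : (4 * Real.pi * t) ^ (-(N : ℝ) / 2) =
          (4 * Real.pi) ^ (-(N : ℝ) / 2) * t ^ (-(N : ℝ) / 2) :=
        Real.mul_rpow (by positivity) ht.le
      have e2 : (√t ^ m)⁻¹ = t ^ (-(m : ℝ) / 2) := by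
        rw [Real.sqrt_eq_rpow, ← Real.rpow_natCast, ← Real.rpow_mul ht.le, ← Real.rpow_neg ht.le]
        congr 1; ring
      have e3 : √t ^ ((N : ℝ) + (m - κ)) = t ^ (((N : ℝ) + (m - κ)) / 2) := by
        rw [Real.sqrt_eq_rpow, ← Real.rpow_mul ht.le]
        congr 1; ring
      have e4 : t ^ (-(N : ℝ) / 2) * t ^ (-(m : ℝ) / 2) * t ^ (((N : ℝ) + (m - κ)) / 2) =
          t ^ (-(κ / 2)) := by
        rw [← Real.rpow_add ht, ← Real.rpow_add ht]
        congr 1; ring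
      rw [e1, e2, e3, ← e4]
      exact le_of_eq (by ring)
  · refine (hw.abs_setIntegral_diff_le ht x hst).trans_eq ?_
    rw [Real.sqrt_eq_rpow, ← Real.rpow_mul ht.le, mul_assoc]
    congr 3; ring

end Evol

/-! ### The nonlinearity -/

theorem one_sub_rpow_mul_le {α r : ℝ} (hα : 0 < α) (hr0 : 0 ≤ r) :
    (1 - r ^ α) * r ≤ α * (1 - r) := by
  rcases hr0.eq_or_lt with rfl | hr
  · simp [hα.le]
  have h1 : 1 + α * Real.log r ≤ r ^ α := by
    rw [Real.rpow_def_of_pos hr, mul_comm (Real.log r)]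
    linarith [Real.add_one_le_exp (α * Real.log r)]
  have h2 := Real.one_sub_inv_le_log_of_pos hr
  have h3 : 1 - r ^ α ≤ α * (r⁻¹ - 1) := by nlinarith
  calc (1 - r ^ α) * r ≤ α * (r⁻¹ - 1) * r := by gcongr
    _ = α * (1 - r) := by field_simp

theorem abs_rpow_mul_sub_le {α R a b : ℝ} (hα : 0 < α) (ha : |a| ≤ R) (hb : |b| ≤ R) :
    |(|a| ^ α * a) - |b| ^ α * b| ≤ (α + 1) * R ^ α * |a - b| := by
  wlog hab : |b| ≤ |a| generalizing a b
  · have := this hb ha (le_of_not_ge hab)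
    rwa [abs_sub_comm, abs_sub_comm b a] at this
  have key : (|a| ^ α - |b| ^ α) * |b| ≤ α * |a| ^ α * (|a| - |b|) := by
    rcases (abs_nonneg a).eq_or_lt with h0 | h0
    · have hb0 : |b| = 0 := le_antisymm (hab.trans_eq h0.symm) (abs_nonneg b)
      rw [← h0, hb0]; simp
    have h1 := one_sub_rpow_mul_le hα (r := |b| / |a|) (by positivity)
    rw [Real.div_rpow (abs_nonneg _) (abs_nonneg _)] at h1
    have hp : 0 < |a| ^ α := by positivity
    have h2 := mul_le_mul_of_nonneg_right h1 (by positivity : 0 ≤ |a| ^ α * |a|)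
    calc (|a| ^ α - |b| ^ α) * |b| = (1 - |b| ^ α / |a| ^ α) * (|b| / |a|) * (|a| ^ α * |a|) := by
          field_simp
      _ ≤ _ := h2
      _ = _ := by field_simp
  have hmono : |b| ^ α ≤ |a| ^ α := Real.rpow_le_rpow (abs_nonneg _) hab hα.le
  have e : |a| ^ α * a - |b| ^ α * b = |a| ^ α * (a - b) + (|a| ^ α - |b| ^ α) * b := by ring
  have hle : |a| ^ α ≤ R ^ α := Real.rpow_le_rpow (abs_nonneg _) ha hα.le
  have hp : 0 ≤ |a| ^ α := by positivity
  have h5 := abs_sub_abs_le_abs_sub a b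
  rw [e]
  refine (abs_add_le _ _).trans ?_
  rw [abs_mul, abs_mul, abs_of_nonneg hp, abs_of_nonneg (sub_nonneg.2 hmono)]
  calc |a| ^ α * |a - b| + (|a| ^ α - |b| ^ α) * |b|
      ≤ |a| ^ α * |a - b| + α * |a| ^ α * |a - b| := by
        have : α * |a| ^ α * (|a| - |b|) ≤ α * |a| ^ α * |a - b| := by gcongr
        linarith
    _ = (α + 1) * |a| ^ α * |a - b| := by ring
    _ ≤ _ := by gcongr

/-- The nonlinearity `f ↦ |f| ^ α f` on `C₀`. -/
noncomputable def nonlinOp {N : ℕ} {α : ℝ} (hα : 0 < α) (f : C₀(Eucl N, ℝ)) : C₀(Eucl N, ℝ) where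
  toFun x := |f x| ^ α * f x
  continuous_toFun :=
    ((map_continuous f).abs.rpow_const fun _ => Or.inr hα.le).mul (map_continuous f)
  zero_at_infty' := by
    have h : Continuous fun r : ℝ => |r| ^ α * r :=
      (continuous_abs.rpow_const fun _ => Or.inr hα.le).mul continuous_id
    have := (h.tendsto 0).comp (zero_at_infty f)
    simpa [Function.comp_def] using this

section Nonlin

variable {N m : ℕ} {α : ℝ} (hα : 0 < α)

theorem nonlinOp_apply (f : C₀(Eucl N, ℝ)) (x : Eucl N) : nonlinOp hα f x = |f x| ^ α * f x := rfl

theorem coe_nonlinOp (f : C₀(Eucl N, ℝ)) : ⇑(nonlinOp hα f) = nonlin α f := rfl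

theorem abs_nonlinOp_sub_le {f g : C₀(Eucl N, ℝ)} {R : ℝ} {x : Eucl N} (hf : |f x| ≤ R)
    (hg : |g x| ≤ R) :
    |(nonlinOp hα f - nonlinOp hα g) x| ≤ (α + 1) * R ^ α * |(f - g) x| :=
  abs_rpow_mul_sub_le hα hf hg

theorem norm_nonlinOp_sub_le {f g : C₀(Eucl N, ℝ)} {R : ℝ} (hf : ‖f‖ ≤ R) (hg : ‖g‖ ≤ R) :
    ‖nonlinOp hα f - nonlinOp hα g‖ ≤ (α + 1) * R ^ α * ‖f - g‖ := by
  have hR : 0 ≤ R := (norm_nonneg f).trans hf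
  refine norm_le_of_abs_apply_le (by positivity) fun x => ?_
  refine (abs_nonlinOp_sub_le hα ((abs_apply_le_norm f x).trans hf)
    ((abs_apply_le_norm g x).trans hg)).trans ?_
  gcongr
  exact abs_apply_le_norm _ x

theorem continuous_nonlinOp : Continuous (nonlinOp hα : C₀(Eucl N, ℝ) → C₀(Eucl N, ℝ)) := by
  rw [continuous_iff_continuousAt]
  intro f
  rw [ContinuousAt, tendsto_iff_norm_sub_tendsto_zero]
  have h1 : Tendsto (fun g => (α + 1) * (‖f‖ + 1) ^ α * ‖g - f‖) (𝓝 f) (𝓝 0) := by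
    have : Tendsto (fun g : C₀(Eucl N, ℝ) => ‖g - f‖) (𝓝 f) (𝓝 0) := by
      simpa using ((continuous_id.sub continuous_const).norm.tendsto f :
        Tendsto (fun g : C₀(Eucl N, ℝ) => ‖g - f‖) (𝓝 f) _)
    simpa using this.const_mul ((α + 1) * (‖f‖ + 1) ^ α)
  refine squeeze_zero' (Eventually.of_forall fun _ => norm_nonneg _) ?_ h1
  filter_upwards [Metric.ball_mem_nhds f one_pos] with g hg
  rw [mem_ball_iff_norm] at hg
  refine norm_nonlinOp_sub_le hα ?_ (by linarith)
  have := norm_sub_norm_le g f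
  linarith

theorem nonlinOp_antisymmIn {f : C₀(Eucl N, ℝ)} (hf : AntisymmIn m f) :
    AntisymmIn m (nonlinOp hα f) := by
  intro i hi x
  rw [nonlinOp_apply, nonlinOp_apply, hf i hi x, abs_neg]
  ring

theorem nonlinOp_zero : nonlinOp hα (0 : C₀(Eucl N, ℝ)) = 0 := by
  ext x; simp [nonlinOp_apply]

end Nonlin

theorem AntisymmIn.sub {N m : ℕ} {f g : C₀(Eucl N, ℝ)} (hf : AntisymmIn m f)
    (hg : AntisymmIn m g) : AntisymmIn m (f - g : C₀(Eucl N, ℝ)) := fun i hi x => by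
  simp only [ZeroAtInftyContinuousMap.sub_apply, hf i hi x, hg i hi x]
  ring

theorem AntisymmIn.add_smul {N m : ℕ} {f g : C₀(Eucl N, ℝ)} (hf : AntisymmIn m f)
    (hg : AntisymmIn m g) (a : ℝ) : AntisymmIn m (f + a • g : C₀(Eucl N, ℝ)) := fun i hi x => by
  simp only [ZeroAtInftyContinuousMap.add_apply, ZeroAtInftyContinuousMap.smul_apply, hf i hi x,
    hg i hi x, smul_eq_mul]
  ring

theorem antisymmIn_intervalIntegral {N m : ℕ} {g : ℝ → C₀(Eucl N, ℝ)} {a b : ℝ} (hab : a ≤ b)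
    (hi : IntervalIntegrable g volume a b) (hg : ∀ s ∈ Ioc a b, AntisymmIn m (g s)) :
    AntisymmIn m (∫ s in a..b, g s : C₀(Eucl N, ℝ)) := by
  intro i him x
  rw [intervalIntegral_apply hi, intervalIntegral_apply hi, ← intervalIntegral.integral_neg]
  refine intervalIntegral.integral_congr_ae (Eventually.of_forall fun s hs => ?_)
  rw [uIoc_of_le hab] at hs
  exact hg s hs i him x

/-! ### The Duhamel term -/

section Duhamel

variable {N m : ℕ}

theorem continuousOn_heatOp_sub {T : ℝ} {g : ℝ → C₀(Eucl N, ℝ)} (hg : ContinuousOn g (Ioc 0 T))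
    (t : ℝ) : ContinuousOn (fun σ => heatOp (t - σ) (g σ)) (Ioc 0 T) :=
  continuousOn_heatOp (continuousOn_const.sub continuousOn_id) hg

theorem intervalIntegrable_duhamel {T t : ℝ} {g : ℝ → C₀(Eucl N, ℝ)} {q b : ℝ → ℝ}
    (hg : ContinuousOn g (Ioc 0 T)) (hq : IntervalIntegrable q volume 0 T)
    (hgq : ∀ σ t, 0 < σ → σ ≤ t → t ≤ T → ‖heatOp (t - σ) (g σ)‖ ≤ q σ * b t)
    (ht : t ∈ Ioc 0 T) : IntervalIntegrable (fun σ => heatOp (t - σ) (g σ)) volume 0 t := by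
  rw [intervalIntegrable_iff_integrableOn_Ioc_of_le ht.1.le]
  have hq' : IntegrableOn q (Ioc 0 t) := by
    rw [intervalIntegrable_iff_integrableOn_Ioc_of_le (ht.1.le.trans ht.2)] at hq
    exact hq.mono_set (Ioc_subset_Ioc_right ht.2)
  refine Integrable.mono' (hq'.mul_const (b t)) ?_ ?_
  · exact ((continuousOn_heatOp_sub hg t).mono (Ioc_subset_Ioc_right ht.2)).aestronglyMeasurable
      measurableSet_Ioc
  · filter_upwards [ae_restrict_mem measurableSet_Ioc] with σ hσ
    exact hgq σ t hσ.1 hσ.2 ht.2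

theorem continuousOn_duhamel {T : ℝ} {g : ℝ → C₀(Eucl N, ℝ)} {q b : ℝ → ℝ}
    (hg : ContinuousOn g (Ioc 0 T)) (hq : IntervalIntegrable q volume 0 T)
    (hq0 : ∀ σ ∈ Ioc 0 T, 0 ≤ q σ) (hb : ContinuousOn b (Ioc 0 T)) (hb0 : ∀ t ∈ Ioc 0 T, 0 ≤ b t)
    (hgq : ∀ σ t, 0 < σ → σ ≤ t → t ≤ T → ‖heatOp (t - σ) (g σ)‖ ≤ q σ * b t) :
    ContinuousOn (fun t => ∫ σ in 0..t, heatOp (t - σ) (g σ)) (Ioc 0 T) := by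
  intro t₀ ht₀
  have hT : 0 ≤ T := ht₀.1.le.trans ht₀.2
  have heq : ∀ t ∈ Ioc 0 T, (∫ σ in 0..t, heatOp (t - σ) (g σ)) =
      ∫ σ, (Ioc 0 t).indicator (fun σ => heatOp (t - σ) (g σ)) σ := fun t ht => by
    rw [integral_indicator measurableSet_Ioc, intervalIntegral.integral_of_le ht.1.le]
  refine ContinuousWithinAt.congr ?_ heq (heq t₀ ht₀)
  have hb' : ∀ᶠ t in 𝓝[Ioc 0 T] t₀, b t ≤ b t₀ + 1 :=
    (hb t₀ ht₀).eventually_le_const (by linarith)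
  have hself : ∀ᶠ t in 𝓝[Ioc 0 T] t₀, t ∈ Ioc 0 T := self_mem_nhdsWithin
  refine continuousWithinAt_of_dominated
    (bound := (Ioc 0 T).indicator fun σ => q σ * (b t₀ + 1)) ?_ ?_ ?_ ?_
  · filter_upwards [hself] with t ht
    have := intervalIntegrable_duhamel hg hq hgq ht
    rw [intervalIntegrable_iff_integrableOn_Ioc_of_le ht.1.le] at this
    exact (this.integrable_indicator measurableSet_Ioc).aestronglyMeasurable
  · filter_upwards [hself, hb'] with t ht htb
    refine Eventually.of_forall fun σ => ?_
    by_cases hσ : σ ∈ Ioc 0 t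
    · have hσT : σ ∈ Ioc 0 T := ⟨hσ.1, hσ.2.trans ht.2⟩
      rw [indicator_of_mem hσ, indicator_of_mem hσT]
      exact (hgq σ t hσ.1 hσ.2 ht.2).trans (mul_le_mul_of_nonneg_left htb (hq0 σ hσT))
    · rw [indicator_of_notMem hσ, norm_zero]
      refine indicator_nonneg (fun s hs => mul_nonneg (hq0 s hs) ?_) σ
      linarith [hb0 t₀ ht₀]
  · rw [intervalIntegrable_iff_integrableOn_Ioc_of_le hT] at hq
    exact IntegrableOn.integrable_indicator (Integrable.mul_const hq _) measurableSet_Ioc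
  · have hne : ∀ᵐ σ : ℝ, σ ≠ t₀ := by simp [ae_iff]
    filter_upwards [hne] with σ hσ
    rcases lt_or_gt_of_ne hσ with h | h
    · by_cases h0 : 0 < σ
      · have h1 : ContinuousWithinAt (fun t => heatOp (t - σ) (g σ)) (Ioc 0 T) t₀ :=
          ((continuous_heatOp _).comp (continuous_id.sub continuous_const)).continuousWithinAt
        refine h1.congr_of_eventuallyEq ?_ ?_
        · filter_upwards [mem_nhdsWithin_of_mem_nhds (lt_mem_nhds h)] with t ht
          rw [indicator_of_mem (show σ ∈ Ioc 0 t from ⟨h0, ht.le⟩)]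
        · rw [indicator_of_mem (show σ ∈ Ioc 0 t₀ from ⟨h0, h.le⟩)]
      · have : ∀ t, (Ioc 0 t).indicator (fun σ => heatOp (t - σ) (g σ)) σ = 0 := fun t =>
          indicator_of_notMem (fun hh => h0 hh.1) _
        simp_rw [this]
        exact continuousWithinAt_const
    · refine (continuousWithinAt_const (b := (0 : C₀(Eucl N, ℝ)))).congr_of_eventuallyEq ?_ ?_
      · filter_upwards [mem_nhdsWithin_of_mem_nhds (gt_mem_nhds h)] with t ht
        exact indicator_of_notMem (fun hh => absurd hh.2 (not_le.2 ht)) _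
      · exact indicator_of_notMem (fun hh => absurd hh.2 (not_le.2 h)) _

end Duhamel

/-! ### Mild solutions in weighted classes -/

/-- A weight on the sector that dominates, up to time `T`, the heat evolution of its multiples. -/
structure HeatWeight {N : ℕ} (m : ℕ) (T : ℝ) (w : ℝ → Eucl N → ℝ) (b : ℝ → ℝ) : Prop where
  nonneg : ∀ t ∈ Ioc 0 T, ∀ x ∈ sector N m, 0 ≤ w t x
  le : ∀ t ∈ Ioc 0 T, ∀ x ∈ sector N m, w t x ≤ b t
  bound_nonneg : ∀ t ∈ Ioc 0 T, 0 ≤ b t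
  cont : ContinuousOn b (Ioc 0 T)
  heat_le : ∀ σ t, 0 < σ → σ ≤ t → t ≤ T → ∀ f : C₀(Eucl N, ℝ), AntisymmIn m f → ∀ r ≥ 0,
    (∀ x ∈ sector N m, |f x| ≤ r * w σ x) → ∀ x ∈ sector N m, |heatOp (t - σ) f x| ≤ r * w t x

/-- Continuous anti-symmetric curves in `C₀` bounded by `K` times a weight. -/
structure WeightedCurve {N : ℕ} (m : ℕ) (T : ℝ) (w : ℝ → Eucl N → ℝ) (K : ℝ)
    (u : ℝ → C₀(Eucl N, ℝ)) : Prop where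
  cont : ContinuousOn u (Ioc 0 T)
  antisymm : ∀ t ∈ Ioc 0 T, AntisymmIn m (u t)
  bound : ∀ t ∈ Ioc 0 T, ∀ x ∈ sector N m, |u t x| ≤ K * w t x

/-- The Duhamel term `∫_0^t e^{(t-σ)Δ} |u|^α u dσ`. -/
noncomputable def duhamel {N : ℕ} {α : ℝ} (hα : 0 < α) (u : ℝ → C₀(Eucl N, ℝ)) (t : ℝ) :
    C₀(Eucl N, ℝ) :=
  ∫ σ in 0..t, heatOp (t - σ) (nonlinOp hα (u σ))

/-- Mild solutions with linear part `L`. -/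
structure MildSol {N : ℕ} {α : ℝ} (hα : 0 < α) (a : ℝ) (L : ℝ → C₀(Eucl N, ℝ)) (J : Set ℝ)
    (u : ℝ → C₀(Eucl N, ℝ)) : Prop where
  cont : ContinuousOn u J
  integrable : ∀ t ∈ J, IntervalIntegrable (fun σ => heatOp (t - σ) (nonlinOp hα (u σ))) volume 0 t
  eqn : ∀ t ∈ J, u t = L t + a • duhamel hα u t

section Picard

variable {N m : ℕ} {α : ℝ} {hα : 0 < α} {T K : ℝ} {w : ℝ → Eucl N → ℝ} {b : ℝ → ℝ}
  {u v : ℝ → C₀(Eucl N, ℝ)}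

/-- The Lipschitz constant of the nonlinearity on functions bounded by `K b`. -/
noncomputable def lipRate (α K : ℝ) (b : ℝ → ℝ) (σ : ℝ) : ℝ := (α + 1) * (K * b σ) ^ α

theorem HeatWeight.lipRate_nonneg (hα : 0 < α) (hw : HeatWeight m T w b) (hK : 0 ≤ K) {σ : ℝ}
    (hσ : σ ∈ Ioc 0 T) : 0 ≤ lipRate α K b σ := by
  have := hw.bound_nonneg σ hσ
  unfold lipRate; positivity

theorem HeatWeight.abs_heatOp_nonlinOp_sub_le (hw : HeatWeight m T w b) (hK : 0 ≤ K)
    (hu : WeightedCurve m T w K u) (hv : WeightedCurve m T w K v) {r : ℝ} (hr : 0 ≤ r)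
    {σ t : ℝ} (hσ : 0 < σ) (hσt : σ ≤ t) (ht : t ≤ T)
    (huv : ∀ x ∈ sector N m, |u σ x - v σ x| ≤ r * w σ x) {x : Eucl N} (hx : x ∈ sector N m) :
    |heatOp (t - σ) (nonlinOp hα (u σ) - nonlinOp hα (v σ)) x| ≤ lipRate α K b σ * r * w t x := by
  have hσT : σ ∈ Ioc 0 T := ⟨hσ, hσt.trans ht⟩
  have hq := hw.lipRate_nonneg hα hK hσT
  refine hw.heat_le σ t hσ hσt ht _ ((nonlinOp_antisymmIn hα (hu.antisymm σ hσT)).sub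
    (nonlinOp_antisymmIn hα (hv.antisymm σ hσT))) _ (by positivity) (fun y hy => ?_) x hx
  have hKw : K * w σ y ≤ K * b σ := mul_le_mul_of_nonneg_left (hw.le σ hσT y hy) hK
  refine (abs_nonlinOp_sub_le hα ((hu.bound σ hσT y hy).trans hKw)
    ((hv.bound σ hσT y hy).trans hKw)).trans
    ((mul_le_mul_of_nonneg_left (huv y hy) hq).trans_eq (mul_assoc _ _ _).symm)

theorem HeatWeight.weightedCurve_zero (hw : HeatWeight m T w b) (hK : 0 ≤ K) :
    WeightedCurve m T w K fun _ => (0 : C₀(Eucl N, ℝ)) where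
  cont := continuousOn_const
  antisymm := fun t _ i _ x => by simp
  bound := fun t ht x hx => by simpa using mul_nonneg hK (hw.nonneg t ht x hx)

theorem HeatWeight.abs_heatOp_nonlinOp_le (hw : HeatWeight m T w b) (hK : 0 ≤ K)
    (hu : WeightedCurve m T w K u) {σ t : ℝ} (hσ : 0 < σ) (hσt : σ ≤ t) (ht : t ≤ T)
    {x : Eucl N} (hx : x ∈ sector N m) :
    |heatOp (t - σ) (nonlinOp hα (u σ)) x| ≤ lipRate α K b σ * K * w t x := by
  have := hw.abs_heatOp_nonlinOp_sub_le (hα := hα) hK hu (hw.weightedCurve_zero hK) hK hσ hσt ht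
    (fun y hy => by simpa using hu.bound σ ⟨hσ, hσt.trans ht⟩ y hy) hx
  simpa [nonlinOp_zero] using this

theorem HeatWeight.norm_heatOp_nonlinOp_le (hw : HeatWeight m T w b) (hK : 0 ≤ K)
    (hu : WeightedCurve m T w K u) {σ t : ℝ} (hσ : 0 < σ) (hσt : σ ≤ t) (ht : t ≤ T) :
    ‖heatOp (t - σ) (nonlinOp hα (u σ))‖ ≤ lipRate α K b σ * (K * b t) := by
  have hσT : σ ∈ Ioc 0 T := ⟨hσ, hσt.trans ht⟩
  have htT : t ∈ Ioc 0 T := ⟨hσ.trans_le hσt, ht⟩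
  have hq := hw.lipRate_nonneg hα hK hσT
  have hb := hw.bound_nonneg t htT
  refine (heatOp_antisymmIn (nonlinOp_antisymmIn hα (hu.antisymm σ hσT)) _).norm_le
    (by positivity) fun x hx => (hw.abs_heatOp_nonlinOp_le hK hu hσ hσt ht hx).trans ?_
  rw [mul_assoc]
  gcongr
  exact hw.le t htT x hx

theorem HeatWeight.intervalIntegrable_heatOp (hw : HeatWeight m T w b) (hK : 0 ≤ K)
    (hu : WeightedCurve m T w K u) (hq : IntervalIntegrable (lipRate α K b) volume 0 T) {t : ℝ}
    (ht : t ∈ Ioc 0 T) :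
    IntervalIntegrable (fun σ => heatOp (t - σ) (nonlinOp hα (u σ))) volume 0 t :=
  intervalIntegrable_duhamel ((continuous_nonlinOp hα).comp_continuousOn hu.cont) hq
    (b := fun t => K * b t)
    (fun _ _ hσ hσt ht => hw.norm_heatOp_nonlinOp_le hK hu hσ hσt ht) ht

theorem HeatWeight.continuousOn_duhamel (hw : HeatWeight m T w b) (hK : 0 ≤ K)
    (hu : WeightedCurve m T w K u) (hq : IntervalIntegrable (lipRate α K b) volume 0 T) :
    ContinuousOn (duhamel hα u) (Ioc 0 T) :=
  _root_.continuousOn_duhamel ((continuous_nonlinOp hα).comp_continuousOn hu.cont) hq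
    (fun _ hσ => hw.lipRate_nonneg hα hK hσ) (hw.cont.const_smul K)
    (fun t ht => mul_nonneg hK (hw.bound_nonneg t ht))
    (fun _ _ hσ hσt ht => hw.norm_heatOp_nonlinOp_le hK hu hσ hσt ht)

theorem HeatWeight.duhamel_antisymmIn (hw : HeatWeight m T w b) (hK : 0 ≤ K)
    (hu : WeightedCurve m T w K u) (hq : IntervalIntegrable (lipRate α K b) volume 0 T) {t : ℝ}
    (ht : t ∈ Ioc 0 T) : AntisymmIn m (duhamel hα u t) :=
  antisymmIn_intervalIntegral ht.1.le (hw.intervalIntegrable_heatOp hK hu hq ht) fun σ hσ =>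
    heatOp_antisymmIn (nonlinOp_antisymmIn hα (hu.antisymm σ ⟨hσ.1, hσ.2.trans ht.2⟩)) _

theorem HeatWeight.abs_duhamel_sub_le (hw : HeatWeight m T w b) (hK : 0 ≤ K)
    (hu : WeightedCurve m T w K u) (hv : WeightedCurve m T w K v)
    (hq : IntervalIntegrable (lipRate α K b) volume 0 T) {r : ℝ} (hr : 0 ≤ r)
    (huv : ∀ t ∈ Ioc 0 T, ∀ x ∈ sector N m, |u t x - v t x| ≤ r * w t x) {t : ℝ}
    (ht : t ∈ Ioc 0 T) {x : Eucl N} (hx : x ∈ sector N m) :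
    |duhamel hα u t x - duhamel hα v t x| ≤ (∫ σ in 0..t, lipRate α K b σ) * r * w t x := by
  have h1 := hw.intervalIntegrable_heatOp (hα := hα) hK hu hq ht
  have h2 := hw.intervalIntegrable_heatOp (hα := hα) hK hv hq ht
  have hq' : IntervalIntegrable (lipRate α K b) volume 0 t :=
    hq.mono_set (by
      rw [uIcc_of_le ht.1.le, uIcc_of_le (ht.1.le.trans ht.2)]
      exact Icc_subset_Icc_right ht.2)
  rw [← ZeroAtInftyContinuousMap.sub_apply, duhamel, duhamel, ← intervalIntegral.integral_sub h1 h2,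
    intervalIntegral_apply (h1.sub h2), mul_assoc, ← intervalIntegral.integral_mul_const,
    ← Real.norm_eq_abs]
  refine intervalIntegral.norm_integral_le_of_norm_le ht.1.le
    (Eventually.of_forall fun σ hσ => ?_) (hq'.mul_const _)
  rw [← map_sub, ← mul_assoc]
  exact hw.abs_heatOp_nonlinOp_sub_le hK hu hv hr hσ.1 hσ.2 ht.2
    (huv σ ⟨hσ.1, hσ.2.trans ht.2⟩) hx

theorem duhamel_zero (t : ℝ) : duhamel hα (fun _ => (0 : C₀(Eucl N, ℝ))) t = 0 := by
  simp [duhamel, nonlinOp_zero]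

theorem HeatWeight.abs_duhamel_le (hw : HeatWeight m T w b) (hK : 0 ≤ K)
    (hu : WeightedCurve m T w K u) (hq : IntervalIntegrable (lipRate α K b) volume 0 T) {t : ℝ}
    (ht : t ∈ Ioc 0 T) {x : Eucl N} (hx : x ∈ sector N m) :
    |duhamel hα u t x| ≤ (∫ σ in 0..t, lipRate α K b σ) * K * w t x := by
  have := hw.abs_duhamel_sub_le (hα := hα) hK hu (hw.weightedCurve_zero hK) hq hK
    (fun t ht x hx => by simpa using hu.bound t ht x hx) ht hx
  simpa [duhamel_zero] using this

theorem HeatWeight.integral_lipRate_le (hα : 0 < α) (hw : HeatWeight m T w b) (hK : 0 ≤ K)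
    (hq : IntervalIntegrable (lipRate α K b) volume 0 T) {t : ℝ} (ht : t ∈ Ioc 0 T) :
    ∫ σ in 0..t, lipRate α K b σ ≤ ∫ σ in 0..T, lipRate α K b σ := by
  refine intervalIntegral.integral_mono_interval le_rfl ht.1.le ht.2 ?_ hq
  filter_upwards [ae_restrict_mem measurableSet_Ioc] with σ hσ
  exact hw.lipRate_nonneg hα hK hσ

/-- Existence in a weighted class by Picard iteration. -/
theorem HeatWeight.exists_mildSol (hα : 0 < α) (hw : HeatWeight m T w b)
    (hq : IntervalIntegrable (lipRate α 2 b) volume 0 T)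
    (hsmall : ∫ σ in 0..T, lipRate α 2 b σ ≤ 1 / 4) {a : ℝ} (ha : |a| ≤ 1)
    {L : ℝ → C₀(Eucl N, ℝ)} (hL : WeightedCurve m T w 1 L) :
    ∃ u, MildSol hα a L (Ioc 0 T) u ∧ WeightedCurve m T w 2 u ∧
      ∀ t ∈ Ioc 0 T, ∀ x ∈ sector N m, |u t x - L t x| ≤ 1 / 2 * w t x := by
  set Φ : (ℝ → C₀(Eucl N, ℝ)) → ℝ → C₀(Eucl N, ℝ) := fun u t => L t + a • duhamel hα u t with hΦ
  have hk : ∀ t ∈ Ioc 0 T, ∫ σ in 0..t, lipRate α 2 b σ ≤ 1 / 4 := fun t ht =>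
    (hw.integral_lipRate_le hα zero_le_two hq ht).trans hsmall
  have hΦL : ∀ u, WeightedCurve m T w 2 u → ∀ t ∈ Ioc 0 T, ∀ x ∈ sector N m,
      |Φ u t x - L t x| ≤ 1 / 2 * w t x := fun u hu t ht x hx => by
    have h0 := hw.nonneg t ht x hx
    have h1 := hw.abs_duhamel_le (hα := hα) zero_le_two hu hq ht hx
    have h2 : Φ u t x - L t x = a * duhamel hα u t x := by
      simp [hΦ]
    rw [h2, abs_mul]
    have h3 := mul_le_mul_of_nonneg_right (hk t ht) (mul_nonneg zero_le_two h0)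
    have h4 := mul_le_mul_of_nonneg_right ha (abs_nonneg (duhamel hα u t x))
    linarith
  have hΦmem : ∀ u, WeightedCurve m T w 2 u → WeightedCurve m T w 2 (Φ u) := fun u hu =>
    { cont := hL.cont.add ((hw.continuousOn_duhamel zero_le_two hu hq).const_smul a)
      antisymm := fun t ht => (hL.antisymm t ht).add_smul
        (hw.duhamel_antisymmIn zero_le_two hu hq ht) a
      bound := fun t ht x hx => by
        have h0 := hw.nonneg t ht x hx
        have h1 := hΦL u hu t ht x hx
        have h2 := hL.bound t ht x hx
        have h3 := abs_sub_abs_le_abs_sub (Φ u t x) (L t x)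
        linarith }
  have hΦcontr : ∀ u v, WeightedCurve m T w 2 u → WeightedCurve m T w 2 v → ∀ r ≥ 0,
      (∀ t ∈ Ioc 0 T, ∀ x ∈ sector N m, |u t x - v t x| ≤ r * w t x) →
      ∀ t ∈ Ioc 0 T, ∀ x ∈ sector N m, |Φ u t x - Φ v t x| ≤ 1 / 4 * r * w t x := by
    intro u v hu hv r hr huv t ht x hx
    have h0 := hw.nonneg t ht x hx
    have h1 := hw.abs_duhamel_sub_le (hα := hα) zero_le_two hu hv hq hr huv ht hx
    have h2 : Φ u t x - Φ v t x = a * (duhamel hα u t x - duhamel hα v t x) := by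
      simp [hΦ]; ring
    rw [h2, abs_mul]
    have h3 := mul_le_mul_of_nonneg_right (hk t ht) (mul_nonneg hr h0)
    have h4 := mul_le_mul_of_nonneg_right ha (abs_nonneg (duhamel hα u t x - duhamel hα v t x))
    linarith
  set s : ℕ → ℝ → C₀(Eucl N, ℝ) := fun n => Φ^[n] L with hs
  have hsucc : ∀ n, s (n + 1) = Φ (s n) := fun n => Function.iterate_succ_apply' Φ n L
  have hmem : ∀ n, WeightedCurve m T w 2 (s n) := by
    intro n
    induction n with
    | zero =>
      exact ⟨hL.cont, hL.antisymm, fun t ht x hx => (hL.bound t ht x hx).trans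
        (mul_le_mul_of_nonneg_right one_le_two (hw.nonneg t ht x hx))⟩
    | succ n ih => rw [hsucc]; exact hΦmem _ ih
  have hdiff : ∀ n, ∀ t ∈ Ioc 0 T, ∀ x ∈ sector N m,
      |s n t x - s (n + 1) t x| ≤ w t x * (1 / 4) ^ n := by
    intro n
    induction n with
    | zero =>
      intro t ht x hx
      have := hΦL _ (hmem 0) t ht x hx
      have h0 := hw.nonneg t ht x hx
      rw [abs_sub_comm, hsucc, pow_zero]
      change |Φ (s 0) t x - L t x| ≤ _
      linarith
    | succ n ih =>
      intro t ht x hx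
      have := hΦcontr _ _ (hmem n) (hmem (n + 1)) ((1 / 4) ^ n) (by positivity)
        (fun t ht x hx => by rw [mul_comm]; exact ih t ht x hx) t ht x hx
      rw [← hsucc n, ← hsucc (n + 1)] at this
      rw [pow_succ]
      linarith
  have hdist : ∀ t ∈ Ioc 0 T, ∀ n, dist (s n t) (s (n + 1) t) ≤ b t * (1 / 4) ^ n := by
    intro t ht n
    have hb := hw.bound_nonneg t ht
    rw [dist_eq_norm]
    refine (((hmem n).antisymm t ht).sub ((hmem (n + 1)).antisymm t ht)).norm_le (by positivity)
      fun x hx => (hdiff n t ht x hx).trans ?_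
    gcongr
    exact hw.le t ht x hx
  have hlim : ∀ t, ∃ l, t ∈ Ioc 0 T → Tendsto (fun n => s n t) atTop (𝓝 l) := fun t => by
    by_cases ht : t ∈ Ioc 0 T
    · obtain ⟨l, hl⟩ := cauchySeq_tendsto_of_complete
        (cauchySeq_of_le_geometric (1 / 4) (b t) (by norm_num) (hdist t ht))
      exact ⟨l, fun _ => hl⟩
    · exact ⟨0, fun h => absurd h ht⟩
  choose u hu using hlim
  have hux : ∀ t ∈ Ioc 0 T, ∀ x, Tendsto (fun n => s n t x) atTop (𝓝 (u t x)) := fun t ht x =>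
    ((evalCLM x).continuous.tendsto _).comp (hu t ht)
  have hun : ∀ n, ∀ t ∈ Ioc 0 T, ‖s n t - u t‖ ≤ 2 * (1 / 4) ^ n * b t := fun n t ht => by
    have h1 := dist_le_of_le_geometric_of_tendsto (1 / 4) (b t) (by norm_num) (hdist t ht)
      (hu t ht) n
    rw [dist_eq_norm] at h1
    have hb := hw.bound_nonneg t ht
    refine h1.trans ?_
    rw [show (1 : ℝ) - 1 / 4 = 3 / 4 by norm_num]
    have : 0 ≤ b t * (1 / 4) ^ n := by positivity
    linarith
  have hunx : ∀ n, ∀ t ∈ Ioc 0 T, ∀ x ∈ sector N m,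
      |s n t x - u t x| ≤ 2 * (1 / 4) ^ n * w t x := fun n t ht x hx => by
    have h1 := dist_le_of_le_geometric_of_tendsto (1 / 4) (w t x) (by norm_num)
      (fun n => by rw [Real.dist_eq]; exact hdiff n t ht x hx) (hux t ht x) n
    rw [Real.dist_eq] at h1
    have hb := hw.nonneg t ht x hx
    refine h1.trans ?_
    rw [show (1 : ℝ) - 1 / 4 = 3 / 4 by norm_num]
    have : 0 ≤ w t x * (1 / 4) ^ n := by positivity
    linarith
  have hpow : Tendsto (fun n : ℕ => (1 / 4 : ℝ) ^ n) atTop (𝓝 0) :=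
    tendsto_pow_atTop_nhds_zero_of_lt_one (by norm_num) (by norm_num)
  have humem : WeightedCurve m T w 2 u := by
    refine ⟨?_, ?_, ?_⟩
    · refine continuousOn_of_locally_uniform_approx_of_continuousWithinAt fun t ht V hV => ?_
      obtain ⟨ε, hε, hεV⟩ := Metric.mem_uniformity_dist.1 hV
      have hb := hw.bound_nonneg t ht
      obtain ⟨n, hn⟩ := ((hpow.const_mul (2 * (b t + 1))).eventually_lt_const
        (by simpa using hε)).exists
      refine ⟨Ioc 0 T ∩ {t' | b t' < b t + 1}, ?_, s n, (hmem n).cont t ht, fun y hy => hεV ?_⟩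
      · exact inter_mem self_mem_nhdsWithin ((hw.cont t ht).eventually_lt_const (by linarith))
      · rw [dist_comm, dist_eq_norm]
        refine (hun n y hy.1).trans_lt (lt_of_le_of_lt ?_ hn)
        have h3 : b y ≤ b t + 1 := le_of_lt hy.2
        have : 2 * (1 / 4 : ℝ) ^ n * b y ≤ 2 * (1 / 4) ^ n * (b t + 1) := by gcongr
        linarith
    · intro t ht i hi x
      exact tendsto_nhds_unique (hux t ht (reflectCoord i x)) (((hux t ht x).neg).congr fun n =>
        ((hmem n).antisymm t ht i hi x).symm)
    · intro t ht x hx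
      exact le_of_tendsto (hux t ht x).abs (Eventually.of_forall fun n => (hmem n).bound t ht x hx)
  have hfix : ∀ t ∈ Ioc 0 T, u t = Φ u t := by
    intro t ht
    have hb := hw.bound_nonneg t ht
    have key : ∀ n : ℕ, ‖u t - Φ u t‖ ≤ 4 * b t * (1 / 4) ^ n := fun n => by
      refine ((humem.antisymm t ht).sub ((hΦmem u humem).antisymm t ht)).norm_le (by positivity)
        fun x hx => ?_
      have h1 := hunx (n + 1) t ht x hx
      have h2 := hΦcontr _ _ (hmem n) humem (2 * (1 / 4) ^ n) (by positivity) (hunx n) t ht x hx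
      rw [← hsucc] at h2
      rw [ZeroAtInftyContinuousMap.sub_apply]
      have h3 := abs_sub_le (u t x) (s (n + 1) t x) (Φ u t x)
      rw [abs_sub_comm] at h1
      rw [pow_succ] at h1
      have h4 : (1 / 4 : ℝ) ^ n * w t x ≤ (1 / 4) ^ n * b t := by
        gcongr; exact hw.le t ht x hx
      have h5 : 0 ≤ (1 / 4 : ℝ) ^ n * b t := by positivity
      linarith
    have h1 : ‖u t - Φ u t‖ ≤ 0 := ge_of_tendsto' (by simpa using hpow.const_mul (4 * b t)) key
    exact sub_eq_zero.1 (norm_le_zero_iff.1 h1)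
  refine ⟨u, ⟨humem.cont, fun t ht => hw.intervalIntegrable_heatOp zero_le_two humem hq ht, hfix⟩,
    humem, fun t ht x hx => ?_⟩
  rw [hfix t ht]
  exact hΦL u humem t ht x hx

/-- Uniqueness in a weighted class. -/
theorem HeatWeight.eq_of_mildSol (hw : HeatWeight m T w b) (hK : 0 ≤ K)
    (hq : IntervalIntegrable (lipRate α K b) volume 0 T)
    (hsmall : ∫ σ in 0..T, lipRate α K b σ ≤ 1 / 2) {a : ℝ} (ha : |a| ≤ 1)
    {L : ℝ → C₀(Eucl N, ℝ)} (hu : WeightedCurve m T w K u) (hv : WeightedCurve m T w K v)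
    (hu' : MildSol hα a L (Ioc 0 T) u) (hv' : MildSol hα a L (Ioc 0 T) v) :
    ∀ t ∈ Ioc 0 T, u t = v t := by
  have key : ∀ n : ℕ, ∀ t ∈ Ioc 0 T, ∀ x ∈ sector N m,
      |u t x - v t x| ≤ 2 * K * (1 / 2) ^ n * w t x := by
    intro n
    induction n with
    | zero =>
      intro t ht x hx
      have h1 := hu.bound t ht x hx
      have h2 := hv.bound t ht x hx
      have h3 := abs_sub (u t x) (v t x)
      simp only [pow_zero]
      linarith
    | succ n ih =>
      intro t ht x hx
      have h0 := hw.nonneg t ht x hx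
      have h1 := hw.abs_duhamel_sub_le (hα := hα) hK hu hv hq (by positivity) ih ht hx
      have h2 : u t x - v t x = a * (duhamel hα u t x - duhamel hα v t x) := by
        rw [hu'.eqn t ht, hv'.eqn t ht]; simp; ring
      rw [h2, abs_mul]
      have h3 := mul_le_mul_of_nonneg_right
        ((hw.integral_lipRate_le hα hK hq ht).trans hsmall)
        (by positivity : 0 ≤ 2 * K * (1 / 2) ^ n * w t x)
      have h4 := mul_le_mul_of_nonneg_right ha (abs_nonneg (duhamel hα u t x - duhamel hα v t x))
      rw [pow_succ]
      linarith
  intro t ht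
  have hb := hw.bound_nonneg t ht
  have hpow : Tendsto (fun n : ℕ => 2 * K * b t * (1 / 2 : ℝ) ^ n) atTop (𝓝 0) := by
    simpa using (tendsto_pow_atTop_nhds_zero_of_lt_one (r := (1 / 2 : ℝ)) (by norm_num)
      (by norm_num)).const_mul (2 * K * b t)
  have h1 : ‖u t - v t‖ ≤ 0 := ge_of_tendsto' hpow fun n => by
    refine ((hu.antisymm t ht).sub (hv.antisymm t ht)).norm_le (by positivity)
      fun x hx => (key n t ht x hx).trans ?_
    have h4 : 2 * K * (1 / 2 : ℝ) ^ n * w t x ≤ 2 * K * (1 / 2) ^ n * b t := by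
      gcongr; exact hw.le t ht x hx
    linarith
  exact sub_eq_zero.1 (norm_le_zero_iff.1 h1)

end Picard

/-! ### Continuation of mild solutions -/

/-- Grönwall's inequality in integral form. -/
theorem le_mul_exp_of_le_add_integral {g : ℝ → ℝ} {a b A Λ : ℝ} (hA : 0 ≤ A) (hΛ : 0 ≤ Λ)
    (hg : ContinuousOn g (Icc a b)) (hg0 : ∀ t ∈ Icc a b, 0 ≤ g t)
    (h : ∀ t ∈ Icc a b, g t ≤ A + Λ * ∫ s in a..t, g s) {t : ℝ} (ht : t ∈ Icc a b) :
    g t ≤ A * Real.exp (Λ * (t - a)) := by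
  have hab : a ≤ b := ht.1.trans ht.2
  set k : ℝ → ℝ := IccExtend hab ((Icc a b).domRestrict g) with hk
  have hkc : Continuous k := (continuousOn_iff_continuous_domRestrict.1 hg).Icc_extend'
  have hkg : ∀ s ∈ Icc a b, k s = g s := fun s hs => by
    rw [hk, IccExtend_of_mem hab _ hs]; rfl
  have hk0 : ∀ s, 0 ≤ k s := fun s => hg0 _ (projIcc a b hab s).2
  have hint : ∀ t ∈ Icc a b, ∫ s in a..t, g s = ∫ s in a..t, k s := fun t ht => by
    refine intervalIntegral.integral_congr fun s hs => ?_
    rw [uIcc_of_le ht.1] at hs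
    exact (hkg s ⟨hs.1, hs.2.trans ht.2⟩).symm
  set G : ℝ → ℝ := fun t => A + Λ * ∫ s in a..t, k s with hG
  have hGd : ∀ t, HasDerivAt G (Λ * k t) t := fun t =>
    ((intervalIntegral.integral_hasDerivAt_right (hkc.intervalIntegrable _ _)
      (hkc.stronglyMeasurableAtFilter _ _) hkc.continuousAt).const_mul Λ).const_add A
  have hG0 : ∀ t ∈ Icc a b, 0 ≤ G t := fun t ht => by
    have := intervalIntegral.integral_nonneg (μ := volume) ht.1 fun s _ => hk0 s
    simp only [hG]; positivity
  have hle : ∀ t ∈ Icc a b, k t ≤ G t := fun t ht => by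
    rw [hkg t ht]
    refine (h t ht).trans_eq ?_
    rw [hint t ht]
  have := norm_le_gronwallBound_of_norm_deriv_right_le (f := G) (δ := A) (K := Λ) (ε := 0)
    (a := a) (b := b) (fun s _ => (hGd s).continuousAt.continuousWithinAt)
    (fun s _ => (hGd s).hasDerivWithinAt) (by simp [hG, abs_of_nonneg hA])
    (fun s hs => by
      have hs' : s ∈ Icc a b := ⟨hs.1, hs.2.le⟩
      rw [norm_mul, Real.norm_of_nonneg hΛ, Real.norm_of_nonneg (hk0 s),
        Real.norm_of_nonneg (hG0 s hs'), add_zero]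
      exact mul_le_mul_of_nonneg_left (hle s hs') hΛ) t ht
  rw [gronwallBound_ε0] at this
  rw [← hkg t ht]
  exact (hle t ht).trans ((le_abs_self _).trans this)

section Continuation

variable {N m : ℕ} {α : ℝ} {hα : 0 < α} {a T : ℝ} {L u v : ℝ → C₀(Eucl N, ℝ)}

theorem c0_smul_add (a : ℝ) (f g : C₀(Eucl N, ℝ)) : a • (f + g) = a • f + a • g :=
  smul_add a f g

theorem c0_smul_sub (a : ℝ) (f g : C₀(Eucl N, ℝ)) : a • (f - g) = a • f - a • g :=
  smul_sub a f g

theorem MildSol.mono {J J' : Set ℝ} (hu : MildSol hα a L J u) (h : J' ⊆ J) :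
    MildSol hα a L J' u :=
  ⟨hu.cont.mono h, fun t ht => hu.integrable t (h ht), fun t ht => hu.eqn t (h ht)⟩

theorem duhamel_congr {t : ℝ} (ht : 0 ≤ t) (h : ∀ s ∈ Ioc 0 t, u s = v s) :
    duhamel hα u t = duhamel hα v t := by
  refine intervalIntegral.integral_congr_ae (Eventually.of_forall fun s hs => ?_)
  rw [uIoc_of_le ht] at hs
  rw [h s hs]

theorem MildSol.congr (hu : MildSol hα a L (Ioc 0 T) u) (h : ∀ t ∈ Ioc 0 T, v t = u t) :
    MildSol hα a L (Ioc 0 T) v where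
  cont := hu.cont.congr h
  integrable := fun t ht => (hu.integrable t ht).congr (fun s hs => by
    rw [uIoc_of_le ht.1.le] at hs
    simp only [h s ⟨hs.1, hs.2.trans ht.2⟩])
  eqn := fun t ht => by
    rw [h t ht, hu.eqn t ht, duhamel_congr ht.1.le fun s hs => h s ⟨hs.1, hs.2.trans ht.2⟩]

theorem heatOp_heatOp_sub {s t r : ℝ} (h1 : s ≤ r) (h2 : r ≤ t) (f : C₀(Eucl N, ℝ)) :
    heatOp (t - r) (heatOp (r - s) f) = heatOp (t - s) f := by
  rw [heatOp_heatOp (by linarith) (by linarith)]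
  congr 2
  ring

theorem MildSol.intervalIntegrable_heatOp (hu : MildSol hα a L (Ioc 0 T) u) {t₀ : ℝ}
    (ht₀ : t₀ ∈ Ioc 0 T) {t : ℝ} (ht : t₀ ≤ t) :
    IntervalIntegrable (fun σ => heatOp (t - σ) (nonlinOp hα (u σ))) volume 0 t₀ := by
  have h1 := hu.integrable t₀ ht₀
  rw [intervalIntegrable_iff_integrableOn_Ioc_of_le ht₀.1.le] at h1 ⊢
  refine ((heatOp (t - t₀)).integrable_comp h1).congr ?_
  filter_upwards [ae_restrict_mem measurableSet_Ioc] with σ hσ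
  exact heatOp_heatOp_sub hσ.2 ht _

theorem heatOp_duhamel (hu : MildSol hα a L (Ioc 0 T) u) {t₀ : ℝ} (ht₀ : t₀ ∈ Ioc 0 T) {t : ℝ}
    (ht : t₀ ≤ t) :
    heatOp (t - t₀) (duhamel hα u t₀) = ∫ σ in 0..t₀, heatOp (t - σ) (nonlinOp hα (u σ)) := by
  rw [duhamel, ← (heatOp (t - t₀)).intervalIntegral_comp_comm (hu.integrable t₀ ht₀)]
  refine intervalIntegral.integral_congr_ae (Eventually.of_forall fun σ hσ => ?_)
  rw [uIoc_of_le ht₀.1.le] at hσ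
  exact heatOp_heatOp_sub hσ.2 ht _

theorem MildSol.continuousOn_heatOp (hu : MildSol hα a L (Ioc 0 T) u) (t : ℝ) :
    ContinuousOn (fun σ => heatOp (t - σ) (nonlinOp hα (u σ))) (Ioc 0 T) :=
  continuousOn_heatOp_sub ((continuous_nonlinOp hα).comp_continuousOn hu.cont) t

theorem MildSol.intervalIntegrable_of_mem (hu : MildSol hα a L (Ioc 0 T) u) {t₀ t : ℝ}
    (ht₀ : 0 < t₀) (ht : t₀ ≤ t) (htT : t ≤ T) (r : ℝ) :
    IntervalIntegrable (fun σ => heatOp (r - σ) (nonlinOp hα (u σ))) volume t₀ t := by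
  refine ContinuousOn.intervalIntegrable ((hu.continuousOn_heatOp r).mono ?_)
  rw [uIcc_of_le ht]
  exact fun s hs => ⟨ht₀.trans_le hs.1, hs.2.trans htT⟩

/-- Restarting a mild solution at a positive time. -/
theorem MildSol.restart (hu : MildSol hα a L (Ioc 0 T) u)
    (hL : ∀ s t, 0 ≤ s → 0 < t → heatOp s (L t) = L (s + t)) {t₀ t : ℝ} (ht₀ : 0 < t₀)
    (ht : t₀ ≤ t) (htT : t ≤ T) :
    u t = heatOp (t - t₀) (u t₀) +
      a • ∫ σ in t₀..t, heatOp (t - σ) (nonlinOp hα (u σ)) := by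
  have hm₀ : t₀ ∈ Ioc 0 T := ⟨ht₀, ht.trans htT⟩
  rw [hu.eqn t ⟨ht₀.trans_le ht, htT⟩, hu.eqn t₀ hm₀, map_add, hL _ _ (by linarith) ht₀, map_smul,
    heatOp_duhamel hu hm₀ ht, sub_add_cancel, add_assoc, ← c0_smul_add,
    intervalIntegral.integral_add_adjacent_intervals (hu.intervalIntegrable_heatOp hm₀ ht)
      (hu.intervalIntegrable_of_mem ht₀ ht htT t), duhamel]

theorem MildSol.exists_norm_le (hu : MildSol hα a L (Ioc 0 T) u) {τ : ℝ} (hτ : 0 < τ) :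
    ∃ R, 0 ≤ R ∧ ∀ t ∈ Icc τ T, ‖u t‖ ≤ R := by
  obtain ⟨R, hR⟩ := isCompact_Icc.exists_bound_of_continuousOn
    (hu.cont.mono fun t (ht : t ∈ Icc τ T) => ⟨hτ.trans_le ht.1, ht.2⟩)
  exact ⟨max R 0, le_max_right _ _, fun t ht => (hR t ht).trans (le_max_left _ _)⟩

/-- Solutions agreeing for small times agree. -/
theorem MildSol.eq_of_eq_initially (ha : |a| ≤ 1) (hu : MildSol hα a L (Ioc 0 T) u)
    (hv : MildSol hα a L (Ioc 0 T) v)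
    (hL : ∀ s t, 0 ≤ s → 0 < t → heatOp s (L t) = L (s + t)) {τ : ℝ} (hτ : 0 < τ)
    (h : ∀ t ∈ Ioc 0 T, t ≤ τ → u t = v t) : ∀ t ∈ Ioc 0 T, u t = v t := by
  intro t ht
  rcases le_or_gt t τ with h1 | h1
  · exact h t ht h1
  have hτT : τ ∈ Ioc 0 T := ⟨hτ, h1.le.trans ht.2⟩
  obtain ⟨R₁, hR₁, hu₁⟩ := hu.exists_norm_le hτ
  obtain ⟨R₂, hR₂, hv₁⟩ := hv.exists_norm_le hτ
  set Λ := (α + 1) * (max R₁ R₂) ^ α with hΛ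
  have hΛ0 : 0 ≤ Λ := by positivity
  have hsub : Icc τ T ⊆ Ioc 0 T := fun s hs => ⟨hτ.trans_le hs.1, hs.2⟩
  have hcont : ContinuousOn (fun s => ‖u s - v s‖) (Icc τ T) :=
    ((hu.cont.mono hsub).sub (hv.cont.mono hsub)).norm
  have key := le_mul_exp_of_le_add_integral (g := fun s => ‖u s - v s‖) (A := 0) le_rfl hΛ0 hcont
    (fun _ _ => norm_nonneg _) (fun t ht => ?_) (t := t) ⟨h1.le, ht.2⟩
  · rw [zero_mul] at key
    exact sub_eq_zero.1 (norm_le_zero_iff.1 key)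
  · have hi1 := hu.intervalIntegrable_of_mem hτ ht.1 ht.2 t
    have hi2 := hv.intervalIntegrable_of_mem hτ ht.1 ht.2 t
    have e : u t - v t =
        a • ∫ σ in τ..t, heatOp (t - σ) (nonlinOp hα (u σ) - nonlinOp hα (v σ)) := by
      rw [hu.restart hL hτ ht.1 ht.2, hv.restart hL hτ ht.1 ht.2, h τ hτT le_rfl,
        add_sub_add_left_eq_sub, ← c0_smul_sub, ← intervalIntegral.integral_sub hi1 hi2]
      simp_rw [map_sub]
    rw [e, norm_smul, zero_add, ← intervalIntegral.integral_const_mul]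
    refine (mul_le_of_le_one_left (norm_nonneg _) ha).trans ?_
    refine intervalIntegral.norm_integral_le_of_norm_le ht.1
      (Eventually.of_forall fun σ hσ => ?_) ?_
    · have hσ' : σ ∈ Icc τ T := ⟨hσ.1.le, hσ.2.trans ht.2⟩
      exact (norm_heatOp_le _ _).trans (norm_nonlinOp_sub_le hα
        ((hu₁ σ hσ').trans (le_max_left _ _)) ((hv₁ σ hσ').trans (le_max_right _ _)))
    · refine ContinuousOn.intervalIntegrable ?_
      rw [uIcc_of_le ht.1]
      exact (hcont.mono (Icc_subset_Icc_right ht.2)).const_smul Λ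

/-- Concatenation of mild solutions. -/
theorem MildSol.concat (hu : MildSol hα a L (Ioc 0 T) u) (hT : 0 < T)
    (hL : ∀ s t, 0 ≤ s → 0 < t → heatOp s (L t) = L (s + t)) {δ : ℝ}
    (hv : MildSol hα a (fun t => heatOp t (u T)) (Ioc 0 δ) v)
    (hv0 : Tendsto v (𝓝[>] 0) (𝓝 (u T))) :
    MildSol hα a L (Ioc 0 (T + δ)) fun t => if t ≤ T then u t else v (t - T) := by
  set z : ℝ → C₀(Eucl N, ℝ) := fun t => if t ≤ T then u t else v (t - T) with hz
  have hzu : ∀ t, t ≤ T → z t = u t := fun t ht => if_pos ht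
  have hzv : ∀ t, T < t → z t = v (t - T) := fun t ht => if_neg (not_le.2 ht)
  have hTm : T ∈ Ioc 0 T := ⟨hT, le_rfl⟩
  have hi1 : ∀ t, T ≤ t →
      IntervalIntegrable (fun σ => heatOp (t - σ) (nonlinOp hα (z σ))) volume 0 T := fun t ht =>
    (hu.intervalIntegrable_heatOp hTm ht).congr fun s hs => by
      rw [uIoc_of_le hT.le] at hs
      simp only [hzu s hs.2]
  have hshift : ∀ t, T < t → ∀ σ ∈ Ioc T t, heatOp (t - T - (σ - T)) (nonlinOp hα (v (σ - T))) =
      heatOp (t - σ) (nonlinOp hα (z σ)) := fun t _ σ hσ => by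
    rw [hzv σ hσ.1, sub_sub_sub_cancel_right]
  have hi2 : ∀ t, T < t → t ≤ T + δ →
      IntervalIntegrable (fun σ => heatOp (t - σ) (nonlinOp hα (z σ))) volume T t := by
    intro t ht htδ
    have h1 := (hv.integrable (t - T) ⟨by linarith, by linarith⟩).comp_sub_right T
    rw [zero_add, sub_add_cancel] at h1
    exact h1.congr fun σ hσ => hshift t ht σ (by rwa [uIoc_of_le ht.le] at hσ)
  refine ⟨?_, ?_, ?_⟩
  · intro t ht
    rcases lt_trichotomy t T with h | rfl | h
    · have h1 : ContinuousWithinAt u (Ioc 0 T) t := hu.cont t ⟨ht.1, h.le⟩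
      have h2 : ContinuousAt u t := h1.continuousAt (Ioc_mem_nhds ht.1 h)
      refine (h2.congr ?_).continuousWithinAt
      filter_upwards [gt_mem_nhds h] with s hs
      exact (hzu s hs.le).symm
    · have hl : ContinuousWithinAt z (Ioc 0 t) t :=
        (hu.cont t hTm).congr (fun s hs => hzu s hs.2) (hzu t le_rfl)
      have hr : ContinuousWithinAt z (Ioi t) t := by
        rw [ContinuousWithinAt, hzu t le_rfl]
        have h1 : Tendsto (fun s => s - t) (𝓝[>] t) (𝓝[>] 0) := by
          refine tendsto_nhdsWithin_iff.2 ⟨?_, ?_⟩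
          · have : Tendsto (fun s => s - t) (𝓝 t) (𝓝 (t - t)) := tendsto_id.sub_const t
            rw [sub_self] at this
            exact this.mono_left nhdsWithin_le_nhds
          · filter_upwards [self_mem_nhdsWithin] with s hs
            exact sub_pos.2 (mem_Ioi.1 hs)
        refine (hv0.comp h1).congr' ?_
        filter_upwards [self_mem_nhdsWithin] with s hs
        exact (hzv s hs).symm
      refine (hl.union hr).mono fun s hs => ?_
      rcases le_or_gt s t with h | h
      · exact Or.inl ⟨hs.1, h⟩
      · exact Or.inr h
    · have h1 : ContinuousWithinAt (fun s => v (s - T)) (Ioc T (T + δ)) t := by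
        have h2 : ContinuousWithinAt v (Ioc 0 δ) (t - T) :=
          hv.cont (t - T) ⟨by linarith, by linarith [ht.2]⟩
        refine ContinuousWithinAt.comp (g := v) (f := fun s => s - T) h2
          (continuous_id.sub continuous_const).continuousWithinAt fun s hs => ?_
        exact ⟨sub_pos.2 hs.1, by linarith [hs.2]⟩
      have h2 : ContinuousWithinAt z (Ioc T (T + δ)) t :=
        h1.congr (fun s hs => hzv s hs.1) (hzv t h)
      refine h2.mono_of_mem_nhdsWithin ?_
      filter_upwards [self_mem_nhdsWithin, mem_nhdsWithin_of_mem_nhds (lt_mem_nhds h)] with s hs hs2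
      exact ⟨hs2, hs.2⟩
  · intro t ht
    rcases le_or_gt t T with h | h
    · refine (hu.integrable t ⟨ht.1, h⟩).congr fun s hs => ?_
      rw [uIoc_of_le ht.1.le] at hs
      simp only [hzu s (hs.2.trans h)]
    · exact (hi1 t h.le).trans (hi2 t h ht.2)
  · intro t ht
    rcases le_or_gt t T with h | h
    · rw [hzu t h, hu.eqn t ⟨ht.1, h⟩]
      rw [duhamel_congr ht.1.le fun s hs => hzu s (hs.2.trans h)]
    · have e1 : (∫ σ in 0..T, heatOp (t - σ) (nonlinOp hα (z σ))) =
          heatOp (t - T) (duhamel hα u T) := by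
        rw [heatOp_duhamel hu hTm h.le]
        refine intervalIntegral.integral_congr_ae (Eventually.of_forall fun σ hσ => ?_)
        rw [uIoc_of_le hT.le] at hσ
        rw [hzu σ hσ.2]
      have e2 : (∫ σ in T..t, heatOp (t - σ) (nonlinOp hα (z σ))) = duhamel hα v (t - T) := by
        have := intervalIntegral.integral_comp_sub_right (a := T) (b := t)
          (fun σ => heatOp (t - T - σ) (nonlinOp hα (v σ))) T
        rw [sub_self] at this
        rw [duhamel, ← this]
        refine intervalIntegral.integral_congr_ae (Eventually.of_forall fun σ hσ => ?_)
        rw [uIoc_of_le h.le] at hσ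
        exact (hshift t h σ hσ).symm
      rw [hzv t h, hv.eqn (t - T) ⟨by linarith, by linarith [ht.2]⟩, duhamel.eq_1 hα z,
        ← intervalIntegral.integral_add_adjacent_intervals (hi1 t h.le) (hi2 t h ht.2), e1, e2,
        hu.eqn T hTm, map_add, map_smul, hL _ _ (by linarith) hT, sub_add_cancel, c0_smul_add,
        add_assoc]

theorem heatWeight_const (m : ℕ) (T : ℝ) {R : ℝ} (hR : 0 ≤ R) :
    HeatWeight (N := N) m T (fun _ _ => R) fun _ => R where
  nonneg := fun _ _ _ _ => hR
  le := fun _ _ _ _ => le_rfl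
  bound_nonneg := fun _ _ => hR
  cont := continuousOn_const
  heat_le := fun σ t _ _ _ f hf r hr h x _ => (abs_apply_le_norm _ x).trans
    ((norm_heatOp_le _ _).trans (hf.norm_le (by positivity) h))

/-- Local existence for data in `C₀`, on an interval depending only on the size of the data. -/
theorem exists_local_mildSol (hα : 0 < α) {R : ℝ} (hR : 0 ≤ R) : ∃ δ > 0, ∀ a : ℝ, |a| ≤ 1 →
    ∀ f : C₀(Eucl N, ℝ), AntisymmIn m f → ‖f‖ ≤ R → ∃ v,
      MildSol hα a (fun t => heatOp t f) (Ioc 0 δ) v ∧ (∀ t ∈ Ioc 0 δ, AntisymmIn m (v t)) ∧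
      Tendsto v (𝓝[>] 0) (𝓝 f) := by
  set q := (α + 1) * (2 * R) ^ α with hq
  have hq0 : 0 ≤ q := by positivity
  set δ : ℝ := 1 / (4 * (q + 1)) with hδ
  have hδ0 : 0 < δ := by positivity
  refine ⟨δ, hδ0, fun a ha f hf hfR => ?_⟩
  have hw := heatWeight_const (N := N) m δ hR
  have hqi : IntervalIntegrable (lipRate α 2 fun _ => R) volume 0 δ := intervalIntegrable_const
  have hqint : ∀ t, ∫ σ in 0..t, lipRate α 2 (fun _ => R) σ = t * q := fun t => by
    simp [lipRate, hq]
    ring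
  have hL : WeightedCurve m δ (fun _ _ => R) 1 fun t => heatOp t f :=
    ⟨(continuous_heatOp f).continuousOn, fun t _ => heatOp_antisymmIn hf t, fun t _ x _ => by
      rw [one_mul]
      exact (abs_apply_le_norm _ x).trans ((norm_heatOp_le t f).trans hfR)⟩
  obtain ⟨v, hv, hv2, -⟩ := hw.exists_mildSol hα hqi (by
    rw [hqint, hδ, div_mul_eq_mul_div, div_le_div_iff₀ (by positivity) (by norm_num)]
    linarith) ha hL
  refine ⟨v, hv, hv2.antisymm, ?_⟩
  have h1 : Tendsto (fun t => heatOp t f) (𝓝[>] 0) (𝓝 f) := by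
    have := (continuous_heatOp f).tendsto 0
    rw [heatOp_of_nonpos le_rfl] at this
    exact this.mono_left nhdsWithin_le_nhds
  have h2 : Tendsto (fun t => v t - heatOp t f) (𝓝[>] 0) (𝓝 0) := by
    have h3 : Tendsto (fun t : ℝ => t * (q * 2 * R)) (𝓝[>] 0) (𝓝 0) := by
      have : Tendsto (fun t : ℝ => t * (q * 2 * R)) (𝓝 0) (𝓝 (0 * (q * 2 * R))) :=
        tendsto_id.mul_const _
      rw [zero_mul] at this
      exact this.mono_left nhdsWithin_le_nhds
    refine squeeze_zero_norm' ?_ h3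
    filter_upwards [Ioc_mem_nhdsGT hδ0] with t ht
    rw [hv.eqn t ht, add_sub_cancel_left, norm_smul]
    refine (mul_le_of_le_one_left (norm_nonneg _) ha).trans ?_
    have ht0 := ht.1
    refine (hw.duhamel_antisymmIn zero_le_two hv2 hqi ht).norm_le (by positivity) fun x hx => ?_
    have := hw.abs_duhamel_le (hα := hα) zero_le_two hv2 hqi ht hx
    rw [hqint] at this
    linarith
  simpa using h2.add h1

/-- In the absorbing case the sup norm does not increase. -/
theorem MildSol.norm_le_of_absorption (hu : MildSol hα (-1) L (Ioc 0 T) u)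
    (hL : ∀ s t, 0 ≤ s → 0 < t → heatOp s (L t) = L (s + t)) {t₀ t : ℝ} (ht₀ : 0 < t₀)
    (ht : t₀ ≤ t) (htT : t ≤ T) : ‖u t‖ ≤ ‖u t₀‖ := by
  obtain ⟨R, hR, hRu⟩ := hu.exists_norm_le ht₀
  set lam := R ^ α with hlam
  have hlam0 : 0 ≤ lam := by positivity
  have hnl : ∀ s ∈ Icc t₀ T, ‖lam • u s - nonlinOp hα (u s)‖ ≤ lam * ‖u s‖ := fun s hs => by
    refine norm_le_of_abs_apply_le (by positivity) fun x => ?_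
    have h1 : |u s x| ^ α ≤ lam := Real.rpow_le_rpow (abs_nonneg _)
      ((abs_apply_le_norm _ x).trans (hRu s hs)) hα.le
    have h2 : 0 ≤ |u s x| ^ α := by positivity
    have h3 : (lam • u s - nonlinOp hα (u s)) x = (lam - |u s x| ^ α) * u s x := by
      rw [ZeroAtInftyContinuousMap.sub_apply, ZeroAtInftyContinuousMap.smul_apply, nonlinOp_apply,
        smul_eq_mul]
      ring
    rw [h3, abs_mul, abs_of_nonneg (by linarith)]
    refine mul_le_mul (by linarith) (abs_apply_le_norm _ x) (abs_nonneg _) hlam0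
  have hsub : Icc t₀ T ⊆ Ioc 0 T := fun s hs => ⟨ht₀.trans_le hs.1, hs.2⟩
  have hcont : ContinuousOn (fun s => Real.exp (lam * s) * ‖u s‖) (Icc t₀ T) :=
    (by fun_prop : Continuous fun s : ℝ => Real.exp (lam * s)).continuousOn.mul
      (hu.cont.mono hsub).norm
  have key := le_mul_exp_of_le_add_integral (g := fun s => Real.exp (lam * s) * ‖u s‖)
    (A := Real.exp (lam * t₀) * ‖u t₀‖) (by positivity) hlam0 hcont
    (fun _ _ => by positivity) (fun t ht => ?_) (t := t) ⟨ht, htT⟩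
  · have e : Real.exp (lam * t₀) * ‖u t₀‖ * Real.exp (lam * (t - t₀)) =
        Real.exp (lam * t) * ‖u t₀‖ := by
      rw [mul_right_comm, ← Real.exp_add]; congr 2; ring
    rw [e] at key
    exact le_of_mul_le_mul_left key (Real.exp_pos _)
  · set h : ℝ → C₀(Eucl N, ℝ) := fun σ => heatOp (t - σ) (nonlinOp hα (u σ)) with hh
    have hhc : ContinuousOn h (Icc t₀ t) :=
      (hu.continuousOn_heatOp t).mono fun s hs => hsub ⟨hs.1, hs.2.trans ht.2⟩
    set P : ℝ → C₀(Eucl N, ℝ) := fun s =>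
      heatOp (t - t₀) (u t₀) + (-1 : ℝ) • ∫ σ in t₀..s, h σ with hP
    have hPu : ∀ s ∈ Icc t₀ t, P s = heatOp (t - s) (u s) := fun s hs => by
      have hi := hu.intervalIntegrable_of_mem ht₀ hs.1 (hs.2.trans ht.2) s
      rw [hu.restart hL ht₀ hs.1 (hs.2.trans ht.2), map_add, map_smul,
        heatOp_heatOp_sub hs.1 hs.2, ← (heatOp (t - s)).intervalIntegral_comp_comm hi]
      simp only [hP]
      congr 2
      refine intervalIntegral.integral_congr_ae (Eventually.of_forall fun σ hσ => ?_)
      rw [uIoc_of_le hs.1] at hσ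
      exact (heatOp_heatOp_sub hσ.2 hs.2 _).symm
    have hhi : IntervalIntegrable h volume t₀ t :=
      hu.intervalIntegrable_of_mem ht₀ ht.1 ht.2 t
    have hPd : ∀ s ∈ Ioo t₀ t, HasDerivAt P ((-1 : ℝ) • h s) s := fun s hs => by
      suffices H : HasDerivAt (fun r => ∫ σ in t₀..r, h σ) (h s) s from
        (H.const_smul (-1 : ℝ)).const_add (heatOp (t - t₀) (u t₀))
      refine intervalIntegral.integral_hasDerivAt_right
        (hhi.mono_set (by
          rw [uIcc_of_le hs.1.le, uIcc_of_le ht.1]; exact Icc_subset_Icc_right hs.2.le))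
        ((hhc.mono Ioo_subset_Icc_self).stronglyMeasurableAtFilter isOpen_Ioo s hs)
        (hhc.continuousAt (Icc_mem_nhds hs.1 hs.2))
    have hPc : ContinuousOn P (Icc t₀ t) := by
      refine ContinuousOn.congr (f := fun s => heatOp (t - s) (u s)) ?_ hPu
      exact _root_.continuousOn_heatOp (continuousOn_const.sub continuousOn_id)
        (hu.cont.mono fun s hs => hsub ⟨hs.1, hs.2.trans ht.2⟩)
    have hexp : ∀ s, HasDerivAt (fun s => Real.exp (lam * s)) (Real.exp (lam * s) * lam) s :=
      fun s => by simpa using ((hasDerivAt_id s).const_mul lam).exp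
    set Q : ℝ → C₀(Eucl N, ℝ) := fun s => Real.exp (lam * s) • (lam • P s - h s) with hQ
    have hQc : ContinuousOn Q (Icc t₀ t) :=
      (by fun_prop : Continuous fun s : ℝ => Real.exp (lam * s)).continuousOn.smul
        ((hPc.const_smul lam).sub hhc)
    have hftc : ∫ s in t₀..t, Q s = Real.exp (lam * t) • P t - Real.exp (lam * t₀) • P t₀ := by
      refine intervalIntegral.integral_eq_sub_of_hasDeriv_right_of_le ht.1
        (f := fun s => Real.exp (lam * s) • P s)
        ((by fun_prop : Continuous fun s : ℝ => Real.exp (lam * s)).continuousOn.smul hPc)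
        (fun s hs => ?_) (hQc.intervalIntegrable_of_Icc ht.1)
      have := ((hexp s).smul (hPd s hs)).hasDerivWithinAt (s := Ioi s)
      have e : Q s = Real.exp (lam * s) • (-1 : ℝ) • h s + (Real.exp (lam * s) * lam) • P s := by
        refine ZeroAtInftyContinuousMap.ext fun x => ?_
        change Real.exp (lam * s) * (lam * P s x - h s x) =
          Real.exp (lam * s) * (-1 * h s x) + Real.exp (lam * s) * lam * P s x
        ring
      rw [e]
      exact this
    have hPt : P t = u t := by
      rw [hPu t ⟨ht.1, le_rfl⟩, sub_self, heatOp_of_nonpos le_rfl]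
    have hPt₀ : P t₀ = heatOp (t - t₀) (u t₀) := hPu t₀ ⟨le_rfl, ht.1⟩
    have hfin : Real.exp (lam * t) • u t =
        Real.exp (lam * t₀) • heatOp (t - t₀) (u t₀) + ∫ s in t₀..t, Q s := by
      rw [hftc, hPt, hPt₀]; abel
    have hn : Real.exp (lam * t) * ‖u t‖ = ‖Real.exp (lam * t) • u t‖ := by
      rw [norm_smul, Real.norm_of_nonneg (Real.exp_pos _).le]
    rw [hn, hfin, ← intervalIntegral.integral_const_mul]
    refine (norm_add_le _ _).trans (add_le_add ?_ ?_)
    · rw [norm_smul, Real.norm_of_nonneg (Real.exp_pos _).le]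
      exact mul_le_mul_of_nonneg_left (norm_heatOp_le _ _) (Real.exp_pos _).le
    · refine intervalIntegral.norm_integral_le_of_norm_le ht.1
        (Eventually.of_forall fun s hs => ?_) ?_
      · have hs' : s ∈ Icc t₀ t := ⟨hs.1.le, hs.2⟩
        have e : Q s = Real.exp (lam * s) • heatOp (t - s) (lam • u s - nonlinOp hα (u s)) := by
          simp only [hQ, hPu s hs', hh, map_sub, map_smul]
        rw [e, norm_smul, Real.norm_of_nonneg (Real.exp_pos _).le]
        have h5 := (norm_heatOp_le (t - s) _).trans (hnl s ⟨hs.1.le, hs.2.trans ht.2⟩)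
        calc _ ≤ Real.exp (lam * s) * (lam * ‖u s‖) := by gcongr
          _ = _ := by ring
      · refine ContinuousOn.intervalIntegrable ?_
        rw [uIcc_of_le ht.1]
        exact (hcont.mono (Icc_subset_Icc_right ht.2)).const_smul lam

end Continuation

/-! ### The profile `ψ₀` -/

section Profile

variable {N m : ℕ} {γ : ℝ}

theorem contDiffAt_norm_rpow (p : ℝ) {x : Eucl N} (hx : x ≠ 0) :
    ContDiffAt ℝ ∞ (fun y : Eucl N => ‖y‖ ^ p) x :=
  (contDiffAt_norm ℝ hx).rpow_const_of_ne (norm_ne_zero_iff.2 hx)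

theorem hasDerivAt_norm_add_smul_single_rpow (p : ℝ) {x : Eucl N} (hx : x ≠ 0) (i : Fin N) :
    HasDerivAt (fun s : ℝ => ‖x + s • (EuclideanSpace.single i (1 : ℝ) : Eucl N)‖ ^ p)
      (p * x i * ‖x‖ ^ (p - 2)) 0 := by
  have h1 : ∀ s : ℝ, ‖x + s • (EuclideanSpace.single i (1 : ℝ) : Eucl N)‖ ^ p =
      (‖x‖ ^ 2 + 2 * (s * x i) + s ^ 2) ^ (p / 2) := fun s => by
    rw [← Real.sqrt_sq (norm_nonneg (x + s • (EuclideanSpace.single i (1 : ℝ) : Eucl N))),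
      Real.sqrt_eq_rpow, ← Real.rpow_mul (by positivity), norm_add_sq_real, norm_smul,
      inner_smul_right, EuclideanSpace.inner_single_right, PiLp.norm_single]
    simp
    congr 1; ring
  simp_rw [h1]
  have hx2 : ‖x‖ ^ 2 ≠ 0 := by simpa using hx
  have h2 : HasDerivAt (fun s : ℝ => ‖x‖ ^ 2 + 2 * (s * x i) + s ^ 2) (2 * x i) 0 := by
    have := ((((hasDerivAt_id (0 : ℝ)).mul_const (x i)).const_mul 2).const_add (‖x‖ ^ 2)).fun_add
      (hasDerivAt_pow 2 (0 : ℝ))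
    simp only [id_eq, one_mul, Nat.cast_ofNat, Nat.add_one_sub_one, pow_one, mul_zero,
      add_zero] at this
    exact this
  have h3 := h2.rpow_const (p := p / 2) (Or.inl (by simpa using hx))
  convert h3 using 1
  have hx0 : 0 < ‖x‖ := norm_pos_iff.2 hx
  have e : (‖x‖ ^ 2 + 2 * (0 * x i) + 0 ^ 2) ^ (p / 2 - 1) = ‖x‖ ^ (p - 2) := by
    rw [zero_mul, mul_zero, add_zero, zero_pow two_ne_zero, add_zero, ← Real.rpow_natCast,
      ← Real.rpow_mul hx0.le]
    congr 1; push_cast; ring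
  rw [e]; ring

theorem iteratedFDeriv_norm_rpow_single (γ : ℝ) {k : ℕ} (v : Fin k → Fin N)
    (hv : Function.Injective v) {x : Eucl N} (hx : x ≠ 0) :
    iteratedFDeriv ℝ k (fun y : Eucl N => ‖y‖ ^ (-γ)) x
      (fun i => EuclideanSpace.single (v i) (1 : ℝ)) =
      (∏ j ∈ Finset.range k, -(γ + 2 * j)) * (∏ i, x (v i)) * ‖x‖ ^ (-γ - 2 * k) := by
  induction k generalizing x with
  | zero => simp
  | succ k ih =>
    have hd : DifferentiableAt ℝ (iteratedFDeriv ℝ k (fun y : Eucl N => ‖y‖ ^ (-γ))) x :=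
      (contDiffAt_norm_rpow (-γ) hx).differentiableAt_iteratedFDeriv
        (by exact_mod_cast WithTop.coe_lt_top _)
    set e : Eucl N := EuclideanSpace.single (v 0) (1 : ℝ) with he
    set tl : Fin k → Eucl N := fun i => EuclideanSpace.single (v i.succ) (1 : ℝ) with htl
    have h1 : HasDerivAt (fun s : ℝ =>
        iteratedFDeriv ℝ k (fun y : Eucl N => ‖y‖ ^ (-γ)) (x + s • e) tl)
        (iteratedFDeriv ℝ (k + 1) (fun y : Eucl N => ‖y‖ ^ (-γ)) x
          (fun i => EuclideanSpace.single (v i) (1 : ℝ))) 0 := by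
      have hl : HasDerivAt (fun s : ℝ =>
          iteratedFDeriv ℝ k (fun y : Eucl N => ‖y‖ ^ (-γ)) (x + s • e)) _ 0 :=
        hd.hasFDerivAt.hasLineDerivAt e
      exact ((ContinuousMultilinearMap.apply ℝ (fun _ : Fin k => Eucl N) ℝ
        tl).hasFDerivAt).comp_hasDerivAt 0 hl
    have hne : ∀ᶠ s : ℝ in 𝓝 0, x + s • e ≠ 0 := by
      have hc : ContinuousAt (fun s : ℝ => x + s • e) 0 := by fun_prop
      exact hc.eventually_ne (by simpa using hx)
    have h2 : HasDerivAt (fun s : ℝ =>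
        iteratedFDeriv ℝ k (fun y : Eucl N => ‖y‖ ^ (-γ)) (x + s • e) tl)
        ((∏ j ∈ Finset.range k, -(γ + 2 * j)) * (∏ i : Fin k, x (v i.succ)) *
          ((-γ - 2 * k) * x (v 0) * ‖x‖ ^ (-γ - 2 * k - 2))) 0 := by
      refine ((hasDerivAt_norm_add_smul_single_rpow (-γ - 2 * k) hx (v 0)).const_mul
        ((∏ j ∈ Finset.range k, -(γ + 2 * j)) * ∏ i : Fin k, x (v i.succ))).congr_of_eventuallyEq ?_
      filter_upwards [hne] with s hs
      rw [htl, ih (fun i => v i.succ) (fun i j h => Fin.succ_injective _ (hv h)) hs]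
      congr 2
      refine Finset.prod_congr rfl fun i _ => ?_
      have : v i.succ ≠ v 0 := fun h => Fin.succ_ne_zero i (hv h)
      simp [he, this]
    rw [h1.unique h2, Finset.prod_range_succ, Fin.prod_univ_succ]
    have e2 : -γ - 2 * (k : ℝ) - 2 = -γ - 2 * ((k + 1 : ℕ) : ℝ) := by push_cast; ring
    rw [e2]
    ring

theorem psiZero_eq (hm : m ≤ N) (γ : ℝ) {x : Eucl N} (hx : x ≠ 0) : psiZero hm γ x =
    (∏ j ∈ Finset.range m, (γ + 2 * j)) * (∏ i ∈ headCoords N m, x i) * ‖x‖ ^ (-γ - 2 * m) := by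
  rw [psiZero, iteratedFDeriv_norm_rpow_single γ (Fin.castLE hm) (Fin.castLE_injective hm) hx,
    Finset.prod_neg, Finset.card_range]
  have h1 : ∏ i ∈ headCoords N m, x i = ∏ i : Fin m, x (Fin.castLE hm i) := by
    have : headCoords N m = Finset.univ.map (Fin.castLEEmb hm) := by
      ext i
      simp only [mem_headCoords, Finset.mem_map, Finset.mem_univ, true_and]
      constructor
      · intro h
        exact ⟨⟨i, h⟩, by ext; simp⟩
      · rintro ⟨j, rfl⟩
        simp
    rw [this, Finset.prod_map]
    simp
  rw [h1, ← mul_assoc, ← mul_assoc, ← mul_assoc, ← mul_pow]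
  simp

theorem psiZero_nonneg (hm1 : 1 ≤ m) (hm : m ≤ N) (hγ : 0 < γ) {x : Eucl N}
    (hx : x ∈ sector N m) : 0 ≤ psiZero hm γ x := by
  rw [psiZero_eq hm γ (sector_ne_zero hm1 hm hx)]
  have h1 : 0 ≤ ∏ i ∈ headCoords N m, x i :=
    Finset.prod_nonneg fun i hi => (hx i (mem_headCoords.1 hi)).le
  positivity

theorem singularData_psiZero (hm1 : 1 ≤ m) (hm : m ≤ N) (hγ : 0 < γ) (hγN : γ < N) :
    SingularData m (γ + m) (∏ j ∈ Finset.range m, (γ + 2 * j)) (psiZero hm γ) where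
  one_le := hm1
  le_dim := hm
  kappa_pos := by positivity
  kappa_lt := by linarith
  nonneg := by positivity
  meas := by
    have h1 : Measurable fun x : Eucl N => (∏ j ∈ Finset.range m, (γ + 2 * (j : ℝ))) *
        (∏ i ∈ headCoords N m, x i) * ‖x‖ ^ (-γ - 2 * (m : ℝ)) := by
      refine Measurable.mul (Measurable.const_mul ?_ _) (measurable_norm.pow_const _)
      exact (continuous_finsetProd _ fun i _ => by fun_prop).measurable
    refine h1.aestronglyMeasurable.congr ?_
    filter_upwards [ae_restrict_mem measurableSet_sector] with x hx
    exact (psiZero_eq hm γ (sector_ne_zero hm1 hm hx)).symm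
  le := by
    filter_upwards [ae_restrict_mem measurableSet_sector] with x hx
    have hx0 := sector_ne_zero hm1 hm hx
    have hxp : 0 < ‖x‖ := norm_pos_iff.2 hx0
    rw [abs_of_nonneg (psiZero_nonneg hm1 hm hγ hx), psiZero_eq hm γ hx0, mul_assoc]
    refine mul_le_mul_of_nonneg_left ?_ (by positivity)
    have h2 : ∏ i ∈ headCoords N m, x i ≤ ‖x‖ ^ m := by
      refine (Finset.prod_le_prod (fun i hi => (hx i (mem_headCoords.1 hi)).le)
        fun i _ => le_abs_self _).trans (prod_abs_headCoords_le hm x)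
    refine (mul_le_mul_of_nonneg_right h2 (by positivity)).trans_eq ?_
    rw [← Real.rpow_natCast, ← Real.rpow_add hxp]
    congr 1; ring

theorem bigPsi_eq_evol (hm1 : 1 ≤ m) (hm : m ≤ N) (hγ : 0 < γ) (hγN : γ < N) {t : ℝ} (ht : 0 < t)
    (x : Eucl N) : bigPsi hm γ t x = evol m (psiZero hm γ) t x :=
  ((singularData_psiZero hm1 hm hγ hγN).evol_apply ht x).symm

end Profile

/-! ### Anti-symmetrization -/

/-- Anti-symmetrization in the coordinates in `I`. -/
noncomputable def oddPart {N : ℕ} {V : Type*} [AddCommGroup V] [Module ℝ V] (I : Finset (Fin N))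
    (f : Eucl N → V) (x : Eucl N) : V :=
  ∑ S ∈ I.powerset, (-1 : ℝ) ^ S.card • f (signFlip S x)

section OddPart

variable {N m : ℕ} {V : Type*} [NormedAddCommGroup V] [NormedSpace ℝ V]

theorem oddPart_insert {I : Finset (Fin N)} {i : Fin N} (hi : i ∉ I) (f : Eucl N → V)
    (x : Eucl N) : oddPart (insert i I) f x = oddPart I f x - oddPart I f (reflectCoord i x) := by
  simp only [oddPart]
  rw [Finset.sum_powerset_insert hi, sub_eq_add_neg, ← Finset.sum_neg_distrib]
  congr 1
  refine Finset.sum_congr rfl fun S hS => ?_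
  have hiS : i ∉ S := fun h => hi (Finset.mem_powerset.1 hS h)
  rw [Finset.card_insert_of_notMem hiS, signFlip_insert hiS, pow_succ, mul_neg_one, neg_smul]

theorem norm_oddPart_le_sum (I : Finset (Fin N)) (f : Eucl N → V) (x : Eucl N) :
    ‖oddPart I f x‖ ≤ ∑ S ∈ I.powerset, ‖f (signFlip S x)‖ := by
  refine (norm_sum_le _ _).trans_eq (Finset.sum_congr rfl fun S _ => ?_)
  rw [norm_smul]
  simp

theorem norm_oddPart_le_of_forall {I : Finset (Fin N)} {f : Eucl N → V} {x : Eucl N} {C : ℝ}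
    (h : ∀ S, ‖f (signFlip S x)‖ ≤ C) : ‖oddPart I f x‖ ≤ 2 ^ I.card * C := by
  refine (norm_oddPart_le_sum I f x).trans ((Finset.sum_le_sum fun S _ => h S).trans_eq ?_)
  simp

theorem signFlip_single_of_notMem {S : Finset (Fin N)} {i : Fin N} (hi : i ∉ S) :
    signFlip S (EuclideanSpace.single i (1 : ℝ) : Eucl N) = EuclideanSpace.single i (1 : ℝ) := by
  ext j
  rw [signFlip_apply]
  split_ifs with h
  · have : j ≠ i := fun h2 => hi (h2 ▸ h)
    simp [this]
  · rfl

theorem hasDerivAt_oddPart {I : Finset (Fin N)} {i : Fin N} (hi : i ∉ I) {f : Eucl N → V}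
    (hf : Differentiable ℝ f) (x : Eucl N) (s : ℝ) :
    HasDerivAt (fun s : ℝ => oddPart I f (x + s • (EuclideanSpace.single i (1 : ℝ) : Eucl N)))
      (oddPart I (fun y => fderiv ℝ f y (EuclideanSpace.single i (1 : ℝ)))
        (x + s • (EuclideanSpace.single i (1 : ℝ) : Eucl N))) s := by
  simp only [oddPart]
  refine HasDerivAt.fun_sum fun S hS => HasDerivAt.const_smul ((-1 : ℝ) ^ S.card) ?_
  have hiS : i ∉ S := fun h => hi (Finset.mem_powerset.1 hS h)
  have h1 : HasDerivAt
      (fun s : ℝ => signFlip S (x + s • (EuclideanSpace.single i (1 : ℝ) : Eucl N)))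
      (EuclideanSpace.single i (1 : ℝ)) s := by
    simp_rw [map_add, map_smul, signFlip_single_of_notMem hiS]
    simpa using ((hasDerivAt_id s).smul_const
      (EuclideanSpace.single i (1 : ℝ) : Eucl N)).const_add (signFlip S x)
  exact (hf _).hasFDerivAt.comp_hasDerivAt s h1

theorem norm_oddPart_le_prod (I : Finset (Fin N)) {f : Eucl N → V} (hf : ContDiff ℝ ∞ f) {C : ℝ}
    (hC : ∀ y, ‖iteratedFDeriv ℝ I.card f y‖ ≤ C) (x : Eucl N) :
    ‖oddPart I f x‖ ≤ 2 ^ I.card * C * ∏ i ∈ I, |x i| := by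
  induction I using Finset.induction_on generalizing f x with
  | empty =>
    have h := hC x
    rw [Finset.card_empty, norm_iteratedFDeriv_zero] at h
    simpa [oddPart] using h
  | insert i I hi ih =>
    set e : Eucl N := EuclideanSpace.single i (1 : ℝ) with he
    set B := 2 ^ I.card * C * ∏ j ∈ I, |x j| with hB
    have hd : ContDiff ℝ ∞ (fun y => fderiv ℝ f y e) :=
      (hf.fderiv_right (m := ∞) (by simp)).clm_apply contDiff_const
    have hbound : ∀ s : ℝ, ‖oddPart I (fun y => fderiv ℝ f y e) (x + s • e)‖ ≤ B := fun s => by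
      refine (ih hd (fun y => ?_) (x + s • e)).trans_eq ?_
      · have h1 := norm_iteratedFDeriv_clm_apply_const (𝕜 := ℝ) (c := e) (n := I.card) (x := y)
          (N := ∞) (hf.fderiv_right (m := ∞) (by simp)).contDiffAt (by exact_mod_cast le_top)
        rw [norm_iteratedFDeriv_fderiv, he, PiLp.norm_single, norm_one, one_mul] at h1
        rw [Finset.card_insert_of_notMem hi] at hC
        exact h1.trans (hC y)
      · rw [hB]
        congr 1
        refine Finset.prod_congr rfl fun j hj => ?_
        have : j ≠ i := fun h => hi (h ▸ hj)
        simp [he, this]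
    have hmv := Convex.norm_image_sub_le_of_norm_hasDerivWithin_le (C := B) (s := Set.univ)
      (fun s _ => (hasDerivAt_oddPart hi (hf.differentiable (by simp)) x s).hasDerivWithinAt)
      (fun s _ => hbound s) convex_univ (mem_univ (-(2 * x i))) (mem_univ (0 : ℝ))
    have hr : x + (-(2 * x i)) • (EuclideanSpace.single i (1 : ℝ) : Eucl N) = reflectCoord i x := by
      ext j
      rw [reflectCoord_apply]
      split_ifs with h
      · subst h; simp; ring
      · simp [h]
    rw [hr, zero_smul, add_zero] at hmv
    rw [oddPart_insert hi]
    refine hmv.trans_eq ?_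
    rw [Finset.prod_insert hi, Finset.card_insert_of_notMem hi, hB, sub_neg_eq_add, zero_add,
      Real.norm_eq_abs, abs_mul, abs_two]
    ring

end OddPart

/-! ### Singular data as tempered distributions -/

/-- An integrable majorant, up to constants, for the product of singular data and
anti-symmetrized test functions. -/
noncomputable def pairMajorant (N m : ℕ) (κ : ℝ) (y : Eucl N) : ℝ :=
  (Metric.ball (0 : Eucl N) 1).indicator (fun y => ‖y‖ ^ ((m : ℝ) - κ)) y +
    (1 + ‖y‖) ^ (-((N : ℝ) + 1))

/-- A seminorm on test functions controlling their anti-symmetrization. -/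
noncomputable def testSeminorm {N : ℕ} (m : ℕ) (φ : 𝓢(Eucl N, ℂ)) : ℝ :=
  2 ^ m * (2 ^ (N + 1) *
    (Finset.Iic (N + 1, m)).sup (fun p : ℕ × ℕ => SchwartzMap.seminorm ℂ p.1 p.2) φ)

section Tempered

variable {N m : ℕ} {κ A : ℝ} {w : Eucl N → ℝ}

theorem testSeminorm_nonneg (φ : 𝓢(Eucl N, ℂ)) : 0 ≤ testSeminorm m φ := by
  unfold testSeminorm; positivity

theorem pairMajorant_nonneg (y : Eucl N) : 0 ≤ pairMajorant N m κ y :=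
  add_nonneg (indicator_nonneg (fun _ _ => by positivity) y) (by positivity)

theorem integrable_one_add_norm_rpow : Integrable fun y : Eucl N => (1 + ‖y‖) ^ (-((N : ℝ) + 1)) :=
  integrable_one_add_norm (by simp)

theorem integrable_pairMajorant (hN : 1 ≤ N) (hκ : κ < N + m) :
    Integrable (pairMajorant N m κ) :=
  ((integrableOn_ball_norm_rpow hN (by linarith) 1).integrable_indicator measurableSet_ball).add
    integrable_one_add_norm_rpow

theorem SingularData.ae_abs_mul_le (hw : SingularData m κ A w) :
    ∀ᵐ y ∂volume.restrict (sector N m), ∀ g Q : ℝ, 0 ≤ g → 0 ≤ Q → g ≤ Q * ‖y‖ ^ m →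
      g ≤ Q * (1 + ‖y‖) ^ (-((N : ℝ) + 1)) → |w y| * g ≤ A * Q * pairMajorant N m κ y := by
  filter_upwards [hw.le, ae_restrict_mem measurableSet_sector] with y hy hyΩ g Q hg hQ h1 h2
  have hA := hw.nonneg
  have hy0 : 0 < ‖y‖ := norm_pos_iff.2 (sector_ne_zero hw.one_le hw.le_dim hyΩ)
  have h3 : 0 ≤ (1 + ‖y‖) ^ (-((N : ℝ) + 1)) := by positivity
  by_cases hb : y ∈ Metric.ball (0 : Eucl N) 1
  · rw [pairMajorant, indicator_of_mem hb]
    have h4 : |w y| * g ≤ A * ‖y‖ ^ (-κ) * (Q * ‖y‖ ^ m) := by gcongr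
    have h5 : ‖y‖ ^ ((m : ℝ) - κ) = ‖y‖ ^ m * ‖y‖ ^ (-κ) := by
      rw [sub_eq_add_neg, Real.rpow_add hy0, Real.rpow_natCast]
    rw [h5]
    have h6 : 0 ≤ A * Q * (1 + ‖y‖) ^ (-((N : ℝ) + 1)) := by positivity
    linarith
  · rw [pairMajorant, indicator_of_notMem hb, zero_add]
    have hy1 : 1 ≤ ‖y‖ := by simpa using hb
    have h4 : |w y| ≤ A := hy.trans (mul_le_of_le_one_right hA
      (Real.rpow_le_one_of_one_le_of_nonpos hy1 (by linarith [hw.kappa_pos])))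
    calc |w y| * g ≤ A * (Q * (1 + ‖y‖) ^ (-((N : ℝ) + 1))) := by gcongr
      _ = _ := by ring

theorem norm_apply_le_testSeminorm (φ : 𝓢(Eucl N, ℂ)) (y : Eucl N) :
    2 ^ m * ‖φ y‖ ≤ testSeminorm m φ * (1 + ‖y‖) ^ (-((N : ℝ) + 1)) := by
  have h := SchwartzMap.one_add_le_sup_seminorm_apply (𝕜 := ℂ) (m := (N + 1, m)) (k := N + 1)
    (n := 0) le_rfl (Nat.zero_le _) φ y
  rw [norm_iteratedFDeriv_zero] at h
  have e : (1 + ‖y‖) ^ (-((N : ℝ) + 1)) = ((1 + ‖y‖) ^ (N + 1))⁻¹ := by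
    rw [Real.rpow_neg (by positivity), ← Real.rpow_natCast]
    push_cast; rfl
  rw [e, ← div_eq_mul_inv, le_div_iff₀ (by positivity), testSeminorm, mul_assoc]
  refine mul_le_mul_of_nonneg_left ?_ (by positivity)
  rw [mul_comm]
  exact h

theorem norm_oddPart_le_pow (hm : m ≤ N) (φ : 𝓢(Eucl N, ℂ)) (z : Eucl N) :
    ‖oddPart (headCoords N m) φ z‖ ≤ testSeminorm m φ * ∏ i ∈ headCoords N m, |z i| := by
  refine (norm_oddPart_le_prod (f := ⇑φ) (headCoords N m) φ.smooth' (C := 2 ^ (N + 1) *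
    (Finset.Iic (N + 1, m)).sup (fun p : ℕ × ℕ => SchwartzMap.seminorm ℂ p.1 p.2) φ)
    (fun y => ?_) z).trans_eq ?_
  · rw [card_headCoords hm]
    have h := SchwartzMap.one_add_le_sup_seminorm_apply (𝕜 := ℂ) (m := (N + 1, m)) (k := 0)
      (n := m) (Nat.zero_le _) le_rfl φ y
    simpa using h
  · rw [card_headCoords hm, testSeminorm]

theorem one_add_norm_sub_rpow_le (v z : Eucl N) : (1 + ‖z - v‖) ^ (-((N : ℝ) + 1)) ≤
    (1 + ‖v‖) ^ (N + 1) * (1 + ‖z‖) ^ (-((N : ℝ) + 1)) := by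
  have h1 : 1 + ‖z‖ ≤ (1 + ‖v‖) * (1 + ‖z - v‖) := by
    have : ‖z‖ ≤ ‖z - v‖ + ‖v‖ := by simpa using norm_add_le (z - v) v
    nlinarith [norm_nonneg (z - v), norm_nonneg v, mul_nonneg (norm_nonneg v) (norm_nonneg (z - v))]
  have h2 : ((1 + ‖v‖) * (1 + ‖z - v‖)) ^ (-((N : ℝ) + 1)) ≤ (1 + ‖z‖) ^ (-((N : ℝ) + 1)) :=
    Real.rpow_le_rpow_of_nonpos (by positivity) h1 (by linarith [Nat.cast_nonneg (α := ℝ) N])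
  rw [Real.mul_rpow (by positivity) (by positivity)] at h2
  have h3 : (1 + ‖v‖) ^ (N + 1) * (1 + ‖v‖) ^ (-((N : ℝ) + 1)) = 1 := by
    rw [← Real.rpow_natCast, ← Real.rpow_add (by positivity)]
    push_cast
    simp
  calc (1 + ‖z - v‖) ^ (-((N : ℝ) + 1)) = (1 + ‖v‖) ^ (N + 1) *
        ((1 + ‖v‖) ^ (-((N : ℝ) + 1)) * (1 + ‖z - v‖) ^ (-((N : ℝ) + 1))) := by
        rw [← mul_assoc, h3, one_mul]
    _ ≤ _ := by gcongr

theorem norm_oddPart_le_rpow (hm : m ≤ N) (φ : 𝓢(Eucl N, ℂ)) (z : Eucl N) :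
    ‖oddPart (headCoords N m) φ z‖ ≤ testSeminorm m φ * (1 + ‖z‖) ^ (-((N : ℝ) + 1)) := by
  have h2 : (0 : ℝ) < 2 ^ m := by positivity
  refine (norm_oddPart_le_of_forall (C := (2 ^ m)⁻¹ *
    (testSeminorm m φ * (1 + ‖z‖) ^ (-((N : ℝ) + 1)))) fun S => ?_).trans_eq ?_
  · rw [← div_eq_inv_mul, le_div_iff₀ h2, mul_comm]
    simpa using norm_apply_le_testSeminorm (m := m) φ (signFlip S z)
  · rw [card_headCoords hm, mul_inv_cancel_left₀ h2.ne']

theorem continuous_oddPart (I : Finset (Fin N)) {f : Eucl N → ℂ} (hf : Continuous f) :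
    Continuous (oddPart I f) :=
  continuous_finsetSum _ fun S _ => (hf.comp (signFlip S).continuous).const_smul _

theorem SingularData.norm_mul_oddPart_le (hw : SingularData m κ A w) :
    ∀ᵐ y ∂volume.restrict (sector N m), ∀ φ : 𝓢(Eucl N, ℂ),
      ‖(w y : ℂ) * oddPart (headCoords N m) φ y‖ ≤ A * testSeminorm m φ * pairMajorant N m κ y := by
  filter_upwards [hw.ae_abs_mul_le] with y hy φ
  rw [norm_mul, Complex.norm_real]
  exact hy _ _ (norm_nonneg _) (testSeminorm_nonneg φ)
    ((norm_oddPart_le_pow hw.le_dim φ y).trans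
      (mul_le_mul_of_nonneg_left (prod_abs_headCoords_le hw.le_dim y) (testSeminorm_nonneg φ)))
    (norm_oddPart_le_rpow hw.le_dim φ y)

theorem SingularData.integrableOn_mul_oddPart (hw : SingularData m κ A w) (φ : 𝓢(Eucl N, ℂ)) :
    IntegrableOn (fun y => (w y : ℂ) * oddPart (headCoords N m) φ y) (sector N m) := by
  refine ((integrable_pairMajorant hw.one_le_dim hw.kappa_lt).integrableOn.const_mul
    (A * testSeminorm m φ)).mono' ?_ ?_
  · exact (Complex.continuous_ofReal.comp_aestronglyMeasurable hw.meas).mul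
      (continuous_oddPart _ φ.continuous).aestronglyMeasurable
  · filter_upwards [hw.norm_mul_oddPart_le] with y hy
    exact hy φ

/-- The tempered distribution `φ ↦ ∫_Ω w φ_A`, with `φ_A` the anti-symmetrization of `φ`. -/
theorem SingularData.exists_distribution (hw : SingularData m κ A w) :
    ∃ U : 𝓢'(Eucl N, ℂ), ∀ φ : 𝓢(Eucl N, ℂ),
      U φ = ∫ y in sector N m, (w y : ℂ) * oddPart (headCoords N m) φ y := by
  have hmaj := integrable_pairMajorant (m := m) (κ := κ) hw.one_le_dim hw.kappa_lt
  have hA := hw.nonneg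
  refine ⟨ContinuousLinearMap.toPointwiseConvergenceCLM _ _ _ _
    (SchwartzMap.mkCLMtoNormedSpace (𝕜 := ℂ) (σ := RingHom.id ℂ)
      (fun φ : 𝓢(Eucl N, ℂ) => ∫ y in sector N m, (w y : ℂ) * oddPart (headCoords N m) φ y)
      (fun φ ψ => ?_) (fun c φ => ?_) ⟨Finset.Iic (N + 1, m),
        A * (2 ^ m * 2 ^ (N + 1)) * ∫ y in sector N m, pairMajorant N m κ y, ?_, fun φ => ?_⟩),
    fun φ => rfl⟩
  · rw [← integral_add (hw.integrableOn_mul_oddPart φ) (hw.integrableOn_mul_oddPart ψ)]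
    congr 1
    ext y
    rw [← mul_add]
    congr 1
    simp only [oddPart, ← Finset.sum_add_distrib, ← smul_add]
    rfl
  · rw [RingHom.id_apply, ← integral_smul]
    congr 1
    ext y
    rw [smul_eq_mul, mul_left_comm]
    congr 1
    simp only [oddPart, Finset.mul_sum]
    refine Finset.sum_congr rfl fun S _ => ?_
    rw [mul_smul_comm]
    rfl
  · have : 0 ≤ ∫ y in sector N m, pairMajorant N m κ y :=
      integral_nonneg fun y => pairMajorant_nonneg y
    positivity
  · refine (norm_integral_le_of_norm_le (hmaj.integrableOn.const_mul (A * testSeminorm m φ))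
      (hw.norm_mul_oddPart_le.mono fun y hy => hy φ)).trans_eq ?_
    rw [integral_const_mul, testSeminorm]
    have e : (Finset.Iic (N + 1, m)).sup (schwartzSeminormFamily ℂ (Eucl N) ℂ) φ =
      (Finset.Iic (N + 1, m)).sup (fun p : ℕ × ℕ => SchwartzMap.seminorm ℂ p.1 p.2) φ := rfl
    rw [e]
    ring

theorem oddPart_gaussSchwartz {t : ℝ} (ht : 0 < t) (x y : Eucl N) :
    oddPart (headCoords N m) (gaussSchwartz ht x) y = (sectorKernel m t x y : ℂ) := by
  rw [sectorKernel_eq_sum, oddPart, Complex.ofReal_sum]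
  refine Finset.sum_congr rfl fun S _ => ?_
  rw [gaussSchwartz_apply, Complex.real_smul, Complex.ofReal_mul]

theorem SingularData.heatDist_eq (hw : SingularData m κ A w) {U : 𝓢'(Eucl N, ℂ)}
    (hU : ∀ φ : 𝓢(Eucl N, ℂ),
      U φ = ∫ y in sector N m, (w y : ℂ) * oddPart (headCoords N m) φ y)
    {t : ℝ} (ht : 0 < t) (x : Eucl N) : heatDist t U x = (evol m w t x : ℂ) := by
  rw [heatDist, dif_pos ht, hU, hw.evol_apply ht, ← integral_complex_ofReal]
  congr 1
  ext y
  rw [oddPart_gaussSchwartz, mul_comm, Complex.ofReal_mul]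

theorem ae_abs_le_of_antisymmInAE (hanti : AntisymmInAE m w) (hw : SingularData m κ A w) :
    ∀ᵐ x, |w x| ≤ A * ‖x‖ ^ (-κ) := by
  have h1 : ∀ᵐ x, ∀ S ∈ (headCoords N m).powerset, w (signFlip S x) = (-1) ^ S.card * w x := by
    rw [eventually_all_finset]
    exact fun S hS => hanti.apply_signFlip (Finset.mem_powerset.1 hS)
  have h2 : ∀ᵐ x : Eucl N, ∀ S ∈ (headCoords N m).powerset, signFlip S x ∈ sector N m →
      |w (signFlip S x)| ≤ A * ‖signFlip S x‖ ^ (-κ) := by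
    rw [eventually_all_finset]
    exact fun S _ => (measurePreserving_signFlip S).quasiMeasurePreserving.ae
      ((ae_restrict_iff' measurableSet_sector).1 hw.le)
  filter_upwards [h1, h2, ae_coord_ne_zero] with x hx1 hx2 hx3
  obtain ⟨S, hS, hSx⟩ := exists_signFlip_mem_sector m hx3
  have := hx2 S (Finset.mem_powerset.2 hS) hSx
  rw [hx1 S (Finset.mem_powerset.2 hS), LinearIsometryEquiv.norm_map, abs_mul, abs_pow, abs_neg,
    abs_one, one_pow, one_mul] at this
  exact this

theorem isTemperedExtension_of_singularData (hw : SingularData m κ A w)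
    (hmeas : AEStronglyMeasurable w) (hanti : AntisymmInAE m w) {U : 𝓢'(Eucl N, ℂ)}
    (hU : ∀ φ : 𝓢(Eucl N, ℂ),
      U φ = ∫ y in sector N m, (w y : ℂ) * oddPart (headCoords N m) φ y) :
    IsTemperedExtension w U := by
  intro φ
  have hA := hw.nonneg
  have hmeasC : AEStronglyMeasurable fun x => (w x : ℂ) :=
    Complex.continuous_ofReal.comp_aestronglyMeasurable hmeas
  have hset : ∀ ε : ℝ, MeasurableSet {x : Eucl N | ε < ‖x‖} := fun ε =>
    (isOpen_lt continuous_const continuous_norm).measurableSet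
  have hint : ∀ ε > 0, IntegrableOn (fun x => (w x : ℂ) * φ x) {x | ε < ‖x‖} := fun ε hε => by
    refine φ.integrable.integrableOn.bdd_mul (c := A * ε ^ (-κ)) hmeasC.restrict ?_
    filter_upwards [ae_restrict_of_ae (ae_abs_le_of_antisymmInAE hanti hw),
      ae_restrict_mem (hset ε)] with x hx hx2
    rw [Complex.norm_real]
    refine hx.trans (mul_le_mul_of_nonneg_left ?_ hA)
    exact Real.rpow_le_rpow_of_nonpos hε (le_of_lt hx2) (by linarith [hw.kappa_pos])
  refine ⟨hint, ?_⟩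
  rw [hU]
  have h1 : ∀ᵐ x, ∀ S ∈ (headCoords N m).powerset, w (signFlip S x) = (-1) ^ S.card * w x := by
    rw [eventually_all_finset]
    exact fun S hS => hanti.apply_signFlip (Finset.mem_powerset.1 hS)
  have hfold : ∀ ε > 0, ∫ x in {x : Eucl N | ε < ‖x‖}, (w x : ℂ) * φ x =
      ∫ y in sector N m, {x : Eucl N | ε < ‖x‖}.indicator
        (fun y => (w y : ℂ) * oddPart (headCoords N m) φ y) y := fun ε hε => by
    rw [← integral_indicator (hset ε), integral_eq_setIntegral_sector_sum (m := m)
      ((hint ε hε).integrable_indicator (hset ε))]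
    refine integral_congr_ae (ae_restrict_of_ae ?_)
    filter_upwards [h1] with y hy
    by_cases hyε : ε < ‖y‖
    · rw [indicator_of_mem (show y ∈ {x : Eucl N | ε < ‖x‖} from hyε), oddPart, Finset.mul_sum]
      refine Finset.sum_congr rfl fun S hS => ?_
      rw [indicator_of_mem (show signFlip S y ∈ {x : Eucl N | ε < ‖x‖} by simpa using hyε),
        hy S hS, Complex.real_smul]
      push_cast
      ring
    · rw [indicator_of_notMem (show y ∉ {x : Eucl N | ε < ‖x‖} from hyε)]
      refine Finset.sum_eq_zero fun S hS => ?_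
      rw [indicator_of_notMem (show signFlip S y ∉ {x : Eucl N | ε < ‖x‖} by simpa using hyε)]
  have hev : ∀ᶠ ε : ℝ in 𝓝[>] 0, 0 < ε := self_mem_nhdsWithin
  refine Tendsto.congr' (hev.mono fun ε hε => (hfold ε hε).symm) ?_
  refine tendsto_integral_filter_of_dominated_convergence
    (fun y => A * testSeminorm m φ * pairMajorant N m κ y) ?_ ?_ ?_ ?_
  · exact Eventually.of_forall fun ε =>
      (hw.integrableOn_mul_oddPart φ).aestronglyMeasurable.indicator (hset ε)
  · refine Eventually.of_forall fun ε => ?_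
    filter_upwards [hw.norm_mul_oddPart_le] with y hy
    exact (norm_indicator_le_norm_self _ _).trans (hy φ)
  · exact (integrable_pairMajorant hw.one_le_dim hw.kappa_lt).integrableOn.const_mul _
  · filter_upwards [ae_restrict_mem measurableSet_sector] with y hy
    have hy0 : 0 < ‖y‖ := norm_pos_iff.2 (sector_ne_zero hw.one_le hw.le_dim hy)
    refine tendsto_const_nhds.congr' ?_
    filter_upwards [mem_nhdsWithin_of_mem_nhds (gt_mem_nhds hy0)] with ε hε
    rw [indicator_of_mem (show y ∈ {x : Eucl N | ε < ‖x‖} from hε)]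

end Tempered

/-! ### Continuity at the initial time -/

section Moments

variable {N m : ℕ}

theorem integrable_gaussKernel_sub_mul_pow {t : ℝ} (ht : 0 < t) (y : Eucl N) (k : ℕ) :
    Integrable fun x => gaussKernel t (x - y) * (1 + ‖x‖) ^ k := by
  set b : ℝ := 1 / (4 * t) with hb
  have hb0 : 0 < b := by positivity
  set c : ℝ := (4 * Real.pi * t) ^ (-(N : ℝ) / 2) with hc
  have hc0 : 0 < c := by positivity
  set D : ℝ := (1 + ‖y‖) ^ k * (k.factorial * Real.exp (1 + 1 / (4 * (b / 2)))) with hD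
  refine (((integrable_exp_neg_mul_norm_sq (N := N) (half_pos hb0)).comp_sub_right y).const_mul
    (c * D)).mono' ?_ (Eventually.of_forall fun x => ?_)
  · exact (((continuous_gaussKernel t).comp (continuous_id.sub continuous_const)).mul
      ((continuous_const.add continuous_norm).pow k)).aestronglyMeasurable
  · rw [Real.norm_of_nonneg (mul_nonneg (gaussKernel_pos ht _).le (by positivity)), gaussKernel_eq,
      ← hb, ← hc]
    have h := one_add_norm_pow_mul_exp_le (half_pos hb0) y x k
    rw [norm_sub_rev] at h
    have e : Real.exp (-b * ‖x - y‖ ^ 2) =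
        Real.exp (-(b / 2) * ‖x - y‖ ^ 2) * Real.exp (-(b / 2) * ‖x - y‖ ^ 2) := by
      rw [← Real.exp_add]; congr 1; ring
    rw [e]
    calc c * (Real.exp (-(b / 2) * ‖x - y‖ ^ 2) * Real.exp (-(b / 2) * ‖x - y‖ ^ 2)) * (1 + ‖x‖) ^ k
        = c * Real.exp (-(b / 2) * ‖x - y‖ ^ 2) *
          ((1 + ‖x‖) ^ k * Real.exp (-(b / 2) * ‖x - y‖ ^ 2)) := by ring
      _ ≤ c * Real.exp (-(b / 2) * ‖x - y‖ ^ 2) * D := by gcongr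
      _ = _ := by ring

theorem integral_gaussKernel_sub_smul {V : Type*} [NormedAddCommGroup V] [NormedSpace ℝ V]
    {t : ℝ} (ht : 0 < t) (f : Eucl N → V) (y : Eucl N) :
    ∫ x, gaussKernel t (x - y) • f x = ∫ z, gaussKernel 1 z • f (√t • z + y) := by
  rw [← integral_gaussKernel_mul_eq_scaled ht fun v => f (v + y),
    ← integral_sub_right_eq_self (fun v => gaussKernel t v • f (v + y)) y]
  simp_rw [sub_add_cancel]

theorem integrable_gaussKernel_mul_rpow {t : ℝ} (ht : 0 < t) (y : Eucl N) :
    Integrable fun x => gaussKernel t (x - y) * (1 + ‖x‖) ^ (-((N : ℝ) + 1)) := by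
  refine ((integrable_gaussKernel ht).comp_sub_right y).mul_bdd (c := 1) ?_
    (Eventually.of_forall fun x => ?_)
  · exact integrable_one_add_norm_rpow.aestronglyMeasurable
  · rw [Real.norm_of_nonneg (by positivity)]
    exact Real.rpow_le_one_of_one_le_of_nonpos (by linarith [norm_nonneg x])
      (by linarith [Nat.cast_nonneg (α := ℝ) N])

theorem integral_gaussKernel_mul_rpow_le {t : ℝ} (ht : 0 < t) (ht1 : t ≤ 1) (y : Eucl N) :
    ∫ x, gaussKernel t (x - y) * (1 + ‖x‖) ^ (-((N : ℝ) + 1)) ≤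
      (∫ z : Eucl N, gaussKernel 1 z * (1 + ‖z‖) ^ (N + 1)) * (1 + ‖y‖) ^ (-((N : ℝ) + 1)) := by
  have h := integral_gaussKernel_sub_smul ht (fun x => (1 + ‖x‖) ^ (-((N : ℝ) + 1))) y
  simp only [smul_eq_mul] at h
  rw [h, ← integral_mul_const]
  have hi : Integrable fun z : Eucl N => gaussKernel 1 z * (1 + ‖z‖) ^ (N + 1) := by
    simpa using integrable_gaussKernel_sub_mul_pow one_pos (0 : Eucl N) (N + 1)
  refine integral_mono_of_nonneg (Eventually.of_forall fun z =>
    mul_nonneg (gaussKernel_pos one_pos z).le (by positivity)) (hi.mul_const _)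
    (Eventually.of_forall fun z => ?_)
  change gaussKernel 1 z * _ ≤ gaussKernel 1 z * _ * _
  rw [mul_assoc]
  refine mul_le_mul_of_nonneg_left ?_ (gaussKernel_pos one_pos z).le
  have h1 := one_add_norm_sub_rpow_le (-(√t • z)) y
  rw [sub_neg_eq_add, norm_neg, add_comm y] at h1
  refine h1.trans ?_
  have h2 : ‖√t • z‖ ≤ ‖z‖ := by
    rw [norm_smul, Real.norm_of_nonneg (Real.sqrt_nonneg t)]
    exact mul_le_of_le_one_left (norm_nonneg z) (Real.sqrt_le_one.2 ht1)
  gcongr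

theorem sum_neg_one_pow_mul_prod_signFlip_add (I : Finset (Fin N)) (z v : Eucl N) :
    ∑ S ∈ I.powerset, (-1 : ℝ) ^ S.card * ∏ i ∈ I, (signFlip S z i + v i) = ∏ i ∈ I, (2 * z i) := by
  have h : ∏ i ∈ I, (2 * z i) = ∏ i ∈ I, ((z i + v i) - (-z i + v i)) :=
    Finset.prod_congr rfl fun i _ => by ring
  rw [h, Finset.prod_sub]
  refine Finset.sum_congr rfl fun S hS => ?_
  rw [Finset.mem_powerset] at hS
  rw [← Finset.prod_sdiff hS, mul_assoc]
  congr 2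
  · refine Finset.prod_congr rfl fun i hi => ?_
    rw [signFlip_apply, if_neg (Finset.mem_sdiff.1 hi).2]
  · refine Finset.prod_congr rfl fun i hi => ?_
    rw [signFlip_apply, if_pos hi]

theorem integrable_sectorKernel_left_mul {V : Type*} [NormedAddCommGroup V] [NormedSpace ℝ V]
    {t : ℝ} {f : Eucl N → V}
    (hf : ∀ y, Integrable fun x => gaussKernel t (x - y) • f x) (z : Eucl N) :
    Integrable fun x => sectorKernel m t x z • f x := by
  simp_rw [sectorKernel_eq_sum, Finset.sum_smul, mul_smul]
  exact integrable_finsetSum _ fun S _ => (hf _).fun_smul _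

theorem integral_sectorKernel_left_mul {V : Type*} [NormedAddCommGroup V] [NormedSpace ℝ V]
    {t : ℝ} {f : Eucl N → V}
    (hf : ∀ y, Integrable fun x => gaussKernel t (x - y) • f x) (z : Eucl N) :
    ∫ x, sectorKernel m t x z • f x = ∑ S ∈ (headCoords N m).powerset,
      (-1 : ℝ) ^ S.card • ∫ x, gaussKernel t (x - signFlip S z) • f x := by
  simp_rw [sectorKernel_eq_sum, Finset.sum_smul, mul_smul]
  rw [integral_finsetSum _ fun S _ => (hf _).fun_smul _]
  simp_rw [integral_smul]

/-- Folding of the pairing with the kernel of the sector. -/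
theorem integral_sectorKernel_left_mul_eq_setIntegral {V : Type*} [NormedAddCommGroup V]
    [NormedSpace ℝ V] {t : ℝ} {f : Eucl N → V}
    (hf : ∀ y, Integrable fun x => gaussKernel t (x - y) • f x) (z : Eucl N) :
    ∫ x, sectorKernel m t x z • f x =
      ∫ x in sector N m, sectorKernel m t x z • oddPart (headCoords N m) f x := by
  rw [integral_eq_setIntegral_sector_sum (m := m) (integrable_sectorKernel_left_mul hf z)]
  congr 1
  ext y
  rw [oddPart, Finset.smul_sum]
  refine Finset.sum_congr rfl fun S hS => ?_
  rw [(sectorKernel_antisymmIn t z).apply_signFlip (Finset.mem_powerset.1 hS), smul_smul, mul_comm]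

theorem oddPart_prod (I : Finset (Fin N)) (x : Eucl N) :
    oddPart I (fun x => ∏ i ∈ I, x i) x = ∏ i ∈ I, (2 * x i) := by
  rw [← sum_neg_one_pow_mul_prod_signFlip_add I x 0]
  simp [oddPart]

theorem integrable_gaussKernel_sub_smul_prod (hm : m ≤ N) {t : ℝ} (ht : 0 < t) (y : Eucl N) :
    Integrable fun x => gaussKernel t (x - y) • ∏ i ∈ headCoords N m, x i := by
  refine (integrable_gaussKernel_sub_mul_pow ht y m).mono' ?_ (Eventually.of_forall fun x => ?_)
  · exact (((continuous_gaussKernel t).comp (continuous_id.sub continuous_const)).mul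
      (continuous_finsetProd _ fun i _ => by fun_prop)).aestronglyMeasurable
  · rw [norm_smul, Real.norm_of_nonneg (gaussKernel_pos ht _).le, Real.norm_eq_abs,
      Finset.abs_prod]
    refine mul_le_mul_of_nonneg_left ((prod_abs_headCoords_le hm x).trans ?_)
      (gaussKernel_pos ht _).le
    gcongr
    linarith

/-- The function `∏ x_i` is stationary for the heat flow in the sector. -/
theorem setIntegral_sectorKernel_mul_prod (hm : m ≤ N) {t : ℝ} (ht : 0 < t) (z : Eucl N) :
    ∫ x in sector N m, sectorKernel m t x z * ∏ i ∈ headCoords N m, x i =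
      ∏ i ∈ headCoords N m, z i := by
  have hf := integrable_gaussKernel_sub_smul_prod hm ht
  have hshift : ∀ S : Finset (Fin N), ∫ x, gaussKernel t (x - signFlip S z) •
      ∏ i ∈ headCoords N m, x i = ∫ v, gaussKernel t v • ∏ i ∈ headCoords N m,
        (signFlip S z i + v i) := fun S => by
    rw [← integral_sub_right_eq_self (fun v => gaussKernel t v • ∏ i ∈ headCoords N m,
      (signFlip S z i + v i)) (signFlip S z)]
    simp
  have hi : ∀ S : Finset (Fin N), Integrable fun v : Eucl N => gaussKernel t v •
      ∏ i ∈ headCoords N m, (signFlip S z i + v i) := fun S => by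
    have := (hf (signFlip S z)).comp_add_right (signFlip S z)
    simpa [add_comm] using this
  have h1 := integral_sectorKernel_left_mul (m := m) hf z
  have h2 := integral_sectorKernel_left_mul_eq_setIntegral (m := m) hf z
  have h3 : ∑ S ∈ (headCoords N m).powerset, (-1 : ℝ) ^ S.card •
      ∫ x, gaussKernel t (x - signFlip S z) • ∏ i ∈ headCoords N m, x i =
      2 ^ m * ∏ i ∈ headCoords N m, z i := by
    simp_rw [hshift, ← integral_smul]
    rw [← integral_finsetSum _ fun S _ => (hi S).fun_smul ((-1 : ℝ) ^ S.card)]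
    have e : ∀ v : Eucl N, ∑ S ∈ (headCoords N m).powerset, (-1 : ℝ) ^ S.card •
        gaussKernel t v • ∏ i ∈ headCoords N m, (signFlip S z i + v i) =
        gaussKernel t v * ∏ i ∈ headCoords N m, (2 * z i) := fun v => by
      rw [← sum_neg_one_pow_mul_prod_signFlip_add _ z v, Finset.mul_sum]
      refine Finset.sum_congr rfl fun S _ => ?_
      simp only [smul_eq_mul]
      ring
    simp_rw [e]
    rw [integral_mul_const, integral_gaussKernel ht, one_mul, Finset.prod_mul_distrib,
      Finset.prod_const, card_headCoords hm]
  rw [h2, h3] at h1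
  simp_rw [oddPart_prod, Finset.prod_mul_distrib, Finset.prod_const, card_headCoords hm,
    smul_eq_mul, mul_left_comm _ ((2 : ℝ) ^ m)] at h1
  rw [integral_const_mul] at h1
  exact mul_left_cancel₀ (by positivity) h1

theorem setIntegral_sectorKernel_mul_rpow_le (hm : m ≤ N) {t : ℝ} (ht : 0 < t) (ht1 : t ≤ 1)
    (z : Eucl N) :
    ∫ x in sector N m, |sectorKernel m t x z| * (1 + ‖x‖) ^ (-((N : ℝ) + 1)) ≤
      2 ^ m * (∫ z : Eucl N, gaussKernel 1 z * (1 + ‖z‖) ^ (N + 1)) *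
        (1 + ‖z‖) ^ (-((N : ℝ) + 1)) := by
  have hi : ∀ S ∈ (headCoords N m).powerset, Integrable fun x =>
      gaussKernel t (x - signFlip S z) * (1 + ‖x‖) ^ (-((N : ℝ) + 1)) := fun S _ =>
    integrable_gaussKernel_mul_rpow ht _
  have hnn : ∀ x : Eucl N, 0 ≤ ∑ S ∈ (headCoords N m).powerset,
      gaussKernel t (x - signFlip S z) * (1 + ‖x‖) ^ (-((N : ℝ) + 1)) := fun x =>
    Finset.sum_nonneg fun S _ => mul_nonneg (gaussKernel_pos ht _).le (by positivity)
  calc ∫ x in sector N m, |sectorKernel m t x z| * (1 + ‖x‖) ^ (-((N : ℝ) + 1))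
      ≤ ∫ x in sector N m, ∑ S ∈ (headCoords N m).powerset,
          gaussKernel t (x - signFlip S z) * (1 + ‖x‖) ^ (-((N : ℝ) + 1)) := by
        refine integral_mono_of_nonneg (Eventually.of_forall fun x => by positivity)
          (integrable_finsetSum _ hi).integrableOn (Eventually.of_forall fun x => ?_)
        change |_| * _ ≤ ∑ S ∈ _, _ * _
        rw [← Finset.sum_mul]
        exact mul_le_mul_of_nonneg_right (abs_sectorKernel_le_sum ht x z) (by positivity)
    _ ≤ ∫ x, ∑ S ∈ (headCoords N m).powerset,
          gaussKernel t (x - signFlip S z) * (1 + ‖x‖) ^ (-((N : ℝ) + 1)) :=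
        setIntegral_le_integral (integrable_finsetSum _ hi) (Eventually.of_forall hnn)
    _ ≤ ∑ S ∈ (headCoords N m).powerset, (∫ z : Eucl N, gaussKernel 1 z * (1 + ‖z‖) ^ (N + 1)) *
          (1 + ‖z‖) ^ (-((N : ℝ) + 1)) := by
        rw [integral_finsetSum _ hi]
        refine Finset.sum_le_sum fun S _ => ?_
        simpa using integral_gaussKernel_mul_rpow_le ht ht1 (signFlip S z)
    _ = _ := by
        rw [Finset.sum_const, Finset.card_powerset, card_headCoords hm, nsmul_eq_mul]
        push_cast
        ring

end Moments

section Pairing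

variable {N m : ℕ} {κ A : ℝ} {w : Eucl N → ℝ}

/-- The constant in the decay estimate for the pairing of the kernel of the sector with a
test function. -/
noncomputable def pairConst (N m : ℕ) : ℝ :=
  1 + 2 ^ m * ∫ z : Eucl N, gaussKernel 1 z * (1 + ‖z‖) ^ (N + 1)

theorem one_le_pairConst : 1 ≤ pairConst N m := by
  have : 0 ≤ ∫ z : Eucl N, gaussKernel 1 z * (1 + ‖z‖) ^ (N + 1) :=
    integral_nonneg fun z => mul_nonneg (gaussKernel_pos one_pos z).le (by positivity)
  unfold pairConst
  have := mul_nonneg (by positivity : (0 : ℝ) ≤ 2 ^ m) this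
  linarith

theorem exists_sectorPairing {g : Eucl N → ℂ} (hg : IntegrableOn g (sector N m)) :
    ∃ Λ : C₀(Eucl N, ℝ) →L[ℝ] ℂ, ∀ f, Λ f = ∫ x in sector N m, f x • g x := by
  have hi : ∀ f : C₀(Eucl N, ℝ), IntegrableOn (fun x => f x • g x) (sector N m) := fun f =>
    hg.bdd_smul ‖f‖ f.continuous.aestronglyMeasurable
      (Eventually.of_forall fun x => f.abs_apply_le_norm x)
  refine ⟨LinearMap.mkContinuous
    { toFun := fun f => ∫ x in sector N m, f x • g x
      map_add' := fun f h => ?_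
      map_smul' := fun c f => ?_ } (∫ x in sector N m, ‖g x‖) fun f => ?_, fun f => rfl⟩
  · rw [← integral_add (hi f) (hi h)]
    simp_rw [ZeroAtInftyContinuousMap.add_apply, add_smul]
  · rw [RingHom.id_apply, ← integral_smul]
    simp_rw [ZeroAtInftyContinuousMap.smul_apply, smul_assoc]
  · rw [mul_comm, ← integral_const_mul]
    refine norm_integral_le_of_norm_le (hg.norm.const_mul _) (Eventually.of_forall fun x => ?_)
    rw [norm_smul]
    exact mul_le_mul_of_nonneg_right (f.abs_apply_le_norm x) (norm_nonneg _)

/-- Continuous functions with the size on the sector of an anti-symmetrized test function. -/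
structure SectorTest {N : ℕ} (m : ℕ) (Q : ℝ) (g : Eucl N → ℂ) : Prop where
  le_dim : m ≤ N
  nonneg : 0 ≤ Q
  cont : Continuous g
  le_prod : ∀ x, ‖g x‖ ≤ Q * ∏ i ∈ headCoords N m, |x i|
  le_rpow : ∀ x, ‖g x‖ ≤ Q * (1 + ‖x‖) ^ (-((N : ℝ) + 1))

namespace SectorTest

variable {Q : ℝ} {g : Eucl N → ℂ}

theorem integrable (hg : SectorTest m Q g) : Integrable g :=
  (integrable_one_add_norm_rpow.const_mul Q).mono' hg.cont.aestronglyMeasurable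
    (Eventually.of_forall hg.le_rpow)

theorem norm_setIntegral_le_prod (hg : SectorTest m Q g) {t : ℝ} (ht : 0 < t) {z : Eucl N}
    (hz : z ∈ sector N m) :
    ‖∫ x in sector N m, sectorKernel m t x z • g x‖ ≤ Q * ∏ i ∈ headCoords N m, |z i| := by
  have hi := (integrable_sectorKernel_left_mul (m := m)
    (integrable_gaussKernel_sub_smul_prod hg.le_dim ht) z).const_mul Q
  have habs : ∀ x ∈ sector N m, ∏ i ∈ headCoords N m, |x i| = ∏ i ∈ headCoords N m, x i :=
    fun x hx => Finset.prod_congr rfl fun i hi => abs_of_pos (hx i (mem_headCoords.1 hi))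
  refine (norm_integral_le_of_norm_le hi.integrableOn ?_).trans_eq ?_
  · filter_upwards [ae_restrict_mem measurableSet_sector] with x hx
    rw [norm_smul, Real.norm_of_nonneg (sectorKernel_pos ht hx hz).le, smul_eq_mul, mul_left_comm,
      ← habs x hx]
    exact mul_le_mul_of_nonneg_left (hg.le_prod x) (sectorKernel_pos ht hx hz).le
  · simp_rw [smul_eq_mul]
    rw [integral_const_mul, setIntegral_sectorKernel_mul_prod hg.le_dim ht, habs z hz]

theorem norm_setIntegral_le_rpow (hg : SectorTest m Q g) {t : ℝ} (ht : 0 < t) (ht1 : t ≤ 1)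
    (z : Eucl N) : ‖∫ x in sector N m, sectorKernel m t x z • g x‖ ≤
      pairConst N m * Q * (1 + ‖z‖) ^ (-((N : ℝ) + 1)) := by
  have hQ := hg.nonneg
  have hi : Integrable fun x => |sectorKernel m t x z| * (1 + ‖x‖) ^ (-((N : ℝ) + 1)) := by
    have := (integrable_sectorKernel_left_mul (m := m)
      (fun y => integrable_gaussKernel_mul_rpow ht y) z).abs
    refine this.congr (Eventually.of_forall fun x => ?_)
    simp only [smul_eq_mul, abs_mul]
    rw [abs_of_nonneg (by positivity : 0 ≤ (1 + ‖x‖) ^ (-((N : ℝ) + 1)))]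
  refine (norm_integral_le_of_norm_le (hi.const_mul Q).integrableOn
    (Eventually.of_forall fun x => ?_)).trans ?_
  · rw [norm_smul, Real.norm_eq_abs, mul_left_comm]
    exact mul_le_mul_of_nonneg_left (hg.le_rpow x) (abs_nonneg _)
  · rw [integral_const_mul, mul_comm (pairConst N m), mul_assoc]
    refine mul_le_mul_of_nonneg_left
      ((setIntegral_sectorKernel_mul_rpow_le hg.le_dim ht ht1 z).trans ?_) hQ
    refine mul_le_mul_of_nonneg_right ?_ (by positivity)
    unfold pairConst
    linarith

theorem norm_smul_setIntegral_le (hg : SectorTest m Q g) (hw : SingularData m κ A w) :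
    ∀ᵐ z ∂volume.restrict (sector N m), ∀ t, 0 < t → t ≤ 1 →
      ‖w z • ∫ x in sector N m, sectorKernel m t x z • g x‖ ≤
        A * (pairConst N m * Q) * pairMajorant N m κ z := by
  have hQ := hg.nonneg
  have hD : 1 ≤ pairConst N m := one_le_pairConst
  filter_upwards [hw.ae_abs_mul_le, ae_restrict_mem measurableSet_sector] with z hz hzΩ t ht ht1
  rw [norm_smul, Real.norm_eq_abs]
  refine hz _ _ (norm_nonneg _) (by positivity) ?_ (hg.norm_setIntegral_le_rpow ht ht1 z)
  refine (hg.norm_setIntegral_le_prod ht hzΩ).trans ?_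
  calc Q * ∏ i ∈ headCoords N m, |z i| ≤ Q * ‖z‖ ^ m :=
        mul_le_mul_of_nonneg_left (prod_abs_headCoords_le hg.le_dim z) hQ
    _ ≤ pairConst N m * Q * ‖z‖ ^ m :=
        mul_le_mul_of_nonneg_right (le_mul_of_one_le_left hQ hD) (by positivity)

theorem continuous_setIntegral (hg : SectorTest m Q g) {t : ℝ} (ht : 0 < t) :
    Continuous fun z => ∫ x in sector N m, sectorKernel m t x z • g x := by
  obtain ⟨Λ, hΛ⟩ := exists_sectorPairing (m := m) hg.integrable.integrableOn
  refine (Λ.continuous.comp (continuous_sectorC0 (m := m) ht)).congr fun z => ?_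
  rw [Function.comp_apply, hΛ]
  simp_rw [sectorC0_apply]

theorem integrableOn_smul_setIntegral (hg : SectorTest m Q g) (hw : SingularData m κ A w)
    {t : ℝ} (ht : 0 < t) (ht1 : t ≤ 1) :
    IntegrableOn (fun z => w z • ∫ x in sector N m, sectorKernel m t x z • g x) (sector N m) :=
  ((integrable_pairMajorant hw.one_le_dim hw.kappa_lt).integrableOn.const_mul _).mono'
    (hw.meas.smul (hg.continuous_setIntegral ht).aestronglyMeasurable)
    ((hg.norm_smul_setIntegral_le hw).mono fun _ hz => hz t ht ht1)

/-- The evolution is symmetric with respect to the pairing on the sector. -/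
theorem setIntegral_evol_smul (hg : SectorTest m Q g) (hw : SingularData m κ A w)
    {t : ℝ} (ht : 0 < t) (ht1 : t ≤ 1) :
    ∫ x in sector N m, evol m w t x • g x =
      ∫ z in sector N m, w z • ∫ x in sector N m, sectorKernel m t x z • g x := by
  obtain ⟨Λ, hΛ⟩ := exists_sectorPairing (m := m) hg.integrable.integrableOn
  have h1 := (Λ.continuous.tendsto _).comp (hw.tendsto_trunc ht)
  rw [hΛ] at h1
  refine tendsto_nhds_unique h1 ?_
  have h2 : ∀ n : ℕ, Λ (∫ z in sector N m ∩ Metric.ball 0 ((n : ℝ) + 1), w z • sectorC0 m ht z) =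
      ∫ z in sector N m ∩ Metric.ball 0 ((n : ℝ) + 1),
        w z • ∫ x in sector N m, sectorKernel m t x z • g x := fun n => by
    rw [← Λ.integral_comp_comm (hw.integrableOn_smul_sectorC0 ht _)]
    simp_rw [map_smul, hΛ, sectorC0_apply]
  refine Tendsto.congr (fun n => (h2 n).symm) ?_
  have hU : ⋃ n : ℕ, sector N m ∩ Metric.ball (0 : Eucl N) ((n : ℝ) + 1) = sector N m := by
    rw [← inter_iUnion, inter_eq_left]
    intro z _
    obtain ⟨n, hn⟩ := exists_nat_gt ‖z‖
    exact mem_iUnion.2 ⟨n, by simp; linarith⟩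
  have h3 := tendsto_setIntegral_of_monotone (μ := volume)
    (s := fun n : ℕ => sector N m ∩ Metric.ball (0 : Eucl N) ((n : ℝ) + 1))
    (fun n => measurableSet_sector.inter measurableSet_ball)
    (fun a b hab => inter_subset_inter_right _ (Metric.ball_subset_ball (by
      have : (a : ℝ) ≤ b := by exact_mod_cast hab
      linarith)))
    (f := fun z => w z • ∫ x in sector N m, sectorKernel m t x z • g x)
    (by rw [hU]; exact hg.integrableOn_smul_setIntegral hw ht ht1)
  rwa [hU] at h3

end SectorTest

theorem sectorTest_oddPart (hm : m ≤ N) (φ : 𝓢(Eucl N, ℂ)) :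
    SectorTest m (testSeminorm m φ) (oddPart (headCoords N m) φ) where
  le_dim := hm
  nonneg := testSeminorm_nonneg φ
  cont := continuous_oddPart _ φ.continuous
  le_prod := norm_oddPart_le_pow hm φ
  le_rpow := norm_oddPart_le_rpow hm φ

theorem sectorTest_norm {Q : ℝ} {g : Eucl N → ℂ} (hg : SectorTest m Q g) :
    SectorTest m Q fun x => ((‖g x‖ : ℝ) : ℂ) where
  __ := hg
  cont := Complex.continuous_ofReal.comp hg.cont.norm
  le_prod x := by simpa using hg.le_prod x
  le_rpow x := by simpa using hg.le_rpow x

theorem integrable_gaussKernel_sub_smul_schwartz {t : ℝ} (ht : 0 < t) (φ : 𝓢(Eucl N, ℂ))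
    (y : Eucl N) : Integrable fun x => gaussKernel t (x - y) • φ x :=
  φ.integrable.bdd_smul ((4 * Real.pi * t) ^ (-(N : ℝ) / 2))
    ((continuous_gaussKernel t).comp (continuous_id.sub continuous_const)).aestronglyMeasurable
    (Eventually.of_forall fun x => by
      exact (Real.norm_of_nonneg (gaussKernel_pos ht _).le).trans_le (gaussKernel_le ht _))

theorem tendsto_integral_gaussKernel_sub_smul (φ : 𝓢(Eucl N, ℂ)) (y : Eucl N) :
    Tendsto (fun t => ∫ x, gaussKernel t (x - y) • φ x) (𝓝[>] 0) (𝓝 (φ y)) := by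
  have hev : ∀ᶠ t : ℝ in 𝓝[>] 0, 0 < t := self_mem_nhdsWithin
  refine Tendsto.congr' (hev.mono fun t ht => (integral_gaussKernel_sub_smul ht φ y).symm) ?_
  have h : ∫ z : Eucl N, gaussKernel 1 z • φ y = φ y := by
    rw [integral_smul_const, integral_gaussKernel one_pos, one_smul]
  obtain ⟨D, hD⟩ : ∃ D, ∀ x, ‖φ x‖ ≤ D :=
    ⟨_, fun x => (φ.toBoundedContinuousFunction).norm_coe_le_norm x⟩
  have key : Tendsto (fun t => ∫ z, gaussKernel 1 z • φ (√t • z + y)) (𝓝[>] 0)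
      (𝓝 (∫ z : Eucl N, gaussKernel 1 z • φ y)) := by
    refine tendsto_integral_filter_of_dominated_convergence (μ := volume)
      (F := fun (t : ℝ) (z : Eucl N) => gaussKernel 1 z • φ (√t • z + y))
      (f := fun z : Eucl N => gaussKernel 1 z • φ y)
      (fun z => gaussKernel 1 z * D) ?_ ?_ ?_ ?_
    · refine Eventually.of_forall fun t => Continuous.aestronglyMeasurable ?_
      exact (continuous_gaussKernel 1).smul
        (φ.continuous.comp ((continuous_const_smul (√t)).add continuous_const))
    · refine Eventually.of_forall fun t => Eventually.of_forall fun z => ?_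
      rw [norm_smul, Real.norm_of_nonneg (gaussKernel_pos one_pos z).le]
      exact mul_le_mul_of_nonneg_left (hD _) (gaussKernel_pos one_pos z).le
    · exact (integrable_gaussKernel one_pos).mul_const D
    · refine Eventually.of_forall fun z => ?_
      have hc : Continuous fun t : ℝ => √t • z + y :=
        (Real.continuous_sqrt.smul continuous_const).add continuous_const
      have h2 := (φ.continuous.comp hc).tendsto 0
      simp only [Function.comp_apply, Real.sqrt_zero, zero_smul, zero_add] at h2
      exact (h2.mono_left nhdsWithin_le_nhds).const_smul (gaussKernel 1 z)
  rwa [h] at key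

theorem tendsto_setIntegral_sectorKernel_smul (φ : 𝓢(Eucl N, ℂ)) (z : Eucl N) :
    Tendsto (fun t => ∫ x in sector N m, sectorKernel m t x z • oddPart (headCoords N m) φ x)
      (𝓝[>] 0) (𝓝 (oddPart (headCoords N m) φ z)) := by
  have hev : ∀ᶠ t : ℝ in 𝓝[>] 0, 0 < t := self_mem_nhdsWithin
  have h := tendsto_finsetSum (headCoords N m).powerset fun S _ =>
    (tendsto_integral_gaussKernel_sub_smul φ (signFlip S z)).const_smul ((-1 : ℝ) ^ S.card)
  refine h.congr' (hev.mono fun t ht => ?_)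
  have hf := integrable_gaussKernel_sub_smul_schwartz ht φ
  exact ((integral_sectorKernel_left_mul_eq_setIntegral hf z).symm.trans
    (integral_sectorKernel_left_mul hf z)).symm

theorem SingularData.tendsto_setIntegral_evol (hw : SingularData m κ A w) (φ : 𝓢(Eucl N, ℂ)) :
    Tendsto (fun t => ∫ x in sector N m, evol m w t x • oddPart (headCoords N m) φ x) (𝓝[>] 0)
      (𝓝 (∫ y in sector N m, (w y : ℂ) * oddPart (headCoords N m) φ y)) := by
  have hg := sectorTest_oddPart (m := m) hw.le_dim φ
  have hev : ∀ᶠ t : ℝ in 𝓝[>] 0, 0 < t ∧ t ≤ 1 :=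
    mem_of_superset (Ioc_mem_nhdsGT one_pos) fun t ht => ht
  refine Tendsto.congr' (hev.mono fun t ht => (hg.setIntegral_evol_smul hw ht.1 ht.2).symm) ?_
  refine tendsto_integral_filter_of_dominated_convergence
    (fun z => A * (pairConst N m * testSeminorm m φ) * pairMajorant N m κ z) ?_ ?_ ?_ ?_
  · exact hev.mono fun t ht =>
      (hg.integrableOn_smul_setIntegral hw ht.1 ht.2).aestronglyMeasurable
  · exact hev.mono fun t ht => (hg.norm_smul_setIntegral_le hw).mono fun z hz => hz t ht.1 ht.2
  · exact (integrable_pairMajorant hw.one_le_dim hw.kappa_lt).integrableOn.const_mul _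
  · refine Eventually.of_forall fun z => ?_
    simpa using (tendsto_setIntegral_sectorKernel_smul (m := m) φ z).const_smul (w z)

theorem SectorTest.exists_setIntegral_evol_norm_le {Q : ℝ} {g : Eucl N → ℂ}
    (hg : SectorTest m Q g) (hw : SingularData m κ A w) :
    ∃ D, ∀ t, 0 < t → t ≤ 1 → ∫ x in sector N m, evol m w t x * ‖g x‖ ≤ D := by
  refine ⟨∫ z in sector N m, A * (pairConst N m * Q) * pairMajorant N m κ z, fun t ht ht1 => ?_⟩
  have h := (sectorTest_norm hg).setIntegral_evol_smul hw ht ht1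
  have h2 : ‖∫ x in sector N m, evol m w t x • ((‖g x‖ : ℝ) : ℂ)‖ ≤
      ∫ z in sector N m, A * (pairConst N m * Q) * pairMajorant N m κ z := by
    rw [h]
    exact norm_integral_le_of_norm_le
      ((integrable_pairMajorant hw.one_le_dim hw.kappa_lt).integrableOn.const_mul _)
      (((sectorTest_norm hg).norm_smul_setIntegral_le hw).mono fun z hz => hz t ht ht1)
  have h3 : ∫ x in sector N m, evol m w t x • ((‖g x‖ : ℝ) : ℂ) =
      ((∫ x in sector N m, evol m w t x * ‖g x‖ : ℝ) : ℂ) := by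
    rw [← integral_complex_ofReal]
    simp_rw [Complex.real_smul, Complex.ofReal_mul]
  rw [h3, Complex.norm_real] at h2
  exact (le_abs_self _).trans h2

theorem AntisymmIn.integral_mul_eq_setIntegral {f : C₀(Eucl N, ℝ)} (hf : AntisymmIn m f)
    (φ : 𝓢(Eucl N, ℂ)) : ∫ x, (f x : ℂ) * φ x =
      ∫ x in sector N m, f x • oddPart (headCoords N m) φ x := by
  have hi : Integrable fun x => (f x : ℂ) * φ x :=
    φ.integrable.bdd_mul (c := ‖f‖)
      (Complex.continuous_ofReal.comp f.continuous).aestronglyMeasurable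
      (Eventually.of_forall fun x => by
        rw [Complex.norm_real]; exact f.abs_apply_le_norm x)
  rw [integral_eq_setIntegral_sector_sum (m := m) hi]
  congr 1
  ext y
  rw [oddPart, Finset.smul_sum]
  refine Finset.sum_congr rfl fun S hS => ?_
  rw [hf.apply_signFlip (Finset.mem_powerset.1 hS), smul_smul, Complex.real_smul, mul_comm (f y)]

/-- A curve asymptotic to the linear evolution attains the initial value in `𝓢'`. -/
theorem SingularData.tendstoInitial (hw : SingularData m κ A w) {U : 𝓢'(Eucl N, ℂ)}
    (hU : ∀ φ : 𝓢(Eucl N, ℂ),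
      U φ = ∫ y in sector N m, (w y : ℂ) * oddPart (headCoords N m) φ y)
    {u : ℝ → C₀(Eucl N, ℝ)} {ε : ℝ → ℝ} (hε : Tendsto ε (𝓝[>] 0) (𝓝 0))
    (hu : ∀ᶠ t in 𝓝[>] (0 : ℝ), AntisymmIn m (u t) ∧
      ∀ x ∈ sector N m, |u t x - evol m w t x| ≤ ε t * evol m (fun z => |w z|) t x) :
    TendstoInitial u U := by
  intro φ
  have hg := sectorTest_oddPart (m := m) hw.le_dim φ
  obtain ⟨D, hD⟩ := hg.exists_setIntegral_evol_norm_le hw.abs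
  have hev : ∀ᶠ t : ℝ in 𝓝[>] 0, 0 < t ∧ t ≤ 1 :=
    mem_of_superset (Ioc_mem_nhdsGT one_pos) fun t ht => ht
  have hi : ∀ f : C₀(Eucl N, ℝ), IntegrableOn (fun x => f x • oddPart (headCoords N m) φ x)
      (sector N m) := fun f =>
    hg.integrable.integrableOn.bdd_smul ‖f‖ f.continuous.aestronglyMeasurable
      (Eventually.of_forall fun x => f.abs_apply_le_norm x)
  rw [hU]
  have h0 : Tendsto (fun t => (∫ x, (u t x : ℂ) * φ x) -
      ∫ x in sector N m, evol m w t x • oddPart (headCoords N m) φ x) (𝓝[>] 0) (𝓝 0) := by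
    have hb : Tendsto (fun t => |ε t| * |D|) (𝓝[>] 0) (𝓝 0) := by
      simpa using hε.abs.mul_const |D|
    refine squeeze_zero_norm' ?_ hb
    filter_upwards [hev, hu] with t ht hut
    have habs : ∀ x ∈ sector N m, 0 ≤ evol m (fun z => |w z|) t x := fun x hx =>
      (abs_nonneg _).trans (hw.abs_evol_le hw.abs (Eventually.of_forall fun z => le_rfl) ht.1 hx)
    rw [hut.1.integral_mul_eq_setIntegral, ← integral_sub (hi _) (hi _)]
    have hn : IntegrableOn (fun x => evol m (fun z => |w z|) t x * ‖oddPart (headCoords N m) φ x‖)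
        (sector N m) :=
      hg.integrable.norm.integrableOn.bdd_mul (c := ‖evol m (fun z => |w z|) t‖)
        (evol m (fun z => |w z|) t).continuous.aestronglyMeasurable
        (Eventually.of_forall fun x => abs_apply_le_norm _ x)
    refine (norm_integral_le_of_norm_le (hn.const_mul |ε t|) ?_).trans ?_
    · filter_upwards [ae_restrict_mem measurableSet_sector] with x hx
      rw [← sub_smul, norm_smul, Real.norm_eq_abs, ← mul_assoc]
      refine mul_le_mul_of_nonneg_right ((hut.2 x hx).trans ?_) (norm_nonneg _)
      exact mul_le_mul_of_nonneg_right (le_abs_self _) (habs x hx)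
    · rw [integral_const_mul]
      exact mul_le_mul_of_nonneg_left ((hD t ht.1 ht.2).trans (le_abs_self D)) (abs_nonneg _)
  simpa using h0.add (hw.tendsto_setIntegral_evol φ)

end Pairing

/-! ### The weight given by the linear evolution -/

section Weight

variable {N m : ℕ} {κ A α K D : ℝ} {w : Eucl N → ℝ}

theorem SingularData.heatWeight (hw : SingularData m κ A w)
    (h0 : ∀ᵐ z ∂volume.restrict (sector N m), 0 ≤ w z) (hD : 0 ≤ D)
    (hB : ∀ t > 0, ‖evol m w t‖ ≤ D * t ^ (-(κ / 2))) (T : ℝ) :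
    HeatWeight m T (fun t x => evol m w t x) fun t => D * t ^ (-(κ / 2)) where
  nonneg t ht x hx := (abs_nonneg _).trans
    (hw.abs_evol_le hw (h0.mono fun z hz => (abs_of_nonneg hz).le) ht.1 hx)
  le t ht x _ := (le_abs_self _).trans ((abs_apply_le_norm _ x).trans (hB t ht.1))
  bound_nonneg t ht := mul_nonneg hD (Real.rpow_nonneg ht.1.le _)
  cont := continuousOn_const.mul
    (continuousOn_id.rpow_const fun t ht => Or.inl (ne_of_gt ht.1))
  heat_le σ t hσ hσt _ f hf r _ h x hx := by
    have hodd : AntisymmIn m (r • evol m w σ : C₀(Eucl N, ℝ)) := fun i hi y => by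
      rw [ZeroAtInftyContinuousMap.smul_apply, ZeroAtInftyContinuousMap.smul_apply,
        hw.evol_antisymmIn hσ i hi y, smul_neg]
    refine (abs_heatOp_apply_le hf hodd h hx).trans_eq ?_
    rw [map_smul, hw.heatOp_evol (by linarith) hσ, sub_add_cancel]
    rfl

theorem lipRate_eq (hK : 0 ≤ K) (hD : 0 ≤ D) {σ : ℝ} (hσ : 0 < σ) :
    lipRate α K (fun t => D * t ^ (-(κ / 2))) σ =
      (α + 1) * (K * D) ^ α * σ ^ (-(α * κ / 2)) := by
  rw [lipRate, ← mul_assoc K, Real.mul_rpow (by positivity) (by positivity), ← Real.rpow_mul hσ.le,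
    mul_assoc]
  congr 3
  ring

theorem intervalIntegrable_lipRate (hK : 0 ≤ K) (hD : 0 ≤ D) (hκ : α * κ / 2 < 1) {T : ℝ}
    (hT : 0 ≤ T) :
    IntervalIntegrable (lipRate α K fun t => D * t ^ (-(κ / 2))) volume 0 T := by
  have h := (intervalIntegral.intervalIntegrable_rpow' (a := 0) (b := T)
    (r := -(α * κ / 2)) (by linarith)).const_mul ((α + 1) * (K * D) ^ α)
  refine h.congr fun σ hσ => ?_
  rw [uIoc_of_le hT] at hσ
  exact (lipRate_eq hK hD hσ.1).symm

theorem integral_lipRate (hK : 0 ≤ K) (hD : 0 ≤ D) (hκ : α * κ / 2 < 1) {T : ℝ} (hT : 0 ≤ T) :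
    ∫ σ in 0..T, lipRate α K (fun t => D * t ^ (-(κ / 2))) σ =
      (α + 1) * (K * D) ^ α * (T ^ (1 - α * κ / 2) / (1 - α * κ / 2)) := by
  have h : ∫ σ in 0..T, lipRate α K (fun t => D * t ^ (-(κ / 2))) σ =
      ∫ σ in 0..T, (α + 1) * (K * D) ^ α * σ ^ (-(α * κ / 2)) :=
    intervalIntegral.integral_congr_ae (Eventually.of_forall fun σ hσ => by
      rw [uIoc_of_le hT] at hσ
      exact lipRate_eq hK hD hσ.1)
  rw [h, intervalIntegral.integral_const_mul, integral_rpow (Or.inl (by linarith)),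
    Real.zero_rpow (by linarith), sub_zero, neg_add_eq_sub]

theorem tendsto_integral_lipRate (hK : 0 ≤ K) (hD : 0 ≤ D) (hκ : α * κ / 2 < 1) :
    Tendsto (fun T => ∫ σ in 0..T, lipRate α K (fun t => D * t ^ (-(κ / 2))) σ) (𝓝[>] 0)
      (𝓝 0) := by
  have hc : ContinuousAt (fun T : ℝ => (α + 1) * (K * D) ^ α *
      (T ^ (1 - α * κ / 2) / (1 - α * κ / 2))) 0 :=
    continuousAt_const.mul ((Real.continuousAt_rpow_const _ _ (Or.inr (by linarith))).div_const _)
  have h := hc.tendsto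
  simp only [Real.zero_rpow (show 1 - α * κ / 2 ≠ 0 by linarith), zero_div, mul_zero] at h
  refine (h.mono_left nhdsWithin_le_nhds).congr' ?_
  filter_upwards [self_mem_nhdsWithin] with T hT
  exact (integral_lipRate hK hD hκ (le_of_lt hT)).symm

end Weight

/-! ### Mild solutions in terms of the semigroup on `C₀` -/

section Convert

variable {N : ℕ} {a α : ℝ} {U : 𝓢'(Eucl N, ℂ)} {L u : ℝ → C₀(Eucl N, ℝ)} {J : Set ℝ}

theorem heatFun_nonlin_eq (hα : 0 < α) (f : C₀(Eucl N, ℝ)) {s : ℝ} (hs : 0 < s) (x : Eucl N) :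
    heatFun s (nonlin α f) x = heatOp s (nonlinOp hα f) x := by
  rw [heatOp_apply_eq_heatFun hs, coe_nonlinOp]

theorem integrableOn_iSup_heatFun_iff (hα : 0 < α) {t : ℝ} (hu : ContinuousOn u (Ioc 0 t))
    (ht : 0 < t) :
    IntegrableOn (fun σ => ⨆ x, |heatFun (t - σ) (nonlin α (u σ)) x|) (Ioo 0 t) ↔
      IntervalIntegrable (fun σ => heatOp (t - σ) (nonlinOp hα (u σ))) volume 0 t := by
  have hc : ContinuousOn (fun σ => heatOp (t - σ) (nonlinOp hα (u σ))) (Ioo 0 t) :=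
    (continuousOn_heatOp_sub ((continuous_nonlinOp hα).comp_continuousOn hu) t).mono
      Ioo_subset_Ioc_self
  rw [intervalIntegrable_iff_integrableOn_Ioo_of_le ht.le]
  have h1 : IntegrableOn (fun σ => ⨆ x, |heatFun (t - σ) (nonlin α (u σ)) x|) (Ioo 0 t) ↔
      IntegrableOn (fun σ => ‖heatOp (t - σ) (nonlinOp hα (u σ))‖) (Ioo 0 t) := by
    refine integrableOn_congr_fun (fun σ hσ => ?_) measurableSet_Ioo
    rw [norm_eq_iSup_abs]
    simp_rw [heatFun_nonlin_eq hα _ (sub_pos.2 hσ.2)]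
  rw [h1]
  exact integrable_norm_iff (hc.aestronglyMeasurable measurableSet_Ioo)

theorem setIntegral_heatFun_eq (hα : 0 < α) {t : ℝ} (ht : 0 < t)
    (hi : IntervalIntegrable (fun σ => heatOp (t - σ) (nonlinOp hα (u σ))) volume 0 t)
    (x : Eucl N) :
    ∫ σ in Ioo 0 t, heatFun (t - σ) (nonlin α (u σ)) x = duhamel hα u t x := by
  rw [duhamel, intervalIntegral_apply hi, intervalIntegral.integral_of_le ht.le,
    integral_Ioc_eq_integral_Ioo]
  refine setIntegral_congr_fun measurableSet_Ioo fun σ hσ => ?_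
  exact heatFun_nonlin_eq hα _ (sub_pos.2 hσ.2) x

theorem isMildSolution_iff (hα : 0 < α) (hL : ∀ t > 0, ∀ x, heatDist t U x = (L t x : ℂ))
    (hJ : ∀ t ∈ J, 0 < t) (hJ' : ∀ t ∈ J, Ioc 0 t ⊆ J) :
    IsMildSolution a α U J u ↔ MildSol hα a L J u := by
  constructor
  · intro h
    have hi : ∀ t ∈ J, IntervalIntegrable (fun σ => heatOp (t - σ) (nonlinOp hα (u σ)))
        volume 0 t := fun t ht =>
      (integrableOn_iSup_heatFun_iff hα (h.cont.mono (hJ' t ht)) (hJ t ht)).1 (h.abs_conv t ht)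
    refine ⟨h.cont, hi, fun t ht => ?_⟩
    ext x
    have := h.eqn t ht x
    rw [hL t (hJ t ht), setIntegral_heatFun_eq hα (hJ t ht) (hi t ht)] at this
    exact_mod_cast this
  · intro h
    refine ⟨h.cont, fun t ht => (integrableOn_iSup_heatFun_iff hα (h.cont.mono (hJ' t ht))
      (hJ t ht)).2 (h.integrable t ht), fun t ht x => ?_⟩
    rw [hL t (hJ t ht), setIntegral_heatFun_eq hα (hJ t ht) (h.integrable t ht), h.eqn t ht]
    rw [← Complex.ofReal_add]
    rfl

end Convert

/-! ### Solutions in the sector class -/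

/-- Initial data dominated by a multiple of `ψ₀` on the sector, together with the associated
tempered distribution. -/
structure SectorDatum {N m : ℕ} (hm : m ≤ N) (γ C : ℝ) (w : Eucl N → ℝ) (U : 𝓢'(Eucl N, ℂ)) :
    Prop where
  one_le : 1 ≤ m
  gamma_pos : 0 < γ
  gamma_lt : γ < N
  nonneg : 0 ≤ C
  meas : AEStronglyMeasurable w (volume.restrict (sector N m))
  le : ∀ᵐ z ∂volume.restrict (sector N m), |w z| ≤ C * psiZero hm γ z
  pairing : ∀ φ : 𝓢(Eucl N, ℂ),
    U φ = ∫ y in sector N m, (w y : ℂ) * oddPart (headCoords N m) φ y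

/-- The constant in the bound for `ψ₀`. -/
noncomputable def psiConst (m : ℕ) (γ : ℝ) : ℝ := ∏ j ∈ Finset.range m, (γ + 2 * j)

namespace SectorDatum

variable {N m : ℕ} {hm : m ≤ N} {γ C a α : ℝ} {w : Eucl N → ℝ} {U : 𝓢'(Eucl N, ℂ)}
  {u v : ℝ → C₀(Eucl N, ℝ)} {J : Set ℝ} {T : ℝ}

theorem psi (hd : SectorDatum hm γ C w U) : SingularData m (γ + m) (psiConst m γ) (psiZero hm γ) :=
  singularData_psiZero hd.one_le hm hd.gamma_pos hd.gamma_lt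

theorem singular (hd : SectorDatum hm γ C w U) : SingularData m (γ + m) (C * psiConst m γ) w where
  __ := hd.psi.const_mul hd.nonneg
  meas := hd.meas
  le := by
    filter_upwards [hd.le, hd.psi.le] with z h1 h2
    rw [mul_assoc]
    exact h1.trans (mul_le_mul_of_nonneg_left ((le_abs_self _).trans h2) hd.nonneg)

theorem const_mul (hd : SectorDatum hm γ C w U) {l : ℝ} (hl : 0 ≤ l) :
    SectorDatum hm γ (l * C) (fun z => l * w z) ((l : ℂ) • U) where
  __ := hd
  nonneg := mul_nonneg hl hd.nonneg
  meas := hd.meas.const_mul l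
  le := by
    filter_upwards [hd.le] with z hz
    rw [abs_mul, abs_of_nonneg hl, mul_assoc]
    exact mul_le_mul_of_nonneg_left hz hl
  pairing φ := by
    have h : ((l : ℂ) • U) φ = (l : ℂ) * U φ := rfl
    rw [h, hd.pairing, ← integral_const_mul]
    congr 1
    ext y
    push_cast
    ring

theorem isMildSolution_iff (hd : SectorDatum hm γ C w U) (hα : 0 < α) (hJ : ∀ t ∈ J, 0 < t)
    (hJ' : ∀ t ∈ J, Ioc 0 t ⊆ J) :
    IsMildSolution a α U J u ↔ MildSol hα a (evol m w) J u :=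
  _root_.isMildSolution_iff hα (fun _ ht x => hd.singular.heatDist_eq hd.pairing ht x) hJ hJ'

theorem mildSol (hd : SectorDatum hm γ C w U) (hα : 0 < α)
    (hu : IsSectorSolution hm γ a α U (Ioc 0 T) u) : MildSol hα a (evol m w) (Ioc 0 T) u :=
  (hd.isMildSolution_iff hα (fun _ ht => ht.1) fun _ ht => Ioc_subset_Ioc_right ht.2).1
    hu.toIsMildSolution

theorem heatOp_evol (hd : SectorDatum hm γ C w U) (s t : ℝ) (hs : 0 ≤ s) (ht : 0 < t) :
    heatOp s (evol m w t) = evol m w (s + t) := hd.singular.heatOp_evol hs ht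

theorem bigPsi_nonneg (hd : SectorDatum hm γ C w U) {t : ℝ} (ht : 0 < t) {x : Eucl N}
    (hx : x ∈ sector N m) : 0 ≤ bigPsi hm γ t x := by
  rw [bigPsi]
  refine setIntegral_nonneg measurableSet_sector fun y hy => ?_
  exact mul_nonneg (sectorKernel_pos ht hx hy).le (psiZero_nonneg hd.one_le hm hd.gamma_pos hy)

theorem eq_of_isSectorSolution (hd : SectorDatum hm γ C w U) (hα : 0 < α)
    (hκ : α * (γ + m) / 2 < 1) (ha : |a| ≤ 1) (hu : IsSectorSolution hm γ a α U (Ioc 0 T) u)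
    (hv : IsSectorSolution hm γ a α U (Ioc 0 T) v) : ∀ t ∈ Ioc 0 T, u t = v t := by
  obtain ⟨τ₁, hτ₁, M₁, hM₁⟩ := hu.bound
  obtain ⟨τ₂, hτ₂, M₂, hM₂⟩ := hv.bound
  obtain ⟨B, hB0, hB⟩ := exists_norm_evol_le (N := N) (m := m) (κ := γ + m)
  have hP := hd.psi.nonneg
  set K : ℝ := max |M₁| |M₂| with hK
  have hK0 : 0 ≤ K := (abs_nonneg _).trans (le_max_left _ _)
  have hD0 : 0 ≤ B * psiConst m γ := by positivity
  have hsm := (tendsto_integral_lipRate hK0 hD0 hκ).eventually_le_const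
    (show (0 : ℝ) < 1 / 2 by norm_num)
  obtain ⟨δ, hδ0, hδ⟩ := (hsm.and (Ioc_mem_nhdsGT (lt_min hτ₁ hτ₂))).exists
  have hδpos : 0 < δ := hδ.1
  have hδ1 : δ ≤ τ₁ := hδ.2.trans (min_le_left _ _)
  have hδ2 : δ ≤ τ₂ := hδ.2.trans (min_le_right _ _)
  have hmu := hd.mildSol hα hu
  have hmv := hd.mildSol hα hv
  refine hmu.eq_of_eq_initially ha hmv hd.heatOp_evol hδpos fun t ht htδ => ?_
  have hT0 : 0 < T := ht.1.trans_le ht.2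
  have hsub : Ioc 0 (min δ T) ⊆ Ioc 0 T := Ioc_subset_Ioc_right (min_le_right _ _)
  have hw := hd.psi.heatWeight
    ((ae_restrict_mem measurableSet_sector).mono fun z hz =>
      psiZero_nonneg hd.one_le hm hd.gamma_pos hz) hD0
    (fun t ht => hB _ _ hd.psi t ht) (min δ T)
  have hq := intervalIntegrable_lipRate hK0 hD0 hκ (le_min hδpos.le hT0.le)
  have hq' := intervalIntegrable_lipRate hK0 hD0 hκ hδpos.le
  have hwδ := hd.psi.heatWeight
    ((ae_restrict_mem measurableSet_sector).mono fun z hz =>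
      psiZero_nonneg hd.one_le hm hd.gamma_pos hz) hD0
    (fun t ht => hB _ _ hd.psi t ht) δ
  have hsmall := (hwδ.integral_lipRate_le hα hK0 hq'
    ⟨lt_min hδpos hT0, min_le_left _ _⟩).trans hδ0
  have hcurve : ∀ {z : ℝ → C₀(Eucl N, ℝ)} {τ M : ℝ}, IsSectorSolution hm γ a α U (Ioc 0 T) z →
      δ ≤ τ → |M| ≤ K →
      (∀ t ∈ Ioc 0 T, t ≤ τ → ∀ x ∈ sector N m, |z t x| ≤ M * bigPsi hm γ t x) →
      WeightedCurve m (min δ T) (fun t x => evol m (psiZero hm γ) t x) K z :=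
    fun {z τ M} hz hτ hM hb =>
      { cont := hz.cont.mono hsub
        antisymm := fun t ht => hz.antisymm t (hsub ht)
        bound := fun t ht x hx => by
          refine (hb t (hsub ht) ((ht.2.trans (min_le_left _ _)).trans hτ) x hx).trans ?_
          rw [← bigPsi_eq_evol hd.one_le hm hd.gamma_pos hd.gamma_lt ht.1]
          exact mul_le_mul_of_nonneg_right ((le_abs_self _).trans hM)
            (hd.bigPsi_nonneg ht.1 hx) }
  exact hw.eq_of_mildSol hK0 hq hsmall ha (hcurve hu hδ1 (le_max_left _ _) hM₁)
    (hcurve hv hδ2 (le_max_right _ _) hM₂) (hmu.mono hsub) (hmv.mono hsub) t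
    ⟨ht.1, le_min htδ ht.2⟩

/-- Continuation of a solution, by a time depending only on the size of its final value. -/
theorem exists_extension (hd : SectorDatum hm γ C w U) (hα : 0 < α) {R : ℝ} (hR : 0 ≤ R) :
    ∃ δ > 0, ∀ a : ℝ, |a| ≤ 1 → ∀ T > 0, ∀ u, IsSectorSolution hm γ a α U (Ioc 0 T) u →
      ‖u T‖ ≤ R → ∃ v, IsSectorSolution hm γ a α U (Ioc 0 (T + δ)) v ∧ ∀ t ≤ T, v t = u t := by
  obtain ⟨δ, hδ, hloc⟩ := exists_local_mildSol (N := N) (m := m) hα hR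
  refine ⟨δ, hδ, fun a ha T hT u hu huR => ?_⟩
  obtain ⟨v, hv, hvodd, hv0⟩ := hloc a ha (u T) (hu.antisymm T ⟨hT, le_rfl⟩) huR
  have hz := (hd.mildSol hα hu).concat hT hd.heatOp_evol hv hv0
  obtain ⟨τ, hτ, M, hM⟩ := hu.bound
  refine ⟨_, { toIsMildSolution := (hd.isMildSolution_iff hα (fun _ ht => ht.1) fun _ ht =>
      Ioc_subset_Ioc_right ht.2).2 hz, antisymm := fun t ht => ?_, bound := ?_ },
    fun t ht => if_pos ht⟩
  · by_cases htT : t ≤ T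
    · simp only [if_pos htT]
      exact hu.antisymm t ⟨ht.1, htT⟩
    · simp only [if_neg htT]
      exact hvodd _ ⟨by linarith, by linarith [ht.2]⟩
  · refine ⟨min τ T, lt_min hτ hT, M, fun t ht htτ x hx => ?_⟩
    have htT : t ≤ T := htτ.trans (min_le_right _ _)
    simp only [if_pos htT]
    exact hM t ⟨ht.1, htT⟩ (htτ.trans (min_le_left _ _)) x hx

theorem ofReal_le_maxTime (hT : 0 < T) (hu : IsSectorSolution hm γ a α U (Ioc 0 T) u) :
    ENNReal.ofReal T ≤ maxTime hm γ a α U :=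
  le_iSup₂_of_le T ⟨hT, u, hu⟩ le_rfl

theorem ofReal_lt_maxTime (hd : SectorDatum hm γ C w U) (hα : 0 < α) (ha : |a| ≤ 1) (hT : 0 < T)
    (hu : IsSectorSolution hm γ a α U (Ioc 0 T) u) : ENNReal.ofReal T < maxTime hm γ a α U := by
  obtain ⟨δ, hδ, h⟩ := hd.exists_extension hα (norm_nonneg (u T))
  obtain ⟨v, hv, -⟩ := h a ha T hT u hu le_rfl
  refine lt_of_lt_of_le ?_ (ofReal_le_maxTime (by positivity) hv)
  exact (ENNReal.ofReal_lt_ofReal_iff (by positivity)).2 (by linarith)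

theorem _root_.IsSectorSolution.mono {J' : Set ℝ} (hu : IsSectorSolution hm γ a α U J u)
    (h : J' ⊆ J) : IsSectorSolution hm γ a α U J' u where
  cont := hu.cont.mono h
  abs_conv t ht := hu.abs_conv t (h ht)
  eqn t ht := hu.eqn t (h ht)
  antisymm t ht := hu.antisymm t (h ht)
  bound := by
    obtain ⟨τ, hτ, M, hM⟩ := hu.bound
    exact ⟨τ, hτ, M, fun t ht => hM t (h ht)⟩

/-- The maximal solution. -/
theorem exists_maximal (hd : SectorDatum hm γ C w U) (hα : 0 < α) (hκ : α * (γ + m) / 2 < 1)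
    (ha : |a| ≤ 1) (hT : 0 < T) (hv : IsSectorSolution hm γ a α U (Ioc 0 T) v) :
    ∃ u, IsSectorSolution hm γ a α U {t | 0 < t ∧ ENNReal.ofReal t < maxTime hm γ a α U} u ∧
      ∀ t ∈ Ioc 0 T, u t = v t := by
  set J : Set ℝ := {t | 0 < t ∧ ENNReal.ofReal t < maxTime hm γ a α U} with hJ
  have hex : ∀ t, ∃ S, ∃ z, t ∈ J → t < S ∧ IsSectorSolution hm γ a α U (Ioc 0 S) z := fun t => by
    by_cases ht : t ∈ J
    · obtain ⟨S, hS⟩ := lt_iSup_iff.1 ht.2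
      obtain ⟨⟨hS0, z, hz⟩, hS2⟩ := lt_iSup_iff.1 hS
      exact ⟨S, z, fun _ => ⟨(ENNReal.ofReal_lt_ofReal_iff hS0).1 hS2, hz⟩⟩
    · exact ⟨0, fun _ => 0, fun h => absurd h ht⟩
  choose S z hz using hex
  have hJ' : ∀ t ∈ J, Ioc 0 t ⊆ J := fun t ht s hs =>
    ⟨hs.1, (ENNReal.ofReal_le_ofReal hs.2).trans_lt ht.2⟩
  have hSJ : ∀ S' z', IsSectorSolution hm γ a α U (Ioc 0 S') z' → Ioc 0 S' ⊆ J :=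
    fun S' z' hz' s hs => ⟨hs.1, hd.ofReal_lt_maxTime hα ha hs.1
      (hz'.mono (Ioc_subset_Ioc_right hs.2))⟩
  have heq : ∀ S' z', IsSectorSolution hm γ a α U (Ioc 0 S') z' → ∀ s ∈ Ioc 0 S',
      z s s = z' s := fun S' z' hz' s hs => by
    obtain ⟨h1, h2⟩ := hz s (hSJ S' z' hz' hs)
    exact hd.eq_of_isSectorSolution hα hκ ha (h2.mono (Ioc_subset_Ioc_right h1.le))
      (hz'.mono (Ioc_subset_Ioc_right hs.2)) s ⟨hs.1, le_rfl⟩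
  refine ⟨fun s => z s s, { toIsMildSolution := ?_, antisymm := fun t ht => ?_, bound := ?_ },
    heq T v hv⟩
  · have hms : ∀ t ∈ J, MildSol hα a (evol m w) (Ioc 0 (S t)) fun s => z s s := fun t ht =>
      (hd.mildSol hα (hz t ht).2).congr (heq _ _ (hz t ht).2)
    have hmem : ∀ t ∈ J, t ∈ Ioc 0 (S t) := fun t ht => ⟨ht.1, (hz t ht).1.le⟩
    refine (hd.isMildSolution_iff hα (fun _ ht => ht.1) hJ').2
      ⟨fun t ht => ?_, fun t ht => (hms t ht).integrable t (hmem t ht),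
        fun t ht => (hms t ht).eqn t (hmem t ht)⟩
    have hn : Ioc 0 (S t) ∈ 𝓝 t :=
      mem_of_superset (Ioo_mem_nhds ht.1 (hz t ht).1) Ioo_subset_Ioc_self
    exact (((hms t ht).cont t (hmem t ht)).continuousAt hn).continuousWithinAt
  · exact (hz t ht).2.antisymm t ⟨ht.1, (hz t ht).1.le⟩
  · obtain ⟨τ, hτ, M, hM⟩ := hv.bound
    refine ⟨min τ T, lt_min hτ hT, M, fun t ht htτ x hx => ?_⟩
    have htT : t ∈ Ioc 0 T := ⟨ht.1, htτ.trans (min_le_right _ _)⟩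
    simp only [heq T v hv t htT]
    exact hM t htT (htτ.trans (min_le_left _ _)) x hx

/-- Local existence, on an interval determined by the size of the data. -/
theorem exists_solution (hd : SectorDatum hm γ C w U) (hα : 0 < α) (hκ : α * (γ + m) / 2 < 1)
    (ha : |a| ≤ 1) {D : ℝ} (hD : 0 ≤ D)
    (hB : ∀ t > 0, ‖evol m (fun z => |w z|) t‖ ≤ D * t ^ (-((γ + m) / 2))) (hT : 0 < T)
    (hsmall : ∫ σ in 0..T, lipRate α 2 (fun t => D * t ^ (-((γ + m) / 2))) σ ≤ 1 / 4) :
    ∃ u, IsSectorSolution hm γ a α U (Ioc 0 T) u ∧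
      (∀ t ∈ Ioc 0 T, ∀ x ∈ sector N m,
        |u t x - evol m w t x| ≤ 1 / 2 * evol m (fun z => |w z|) t x) ∧
      ∀ t ∈ Ioc 0 T, ∀ x ∈ sector N m, |u t x - evol m w t x| ≤
        (∫ σ in 0..t, lipRate α 2 (fun t => D * t ^ (-((γ + m) / 2))) σ) * 2 *
          evol m (fun z => |w z|) t x := by
  have hs := hd.singular
  have hw := hs.abs.heatWeight (Eventually.of_forall fun z => abs_nonneg (w z)) hD hB T
  have hq := intervalIntegrable_lipRate zero_le_two hD hκ hT.le
  have hL : WeightedCurve m T (fun t x => evol m (fun z => |w z|) t x) 1 (evol m w) :=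
    { cont := hs.continuousOn_evol.mono fun t ht => ht.1
      antisymm := fun t ht => hs.evol_antisymmIn ht.1
      bound := fun t ht x hx => by
        rw [one_mul]
        exact hs.abs_evol_le hs.abs (Eventually.of_forall fun z => le_rfl) ht.1 hx }
  obtain ⟨u, hu, hu2, huL⟩ := hw.exists_mildSol hα hq hsmall ha hL
  refine ⟨u, { toIsMildSolution := (hd.isMildSolution_iff hα (fun _ ht => ht.1) fun _ ht =>
    Ioc_subset_Ioc_right ht.2).2 hu, antisymm := hu2.antisymm, bound := ?_ }, huL, ?_⟩
  · refine ⟨1, one_pos, 2 * C, fun t ht _ x hx => (hu2.bound t ht x hx).trans ?_⟩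
    rw [mul_assoc]
    refine mul_le_mul_of_nonneg_left ?_ zero_le_two
    refine (le_abs_self _).trans ((hs.abs.abs_evol_le (hd.psi.const_mul hd.nonneg) ?_ ht.1
      hx).trans_eq ?_)
    · filter_upwards [hd.le] with z hz
      rwa [abs_abs]
    · rw [(hd.psi.const_mul hd.nonneg).evol_apply ht.1, bigPsi, ← integral_const_mul]
      congr 1
      ext y
      ring
  · intro t ht x hx
    have h1 := hw.abs_duhamel_le (hα := hα) zero_le_two hu2 hq ht hx
    have h2 : u t x - evol m w t x = a * duhamel hα u t x := by
      rw [hu.eqn t ht]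
      simp
    rw [h2, abs_mul]
    exact (mul_le_of_le_one_left (abs_nonneg _) ha).trans h1

/-- In the absorbing case solutions are global. -/
theorem maxTime_eq_top (hd : SectorDatum hm γ C w U) (hα : 0 < α) (hT : 0 < T)
    (hu : IsSectorSolution hm γ (-1) α U (Ioc 0 T) u) : maxTime hm γ (-1) α U = ⊤ := by
  obtain ⟨δ, hδ, hext⟩ := hd.exists_extension hα (norm_nonneg (u T))
  have key : ∀ n : ℕ, ∃ v, IsSectorSolution hm γ (-1) α U (Ioc 0 (T + n * δ)) v ∧ v T = u T := by
    intro n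
    induction n with
    | zero => exact ⟨u, by simpa using hu, rfl⟩
    | succ n ih =>
      obtain ⟨v, hv, hvT⟩ := ih
      have hn : 0 ≤ n * δ := by positivity
      have hle := (hd.mildSol hα hv).norm_le_of_absorption hd.heatOp_evol hT
        (le_add_of_nonneg_right hn) le_rfl
      rw [hvT] at hle
      obtain ⟨z, hz, hzv⟩ := hext (-1) (by simp) (T + n * δ) (by positivity) v hv hle
      refine ⟨z, ?_, (hzv T (le_add_of_nonneg_right hn)).trans hvT⟩
      have e : T + ((n + 1 : ℕ) : ℝ) * δ = T + n * δ + δ := by push_cast; ring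
      rwa [e]
  refine ENNReal.eq_top_of_forall_nnreal_le fun r => ?_
  obtain ⟨n, hn⟩ := exists_nat_ge ((r : ℝ) / δ)
  obtain ⟨v, hv, -⟩ := key n
  refine le_trans ?_ (ofReal_le_maxTime (by positivity) hv)
  rw [← ENNReal.ofReal_coe_nnreal]
  refine ENNReal.ofReal_le_ofReal ?_
  rw [div_le_iff₀ hδ] at hn
  linarith

end SectorDatum

namespace SectorDatum

variable {N m : ℕ} {hm : m ≤ N} {γ C α : ℝ} {w : Eucl N → ℝ} {U : 𝓢'(Eucl N, ℂ)}

theorem exists_norm_evol_abs_le (hd : SectorDatum hm γ C w U) : ∃ D > 0, ∀ l > 0, ∀ t > 0,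
    ‖evol m (fun z => |l * w z|) t‖ ≤ l * D * t ^ (-((γ + m) / 2)) := by
  obtain ⟨B, hB0, hB⟩ := exists_norm_evol_le (N := N) (m := m) (κ := γ + m)
  have hC := hd.nonneg
  have hP := hd.psi.nonneg
  refine ⟨B * (C * psiConst m γ) + 1, by positivity, fun l hl t ht => ?_⟩
  refine (hB _ _ (hd.const_mul hl.le).singular.abs t ht).trans ?_
  refine mul_le_mul_of_nonneg_right ?_ (by positivity)
  nlinarith

/-- The lower bound for the life span of solutions with small initial data. -/
theorem exists_le_lifespan (hd : SectorDatum hm γ C w U) (hα : 0 < α)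
    (hκ : α * (γ + m) / 2 < 1) : ∃ c > 0, ∀ l > 0, ENNReal.ofReal c ≤
      ENNReal.ofReal (l ^ (1 / α - (γ + m) / 2)⁻¹) * maxTime hm γ 1 α ((l : ℂ) • U) := by
  obtain ⟨D, hD, hB⟩ := hd.exists_norm_evol_abs_le
  set θ : ℝ := (1 / α - (γ + m) / 2)⁻¹ with hθ
  set q : ℝ := 1 - α * (γ + m) / 2 with hq
  have hq0 : 0 < q := by linarith
  have hθq : θ * q = α := by
    have h1 : 1 / α - (γ + m) / 2 = q / α := by
      rw [hq]; field_simp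
    rw [hθ, h1, inv_div, div_mul_cancel₀ _ hq0.ne']
  set c : ℝ := (q / (4 * ((α + 1) * (2 * D) ^ α))) ^ q⁻¹ with hc
  have hE : 0 < (α + 1) * (2 * D) ^ α := by positivity
  have hc0 : 0 < c := by positivity
  have hcq : c ^ q = q / (4 * ((α + 1) * (2 * D) ^ α)) := Real.rpow_inv_rpow (by positivity) hq0.ne'
  refine ⟨c, hc0, fun l hl => ?_⟩
  have hlθ : 0 < l ^ θ := by positivity
  have hT : 0 < c * l ^ (-θ) := by positivity
  have hsmall : ∫ σ in 0..(c * l ^ (-θ)), lipRate α 2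
      (fun t => l * D * t ^ (-((γ + m) / 2))) σ ≤ 1 / 4 := by
    rw [integral_lipRate zero_le_two (by positivity) hκ hT.le, ← hq,
      Real.mul_rpow hc0.le (by positivity), ← Real.rpow_mul hl.le, neg_mul, hθq, hcq,
      mul_left_comm 2 l D, Real.mul_rpow hl.le (by positivity), Real.rpow_neg hl.le]
    have hlα : 0 < l ^ α := by positivity
    refine le_of_eq ?_
    field_simp
  obtain ⟨u, hu, -⟩ := (hd.const_mul hl.le).exists_solution hα hκ (a := 1) (by simp)
    (by positivity) (hB l hl) hT hsmall
  calc ENNReal.ofReal c = ENNReal.ofReal (l ^ θ) * ENNReal.ofReal (c * l ^ (-θ)) := by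
        rw [← ENNReal.ofReal_mul hlθ.le, mul_left_comm, ← Real.rpow_add hl, add_neg_cancel,
          Real.rpow_zero, mul_one]
    _ ≤ _ := by
        gcongr
        exact ofReal_le_maxTime hT hu

end SectorDatum

theorem mainTheorem1 {N m : ℕ} (hm1 : 1 ≤ m) (hm : m ≤ N) (γ α : ℝ) (hγ0 : 0 < γ)
    (hγN : γ < N) (hα0 : 0 < α) (hα : α < 2 / (γ + m))
    (u₀ : Eucl N → ℝ) (hloc : LocallyIntegrableOn u₀ {0}ᶜ) (hanti : AntisymmInAE m u₀)
    (C : ℝ) (hC : 0 < C)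
    (hbound : ∀ᵐ x, x ∈ sector N m → |u₀ x| ≤ C * psiZero hm γ x) :
    ∃ U₀ : 𝓢'(Eucl N, ℂ), IsTemperedExtension u₀ U₀ ∧
      (∀ a : ℝ, a = 1 ∨ a = -1 →
        -- local solution on `(0,T]`, and its extension to a maximal solution on `(0,T_max)`
        (∃ T > 0, ENNReal.ofReal T < maxTime hm γ a α U₀ ∧
          ∃ u : ℝ → C₀(Eucl N, ℝ),
            IsSectorSolution hm γ a α U₀
              {t | 0 < t ∧ ENNReal.ofReal t < maxTime hm γ a α U₀} u ∧
            TendstoInitial u U₀ ∧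
            ((∀ᵐ x, x ∈ sector N m → 0 ≤ u₀ x) → (¬ ∀ᵐ x, x ∈ sector N m → u₀ x = 0) →
              ∀ t ∈ Ioc 0 T, ∀ x ∈ sector N m, 0 < u t x)) ∧
        -- no solution exists on `(0,T]` if `T ≥ T_max`, and solutions are unique
        (∀ T > 0, (∃ v, IsSectorSolution hm γ a α U₀ (Ioc 0 T) v) →
          ENNReal.ofReal T < maxTime hm γ a α U₀) ∧
        (∀ T > 0, ∀ v w, IsSectorSolution hm γ a α U₀ (Ioc 0 T) v →
          IsSectorSolution hm γ a α U₀ (Ioc 0 T) w → ∀ t ∈ Ioc 0 T, v t = w t)) ∧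
      maxTime hm γ (-1) α U₀ = ⊤ ∧
      0 < liminf (fun l : ℝ => ENNReal.ofReal (l ^ (1 / α - (γ + m) / 2)⁻¹) *
        maxTime hm γ 1 α ((l : ℂ) • U₀)) (𝓝[>] 0) := by
  have hm0 : (0 : ℝ) < γ + m := by positivity
  have hκ : α * (γ + m) / 2 < 1 := by
    rw [lt_div_iff₀ hm0] at hα
    linarith
  have hmeas : AEStronglyMeasurable u₀ := by
    have : Nonempty (Fin N) := ⟨⟨0, by omega⟩⟩
    have : Nontrivial (Eucl N) := inferInstance
    have h1 := hloc.aestronglyMeasurable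
    rwa [Measure.restrict_congr_set (t := univ)
      (by simp), Measure.restrict_univ] at h1
  have hle : ∀ᵐ z ∂volume.restrict (sector N m), |u₀ z| ≤ C * psiZero hm γ z :=
    (ae_restrict_iff' measurableSet_sector).2 hbound
  have hs : SingularData m (γ + m) (C * psiConst m γ) u₀ := by
    have hp := singularData_psiZero hm1 hm hγ0 hγN
    exact { (hp.const_mul hC.le) with
      meas := hmeas.restrict
      le := by
        filter_upwards [hle, hp.le] with z h1 h2
        rw [mul_assoc]
        exact h1.trans (mul_le_mul_of_nonneg_left ((le_abs_self _).trans h2) hC.le) }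
  obtain ⟨U, hU⟩ := hs.exists_distribution
  have hd : SectorDatum hm γ C u₀ U := ⟨hm1, hγ0, hγN, hC.le, hmeas.restrict, hle, hU⟩
  obtain ⟨D, hD, hB⟩ := hd.exists_norm_evol_abs_le
  have hB1 : ∀ t > 0, ‖evol m (fun z => |u₀ z|) t‖ ≤ D * t ^ (-((γ + m) / 2)) := by
    simpa using hB 1 one_pos
  have hrate := tendsto_integral_lipRate (α := α) zero_le_two hD.le hκ
  obtain ⟨T, hTsmall, hT⟩ := ((hrate.eventually_le_const (show (0 : ℝ) < 1 / 4 by norm_num)).and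
    self_mem_nhdsWithin).exists
  have hT0 : 0 < T := hT
  have hsol : ∀ a : ℝ, |a| ≤ 1 → _ := fun a ha =>
    hd.exists_solution (a := a) hα0 hκ ha hD.le hB1 hT0 hTsmall
  refine ⟨U, isTemperedExtension_of_singularData hs hmeas hanti hU, fun a ha => ?_, ?_, ?_⟩
  · have ha1 : |a| ≤ 1 := by rcases ha with rfl | rfl <;> simp
    obtain ⟨v, hv, hvL, hvε⟩ := hsol a ha1
    obtain ⟨u, hu, huv⟩ := hd.exists_maximal hα0 hκ ha1 hT0 hv
    refine ⟨⟨T, hT0, hd.ofReal_lt_maxTime hα0 ha1 hT0 hv, u, hu, ?_, ?_⟩, ?_, ?_⟩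
    · refine hs.tendstoInitial hU (by simpa using hrate.mul_const 2) ?_
      filter_upwards [Ioc_mem_nhdsGT hT0] with t ht
      rw [huv t ht]
      exact ⟨hv.antisymm t ht, hvε t ht⟩
    · intro hpos hne t ht x hx
      rw [← ae_restrict_iff' measurableSet_sector] at hpos hne
      have h1 := hs.evol_pos hpos hne ht.1 hx
      have h2 := (le_abs_self _).trans (hs.abs.abs_evol_le hs
        (hpos.mono fun z hz => by rw [abs_abs, abs_of_nonneg hz]) ht.1 hx)
      have h3 := (abs_le.1 (hvL t ht x hx)).1
      rw [huv t ht]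
      linarith
    · exact fun T' hT' ⟨z, hz⟩ => hd.ofReal_lt_maxTime hα0 ha1 hT' hz
    · exact fun T' _ z z' hz hz' => hd.eq_of_isSectorSolution hα0 hκ ha1 hz hz'
  · obtain ⟨v, hv, -⟩ := hsol (-1) (by simp)
    exact hd.maxTime_eq_top hα0 hT0 hv
  · obtain ⟨c, hc, hcl⟩ := hd.exists_le_lifespan hα0 hκ
    refine (ENNReal.ofReal_pos.2 hc).trans_le (le_liminf_of_le ?_ ?_)
    · isBoundedDefault
    · filter_upwards [self_mem_nhdsWithin] with l hl
      exact hcl l hl
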